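/- Let $0<c<C_0$ and let $q(x,t)$, $(x,t)\in\mathbb R\times\mathbb R$, be a real classical solution of the KdV equation $q_t=6qq_x-q_{xxx}$ whose initial datum $q(\cdot,0)\in C^{11}(\mathbb R)$ satisfies $q(x,0)\to0$ as $x\to+\infty$, $q(x,0)\to-c^2$ as $x\to-\infty$, $$\int_0^\infty e^{C_0x}\bigl(|q(x,0)|+|q(-x,0)+c^2|\bigr)dx<\infty,\qquad \int_{\mathbb R}(x^6+1)|\partial_x^iq(x,0)|\,dx<\infty\quad(1\le i\le 11),$$ where the solution is taken in the usual class: $q(\cdot,t)\in C^3(\mathbb R)$, $\partial_x^nq$ is continuous on $\mathbb R^2$ for $n\le3$, and $\int_0^\infty|x|(|q(x,t)|+|q(-x,t)+c^2|)\,dx$ and $\int_{\mathbb R}|\partial_x^nq(x,t)|\,dx$ ($n=1,2,3$) are finite, locally uniformly in $t$. For $\operatorname{Im}k\ge0$ let $k_1=\sqrt{k^2+c^2}$ be the branch that is analytic with $\operatorname{Im}k_1>0$ in $\mathbb C^U_c=\{\operatorname{Im}k>0\}\setminus(0,ic]$, so that $k_1>0$ on the right side of the cut $[0,ic)$ and $k_1$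 has the sign of $k$ on $\mathbb R$. Let $\phi(k,x,t),\phi_1(k,x,t)$ be the Jost solutions, i.e. the solutions of $-\psi''+q(\cdot,t)\psi=k^2\psi$ with $\lim_{x\to+\infty}e^{-ikx}\phi=1$, $\lim_{x\to-\infty}e^{ik_1x}\phi_1=1$. Let $W=\phi_1\phi'-\phi_1'\phi$, $T=2ik/W$, $T_1=2ik_1/W$, and let $R(k,t)$, $k\in\mathbb R$, be given by $T\phi_1=\overline{\phi}+R\phi$. Assume $W(ic,0)\ne0$. Put $R(k)=R(k,0)$, $\chi(k)=-\lim_{\varepsilon\downarrow0}\overline{T(k+\varepsilon,0)}\,T_1(k+\varepsilon,0)$ for $k\in[0,ic]$, and $\chi(-k)=-\chi(k)$. Then the eigenvalues of $H(0)=-\frac{d^2}{dx^2}+q(\cdot,0)$ (with domain $H^2(\mathbb R)$) are finitely many numbers $-\kappa_1^2,\dots,-\kappa_N^2$ with $c<\kappa_1<\dots<\kappa_N$; let $\gamma_j=\|\phi(i\kappa_j,\cdot,0)\|_{L^2}^{-1}$. For all $x,t\in\mathbb R$ the row vector $$m(k)=\begin{cases}\bigl(T(k,t)\phi_1(k,x,t)e^{ikx},\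 \phi(k,x,t)e^{-ikx}\bigr),&\operatorname{Im}k>0,\ k\notin(0,ic],\\ \bigl(\phi(-k,x,t)e^{ikx},\ T(-k,t)\phi_1(-k,x,t)e^{-ikx}\bigr),&\operatorname{Im}k<0,\ k\notin[-ic,0),\end{cases}$$ solves the following vector Riemann–Hilbert problem. It is meromorphic in $\mathbb C\setminus(\mathbb R\cup[-ic,ic])$, and analytic there except for at most simple poles at the points $\pm i\kappa_j$. With $t\Phi(k)=8ik^3t+2ikx$: 1. On $\mathbb R$, oriented from left to right, and $[ic,-ic]$, oriented from top to bottom, the nontangential limits $m_+$ (from the left of the oriented contour) and $m_-$ (from the right) exist and $m_+(k)=m_-(k)v(k)$ with $$v=\begin{pmatrix}1-|R|^2&-\overline{R}e^{-t\Phi}\\ Re^{t\Phi}&1\end{pmatrix}\ (k\in\mathbb R),\quad v=\begin{pmatrix}1&0\\ \chi e^{t\Phi}&1\end{pmatrix}\ (k\in[ic,0)),\quad v=\begin{pmatrix}1&\chi e^{-t\Phi}\\0&1\end{pmatrix}\ (k\in(0,-ic]).$$ 2. For every $j$ $$\operatorname{Res}_{i\kappa_j}m=\lim_{k\to i\kappa_j}m(k)\begin{pmatrix}0&0\\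 i\gamma_j^2e^{t\Phi(i\kappa_j)}&0\end{pmatrix},\qquad \operatorname{Res}_{-i\kappa_j}m=\lim_{k\to-i\kappa_j}m(k)\begin{pmatrix}0&-i\gamma_j^2e^{t\Phi(i\kappa_j)}\\0&0\end{pmatrix}.$$ 3. $m(-k)=m(k)\begin{pmatrix}0&1\\1&0\end{pmatrix}$. 4. $\lim_{\kappa\to+\infty}m(i\kappa)=(1\ \ 1)$. -/

import Mathlib

open Filter Topology MeasureTheory Complex
open scoped ComplexConjugate Matrix

noncomputable section

namespace SteplikeKdV

/-! ### The Cauchy problem -/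

/-- Steplike initial data: `q₀ ∈ C¹¹`, `q₀ → 0` at `+∞`, `q₀ → -c²` at `-∞`, exponential decay of the
perturbation with rate `C₀`, six moments of the derivatives of order `1, …, 11`. -/
structure IsSteplikeData (c C₀ : ℝ) (q₀ : ℝ → ℝ) : Prop where
  contDiff : ContDiff ℝ 11 q₀
  tendsto_right : Tendsto q₀ atTop (𝓝 0)
  tendsto_left : Tendsto q₀ atBot (𝓝 (-c ^ 2))
  decay : IntegrableOn
    (fun x => Real.exp (C₀ * x) * (|q₀ x| + |q₀ (-x) + c ^ 2|)) (Set.Ioi 0)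
  moments : ∀ i : ℕ, 1 ≤ i → i ≤ 11 →
    Integrable (fun x => (x ^ 6 + 1) * |iteratedDeriv i q₀ x|)

/-- Classical solutions `q x t` of the KdV equation `q_t = 6 q q_x - q_xxx` on `ℝ × ℝ` in the
steplike class: `q(·,t) ∈ C³`, the perturbation of the step has a finite first moment, and
`∂ₓq, ∂ₓ²q, ∂ₓ³q` are integrable, with bounds that are uniform for `t` in compact sets. -/
structure IsKdVSolution (c : ℝ) (q : ℝ → ℝ → ℝ) : Prop where
  contDiff : ∀ t, ContDiff ℝ 3 (fun x => q x t)
  continuous : ∀ n : ℕ, n ≤ 3 →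
    Continuous (fun p : ℝ × ℝ => iteratedDeriv n (fun y => q y p.2) p.1)
  kdv : ∀ x t, HasDerivAt (fun s => q x s)
    (6 * q x t * deriv (fun y => q y t) x - iteratedDeriv 3 (fun y => q y t) x) t
  moment : ∀ τ : ℝ, ∃ M : ℝ, ∀ t, |t| ≤ τ →
    ∫⁻ x in Set.Ioi (0 : ℝ), ENNReal.ofReal (|x| * (|q x t| + |q (-x) t + c ^ 2|))
      ≤ ENNReal.ofReal M
  deriv_integrable : ∀ τ : ℝ, ∃ M : ℝ, ∀ t, |t| ≤ τ → ∀ n : ℕ, 1 ≤ n → n ≤ 3 →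
    ∫⁻ x, ENNReal.ofReal |iteratedDeriv n (fun y => q y t) x| ≤ ENNReal.ofReal M

/-! ### Schrödinger operator, Jost solutions, scattering data of a potential `p` -/

/-- `ψ` is a classical solution of `-ψ'' + p ψ = z ψ` on the line. -/
def Solves (p : ℝ → ℝ) (z : ℂ) (ψ : ℝ → ℂ) : Prop :=
  Differentiable ℝ ψ ∧ ∀ x, HasDerivAt (deriv ψ) (((p x : ℂ) - z) * ψ x) x

/-- `lam` is an eigenvalue of `-d²/dx² + p` on `H²(ℝ) ⊂ L²(ℝ)`. (For continuous `p` an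
eigenfunction has a classical representative.) -/
def IsEigenvalue (p : ℝ → ℝ) (lam : ℝ) : Prop :=
  ∃ ψ : ℝ → ℂ, ψ ≠ 0 ∧ Solves p lam ψ ∧
    MemLp ψ 2 ∧ MemLp (deriv ψ) 2 ∧ MemLp (deriv (deriv ψ)) 2

/-- The right Jost normalization `e^{-ikx} ψ(x) → 1`, `x → +∞`; for `Im k ≥ 0` it determines the
solution `ψ` of the equation with spectral parameter `k²`. -/
def IsJostRight (p : ℝ → ℝ) (k : ℂ) (ψ : ℝ → ℂ) : Prop :=
  Solves p (k ^ 2) ψ ∧ Tendsto (fun x : ℝ => exp (-(I * k * x)) * ψ x) atTop (𝓝 1)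

/-- The left Jost normalization `e^{i k₁ x} ψ(x) → 1`, `x → -∞`, with `k₁² = k² + c²`. -/
def IsJostLeft (c : ℝ) (p : ℝ → ℝ) (k₁ : ℂ) (ψ : ℝ → ℂ) : Prop :=
  Solves p (k₁ ^ 2 - (c : ℂ) ^ 2) ψ ∧ Tendsto (fun x : ℝ => exp (I * k₁ * x) * ψ x) atBot (𝓝 1)

/-- `k₁ = √(k² + c²)`. Off the real axis and the cut `[-ic, ic]` this is the branch with
`Im k₁ > 0`; in the closed upper half plane it is positive on the right side of the cut, and
accordingly has the sign of `k` on the real axis. (Points in the interior of the cut, where the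
two sides differ, are only approached through limits; `k₁ = 0` at `k = ± ic`.) -/
def kOne (c : ℝ) (k : ℂ) : ℂ :=
  if k.im = 0 then
    (if 0 ≤ k.re then (Real.sqrt (k.re ^ 2 + c ^ 2) : ℂ) else -(Real.sqrt (k.re ^ 2 + c ^ 2) : ℂ))
  else I * (-(k ^ 2 + (c : ℂ) ^ 2)) ^ (1 / 2 : ℂ)

/-- The right Jost solution `φ(k, ·)`, for `Im k ≥ 0`. -/
def phi (p : ℝ → ℝ) (k : ℂ) : ℝ → ℂ :=
  Classical.epsilon (IsJostRight p k)

/-- The left Jost solution `φ₁(k, ·)`, for `Im k ≥ 0`. -/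
def phiOne (c : ℝ) (p : ℝ → ℝ) (k : ℂ) : ℝ → ℂ :=
  Classical.epsilon (IsJostLeft c p (kOne c k))

/-- The Wronskian `W(k) = φ₁ φ' - φ₁' φ`; it does not depend on `x` and is evaluated at `0`. -/
def wronskian (c : ℝ) (p : ℝ → ℝ) (k : ℂ) : ℂ :=
  phiOne c p k 0 * deriv (phi p k) 0 - deriv (phiOne c p k) 0 * phi p k 0

/-- The right transmission coefficient. -/
def transT (c : ℝ) (p : ℝ → ℝ) (k : ℂ) : ℂ :=
  2 * I * k / wronskian c p k

/-- The left transmission coefficient. -/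
def transTOne (c : ℝ) (p : ℝ → ℝ) (k : ℂ) : ℂ :=
  2 * I * kOne c k / wronskian c p k

/-- The right reflection coefficient: the number with `T φ₁ = conj φ + R φ`, `k ∈ ℝ`. -/
def reflR (c : ℝ) (p : ℝ → ℝ) (k : ℝ) : ℂ :=
  Classical.epsilon fun r : ℂ =>
    ∀ x : ℝ, transT c p k * phiOne c p k x = conj (phi p k x) + r * phi p k x

/-- `χ(k) = - lim_{ε → +0} conj T(k+ε) T₁(k+ε)` on `[0, ic]`, and `χ(-k) = -χ(k)`. -/
def chi (c : ℝ) (p : ℝ → ℝ) (k : ℂ) : ℂ :=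
  if 0 ≤ k.im then
    -limUnder (𝓝[>] (0 : ℝ)) fun ε : ℝ => conj (transT c p (k + ε)) * transTOne c p (k + ε)
  else
    limUnder (𝓝[>] (0 : ℝ)) fun ε : ℝ => conj (transT c p (-k + ε)) * transTOne c p (-k + ε)

/-- The right normalizing constant `γ = ‖φ(iκ, ·)‖₂⁻¹`. -/
def gammaConst (p : ℝ → ℝ) (κ : ℝ) : ℝ :=
  (Real.sqrt (∫ x : ℝ, ‖phi p (I * κ) x‖ ^ 2))⁻¹

/-! ### The vector function `m` -/

/-- The (row) vector function `m(k, x)` of the potential `p`, for `k ∉ ℝ ∪ [-ic, ic]`. -/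
def mVec (c : ℝ) (p : ℝ → ℝ) (x : ℝ) (k : ℂ) : Fin 2 → ℂ :=
  if 0 < k.im then
    ![transT c p k * phiOne c p k x * exp (I * k * x), phi p k x * exp (-(I * k * x))]
  else
    ![phi p (-k) x * exp (I * k * x), transT c p (-k) * phiOne c p (-k) x * exp (-(I * k * x))]

/-! ### The vector Riemann–Hilbert problem -/

/-- The contour `Σ ∪ Σ_c = ℝ ∪ [ic, -ic]`. -/
def contour (c : ℝ) : Set ℂ :=
  {k | k.im = 0} ∪ {k | k.re = 0 ∧ |k.im| ≤ c}

/-- Unit normal pointing to the positive (left) side of the contour: `ℝ` is oriented from left to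
right and `[ic, -ic]` from top to bottom. -/
def plusNormal (k : ℂ) : ℂ :=
  if k.im = 0 then I else 1

/-- The cone with vertex `k` and axis `n` (`|n| = 1`); the aperture tends to a half plane as
`a → ∞`. -/
def cone (k n : ℂ) (a : ℝ) : Set ℂ :=
  {z | 0 < ((z - k) * conj n).re ∧ |((z - k) * conj n).im| ≤ a * ((z - k) * conj n).re}

/-- `l` is the nontangential limit of `f`, a function on `D`, at `k` from the side given by `n`. -/
def HasNTLimit (D : Set ℂ) (f : ℂ → Fin 2 → ℂ) (k n : ℂ) (l : Fin 2 → ℂ) : Prop :=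
  ∀ a : ℝ, 0 < a → Tendsto f (𝓝[D ∩ cone k n a] k) (𝓝 l)

/-- `t Φ(k) = 8 i k³ t + 2 i k x`, i.e. `Φ(k) = 8 i k³ + 2 i k x / t` if `t ≠ 0`. -/
def tPhi (x t : ℝ) (k : ℂ) : ℂ :=
  8 * I * k ^ 3 * t + 2 * I * k * x

/-- The jump matrix `v(k)` on `ℝ`, on the part of the cut in the upper half plane, and on the part
in the lower half plane. -/
def jump (R : ℝ → ℂ) (χ : ℂ → ℂ) (x t : ℝ) (k : ℂ) : Matrix (Fin 2) (Fin 2) ℂ :=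
  if k.im = 0 then
    !![1 - (‖R k.re‖ : ℂ) ^ 2, -(conj (R k.re) * exp (-tPhi x t k));
       R k.re * exp (tPhi x t k), 1]
  else if 0 < k.im then
    !![1, 0; χ k * exp (tPhi x t k), 1]
  else
    !![1, χ k * exp (-tPhi x t k); 0, 1]

/-- The residue condition `Res_p m = lim_{k → p} m(k) A` at a pole of order at most one, where
`Res_p m = lim_{k → p} (k - p) m(k)`; both limits exist. -/
def HasResidueCondition (m : ℂ → Fin 2 → ℂ) (p : ℂ) (A : Matrix (Fin 2) (Fin 2) ℂ) : Prop :=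
  ∃ l : Fin 2 → ℂ, Tendsto (fun k => (k - p) • m k) (𝓝[≠] p) (𝓝 l) ∧
    Tendsto (fun k => m k ᵥ* A) (𝓝[≠] p) (𝓝 l)

/-- The set of the points `± i κ_j`. -/
def poleSet {N : ℕ} (κ : Fin N → ℝ) : Set ℂ :=
  {k | ∃ j, k = I * κ j ∨ k = -(I * κ j)}

/-- `m` solves the vector Riemann–Hilbert problem with data `R, χ, (κ_j, γ_j)` and parameters
`x, t`. -/
structure IsRHPSolution (c : ℝ) (R : ℝ → ℂ) (χ : ℂ → ℂ) {N : ℕ} (κ γ : Fin N → ℝ) (x t : ℝ)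
    (m : ℂ → Fin 2 → ℂ) : Prop where
  analytic : ∀ i, AnalyticOnNhd ℂ (fun k => m k i) ((contour c)ᶜ \ poleSet κ)
  meromorphic : ∀ i, MeromorphicOn (fun k => m k i) (contour c)ᶜ
  simple_poles : ∀ i, ∀ p ∈ poleSet κ, (-1 : ℤ) ≤ meromorphicOrderAt (fun k => m k i) p
  jump_condition : ∀ k ∈ contour c, ∃ mp mm : Fin 2 → ℂ,
    HasNTLimit (contour c)ᶜ m k (plusNormal k) mp ∧
    HasNTLimit (contour c)ᶜ m k (-plusNormal k) mm ∧
    mp = mm ᵥ* jump R χ x t k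
  pole_upper : ∀ j, HasResidueCondition m (I * κ j)
    !![0, 0; I * (γ j : ℂ) ^ 2 * exp (tPhi x t (I * κ j)), 0]
  pole_lower : ∀ j, HasResidueCondition m (-(I * κ j))
    !![0, -(I * (γ j : ℂ) ^ 2 * exp (tPhi x t (I * κ j))); 0, 0]
  symmetry : ∀ k ∈ (contour c)ᶜ \ poleSet κ, m (-k) = m k ᵥ* !![0, 1; 1, 0]
  normalization : Tendsto (fun s : ℝ => m (I * s)) atTop (𝓝 ![1, 1])

end SteplikeKdV

end

noncomputable section

namespace SteplikeKdV

/-! ### General facts of real and complex analysis -/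

lemma hasDerivAt_integral_Ioi {E : Type*} [NormedAddCommGroup E] [NormedSpace ℝ E]
    [CompleteSpace E] {g : ℝ → E} (hg : Continuous g)
    (hi : ∀ a, IntegrableOn g (Set.Ioi a)) (x : ℝ) :
    HasDerivAt (fun x => ∫ y in Set.Ioi x, g y) (-g x) x := by
  have h1 : (fun x => ∫ y in Set.Ioi x, g y) =
      fun x => (∫ y in Set.Ioi 0, g y) - ∫ y in (0 : ℝ)..x, g y := by
    ext x
    rw [← intervalIntegral.integral_Ioi_sub_Ioi' (hi 0) (hi x)]
    abel
  rw [h1]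
  exact (intervalIntegral.integral_hasDerivAt_right (hg.intervalIntegrable _ _)
    (hg.stronglyMeasurableAtFilter _ _) hg.continuousAt).const_sub _

lemma tendsto_integral_Ioi_atTop {E : Type*} [NormedAddCommGroup E] [NormedSpace ℝ E]
    [CompleteSpace E] {g : ℝ → E} (hi : ∀ a, IntegrableOn g (Set.Ioi a)) :
    Tendsto (fun x => ∫ y in Set.Ioi x, g y) atTop (𝓝 0) := by
  have h1 : (fun x => ∫ y in Set.Ioi x, g y) =
      fun x => (∫ y in Set.Ioi 0, g y) - ∫ y in (0 : ℝ)..x, g y := by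
    ext x
    rw [← intervalIntegral.integral_Ioi_sub_Ioi' (hi 0) (hi x)]
    abel
  rw [h1]
  have := intervalIntegral_tendsto_integral_Ioi (0 : ℝ) (hi 0) tendsto_id
  simpa using this.const_sub (∫ y in Set.Ioi 0, g y)

/-- A dominated integral of holomorphic functions is holomorphic. -/
lemma differentiableOn_integral_of_dominated {F : ℂ → ℝ → ℂ} {b : ℝ → ℝ} {U : Set ℂ} {μ : Measure ℝ}
    (hU : IsOpen U) (hm : ∀ k ∈ U, AEStronglyMeasurable (F k) μ)
    (hb : ∀ k ∈ U, ∀ y, ‖F k y‖ ≤ b y) (hbi : Integrable b μ)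
    (hd : ∀ y, DifferentiableOn ℂ (fun k => F k y) U) :
    DifferentiableOn ℂ (fun k => ∫ y, F k y ∂μ) U := by
  intro k₀ hk₀
  obtain ⟨r, hr, hrU⟩ := Metric.isOpen_iff.1 hU k₀ hk₀
  have hsub : ∀ k ∈ Metric.ball k₀ (r / 2), Metric.closedBall k (r / 3) ⊆ U := by
    intro k hk z hz
    apply hrU
    rw [Metric.mem_ball] at hk ⊢
    rw [Metric.mem_closedBall] at hz
    linarith [dist_triangle z k k₀]
  have hball : ∀ k ∈ Metric.ball k₀ (r / 2), k ∈ U := fun k hk =>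
    hsub k hk (Metric.mem_closedBall_self (by positivity))
  have hnk : Metric.ball k₀ (r / 2) ∈ 𝓝 k₀ := Metric.ball_mem_nhds _ (by positivity)
  have hderiv : ∀ y, ∀ k ∈ Metric.ball k₀ (r / 2), ‖deriv (fun k => F k y) k‖ ≤ b y / (r / 3) := by
    intro y k hk
    refine Complex.norm_deriv_le_of_forall_mem_sphere_norm_le (by positivity) ?_ ?_
    · apply DifferentiableOn.diffContOnCl
      rw [closure_ball _ (by positivity)]
      exact (hd y).mono (hsub k hk)
    · intro z hz
      exact hb z (hsub k hk (Metric.sphere_subset_closedBall hz)) y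
  have hlip : ∀ y, LipschitzOnWith (Real.nnabs (b y / (r / 3))) (fun k => F k y)
      (Metric.ball k₀ (r / 2)) := by
    intro y
    refine (convex_ball _ _).lipschitzOnWith_of_nnnorm_deriv_le (𝕜 := ℂ)
      (fun x hx => (hd y).differentiableAt (hU.mem_nhds (hball x hx))) fun x hx => ?_
    rw [← NNReal.coe_le_coe, coe_nnnorm, Real.coe_nnabs]
    exact (hderiv y x hx).trans (le_abs_self _)
  have hdm : AEStronglyMeasurable (fun y => deriv (fun k => F k y) k₀) μ := by
    refine aestronglyMeasurable_of_tendsto_ae (u := atTop)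
      (f := fun (n : ℕ) y => (r / 3 / (n + 1) : ℂ)⁻¹ * (F (k₀ + r / 3 / (n + 1)) y - F k₀ y))
      ?_ ?_
    · intro n
      refine (AEStronglyMeasurable.sub (hm _ ?_) (hm _ hk₀)).const_mul _
      apply hball
      rw [Metric.mem_ball, dist_eq_norm, add_sub_cancel_left]
      have : ((r : ℂ) / 3 / (n + 1)) = ((r / 3 / (n + 1) : ℝ) : ℂ) := by push_cast; ring
      rw [this, Complex.norm_real, Real.norm_eq_abs, abs_of_nonneg (by positivity)]
      have : r / 3 / (n + 1) ≤ r / 3 := div_le_self (by positivity) (by linarith [n.cast_nonneg (α := ℝ)])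
      linarith
    · refine Eventually.of_forall fun y => ?_
      have h1 := ((hd y).differentiableAt (hU.mem_nhds hk₀)).hasDerivAt
      have h2 := h1.tendsto_slope_zero
      have h3 : Tendsto (fun n : ℕ => ((r : ℂ) / 3 / (n + 1))) atTop (𝓝[≠] 0) := by
        rw [tendsto_nhdsWithin_iff]
        constructor
        · have := (tendsto_one_div_add_atTop_nhds_zero_nat (𝕜 := ℂ)).const_mul ((r : ℂ) / 3)
          simpa [div_eq_mul_inv] using this
        · refine Eventually.of_forall fun n => ?_
          have : ((r : ℂ) / 3 / (n + 1)) = ((r / 3 / (n + 1) : ℝ) : ℂ) := by push_cast; ring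
          rw [this]
          simp only [Set.mem_compl_iff, Set.mem_singleton_iff, ofReal_eq_zero]
          positivity
      simpa [Function.comp_def] using h2.comp h3
  have hint : Integrable (F k₀) μ :=
    hbi.mono' (hm k₀ hk₀) (Eventually.of_forall fun y => hb k₀ hk₀ y)
  have := (hasDerivAt_integral_of_dominated_loc_of_lip (𝕜 := ℂ) (F := F) (x₀ := k₀)
    (bound := fun y => b y / (r / 3)) hnk
    (by filter_upwards [hU.mem_nhds hk₀] with k hk using hm k hk) hint hdm
    (Eventually.of_forall hlip) (hbi.div_const _)
    (Eventually.of_forall fun y => ((hd y).differentiableAt (hU.mem_nhds hk₀)).hasDerivAt)).2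
  exact this.differentiableAt.differentiableWithinAt

lemma norm_le_gronwallBound_abs {E : Type*} [NormedAddCommGroup E] [NormedSpace ℝ E]
    {f f' : ℝ → E} {K ε T : ℝ} (hf : ∀ t, |t| ≤ T → HasDerivAt f (f' t) t)
    (hb : ∀ t, |t| ≤ T → ‖f' t‖ ≤ K * ‖f t‖ + ε) {t : ℝ} (ht : |t| ≤ T) :
    ‖f t‖ ≤ gronwallBound ‖f 0‖ K ε |t| := by
  have key : ∀ (g g' : ℝ → E), (∀ t, |t| ≤ T → HasDerivAt g (g' t) t) →
      (∀ t, |t| ≤ T → ‖g' t‖ ≤ K * ‖g t‖ + ε) → ∀ s, 0 ≤ s → s ≤ T →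
      ‖g s‖ ≤ gronwallBound ‖g 0‖ K ε s := by
    intro g g' hg hb s hs hsT
    have habs : ∀ x ∈ Set.Icc 0 s, |x| ≤ T := fun x hx => by
      rw [abs_of_nonneg hx.1]; exact hx.2.trans hsT
    have := norm_le_gronwallBound_of_norm_deriv_right_le (f := g) (f' := g') (a := 0) (b := s)
      (δ := ‖g 0‖) (K := K) (ε := ε)
      (fun x hx => (hg x (habs x hx)).continuousAt.continuousWithinAt)
      (fun x hx => (hg x (habs x ⟨hx.1, hx.2.le⟩)).hasDerivWithinAt) le_rfl
      (fun x hx => hb x (habs x ⟨hx.1, hx.2.le⟩)) s ⟨hs, le_rfl⟩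
    simpa using this
  rcases le_total 0 t with h | h
  · rw [abs_of_nonneg h] at ht ⊢
    exact key f f' hf hb t h ht
  · rw [abs_of_nonpos h] at ht ⊢
    have := key (fun s => f (-s)) (fun s => -f' (-s))
      (fun s hs => by
        have := (hf (-s) (by rwa [abs_neg])).scomp s (hasDerivAt_neg s)
        simpa [Function.comp_def] using this)
      (fun s hs => by
        rw [norm_neg]; exact hb (-s) (by rwa [abs_neg])) (-t) (by linarith) ht
    simpa using this

/-- A function with vanishing Cauchy data at `0` for a locally bounded linear differential
inequality vanishes. -/
lemma eq_zero_of_norm_deriv_le {E : Type*} [NormedAddCommGroup E] [NormedSpace ℝ E]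
    {f f' : ℝ → E} (hf : ∀ t, HasDerivAt f (f' t) t)
    (hb : ∀ T, ∃ K, ∀ t, |t| ≤ T → ‖f' t‖ ≤ K * ‖f t‖) (h0 : f 0 = 0) (t : ℝ) : f t = 0 := by
  obtain ⟨K, hK⟩ := hb |t|
  have := norm_le_gronwallBound_abs (K := K) (ε := 0) (T := |t|) (fun s _ => hf s)
    (fun s hs => by simpa using hK s hs) (le_refl |t|)
  rw [h0, norm_zero, gronwallBound_ε0_δ0] at this
  exact norm_le_zero_iff.1 this

section LinearODE

variable {E : Type*} [NormedAddCommGroup E] [NormedSpace ℝ E]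

/-- The terms of the Neumann series of the linear equation `y' = A(t) y`, `y(0) = y₀`. -/
def neumannTerm (A : ℝ → E →L[ℝ] E) (y₀ : E) : ℕ → ℝ → E
  | 0, _ => y₀
  | n + 1, t => ∫ s in (0 : ℝ)..t, A s (neumannTerm A y₀ n s)

variable {A : ℝ → E →L[ℝ] E}

lemma continuous_neumannTerm (hA : Continuous A) (y₀ : E) (n : ℕ) :
    Continuous (neumannTerm A y₀ n) := by
  induction n with
  | zero => exact continuous_const
  | succ n ih =>
    exact intervalIntegral.continuous_primitive
      (fun a b => (hA.clm_apply ih).intervalIntegrable a b) 0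

lemma hasDerivAt_neumannTerm_succ [CompleteSpace E] (hA : Continuous A) (y₀ : E) (n : ℕ) (t : ℝ) :
    HasDerivAt (neumannTerm A y₀ (n + 1)) (A t (neumannTerm A y₀ n t)) t := by
  have hc := hA.clm_apply (continuous_neumannTerm hA y₀ n)
  exact intervalIntegral.integral_hasDerivAt_right (hc.intervalIntegrable _ _)
    (hc.stronglyMeasurableAtFilter _ _) hc.continuousAt

lemma norm_neumannTerm_le {y₀ : E} {T K : ℝ} (hA : Continuous A)
    (hK : ∀ t, |t| ≤ T → ‖A t‖ ≤ K) (n : ℕ) {t : ℝ} (ht : |t| ≤ T) :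
    ‖neumannTerm A y₀ n t‖ ≤ ‖y₀‖ * (K ^ n * |t| ^ n / n.factorial) := by
  have hK0 : 0 ≤ K := (norm_nonneg _).trans (hK t ht)
  induction n generalizing t with
  | zero => simp [neumannTerm]
  | succ n ih =>
    have hc := hA.clm_apply (continuous_neumannTerm hA y₀ n)
    calc ‖neumannTerm A y₀ (n + 1) t‖
        ≤ ∫ s in Set.uIoc 0 t, ‖A s (neumannTerm A y₀ n s)‖ :=
          intervalIntegral.norm_integral_le_integral_norm_uIoc
      _ ≤ ∫ s in Set.uIoc 0 t, ‖y₀‖ * (K ^ (n + 1) / n.factorial) * |s - 0| ^ n := by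
          refine setIntegral_mono_on (hc.norm.integrableOn_uIoc)
            (Continuous.integrableOn_uIoc (by fun_prop)) measurableSet_uIoc fun s hs => ?_
          have hs' : |s| ≤ T := by
            have : s ∈ Set.uIcc 0 t := Set.uIoc_subset_uIcc hs
            have := Set.abs_sub_left_of_mem_uIcc this
            simp only [sub_zero] at this
            exact this.trans ht
          calc ‖A s (neumannTerm A y₀ n s)‖ ≤ ‖A s‖ * ‖neumannTerm A y₀ n s‖ :=
                (A s).le_opNorm _
            _ ≤ K * (‖y₀‖ * (K ^ n * |s| ^ n / n.factorial)) := by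
                gcongr
                · exact hK s hs'
                · exact ih hs'
            _ = _ := by rw [sub_zero]; ring
      _ = ‖y₀‖ * (K ^ (n + 1) / n.factorial) * (|t - 0| ^ (n + 1) / (n + 1)) := by
          rw [integral_const_mul, integral_pow_abs_sub_uIoc]
      _ = _ := by
          rw [sub_zero, Nat.factorial_succ]
          push_cast
          field_simp

/-- Linear equations with continuous coefficients have global solutions. -/
lemma exists_linearODE_solution [CompleteSpace E] (hA : Continuous A) (y₀ : E) :
    ∃ y : ℝ → E, y 0 = y₀ ∧ ∀ t, HasDerivAt y (A t (y t)) t := by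
  have hsum : ∀ K T : ℝ, Summable fun n : ℕ => ‖y₀‖ * (K ^ n * T ^ n / n.factorial) := by
    intro K T
    refine Summable.mul_left _ ?_
    simpa [mul_pow] using Real.summable_pow_div_factorial (K * T)
  have hbd : ∀ T : ℝ, ∃ K, ∀ t, |t| ≤ T → ‖A t‖ ≤ K := by
    intro T
    obtain ⟨K, hK⟩ := (isCompact_Icc (a := -T) (b := T)).exists_bound_of_continuousOn
      hA.continuousOn
    exact ⟨K, fun t ht => hK t (abs_le.1 ht)⟩
  have hs : ∀ t, Summable fun n => neumannTerm A y₀ n t := by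
    intro t
    obtain ⟨K, hK⟩ := hbd |t|
    exact Summable.of_norm_bounded (hsum K |t|)
      fun n => norm_neumannTerm_le hA hK n le_rfl
  refine ⟨fun t => ∑' n, neumannTerm A y₀ n t, ?_, ?_⟩
  · change ∑' n, neumannTerm A y₀ n 0 = y₀
    rw [tsum_eq_single 0]
    · rfl
    · intro n hn
      obtain ⟨m, rfl⟩ := Nat.exists_eq_succ_of_ne_zero hn
      simp [neumannTerm]
  intro t
  obtain ⟨K, hK⟩ := hbd (|t| + 1)
  have hK0 : 0 ≤ K := (norm_nonneg _).trans (hK t (by linarith))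
  have hmem : ∀ s ∈ Metric.ball (0 : ℝ) (|t| + 1), |s| ≤ |t| + 1 := fun s hs => by
    rw [Metric.mem_ball, dist_zero_right, Real.norm_eq_abs] at hs; exact hs.le
  have h := hasDerivAt_tsum_of_isPreconnected (𝕜 := ℝ) (t := Metric.ball (0 : ℝ) (|t| + 1))
    (g := fun n => neumannTerm A y₀ (n + 1)) (g' := fun n s => A s (neumannTerm A y₀ n s))
    (y₀ := 0) (y := t) ((hsum K (|t| + 1)).mul_left K)
    Metric.isOpen_ball (convex_ball _ _).isPreconnected
    (fun n s _ => hasDerivAt_neumannTerm_succ hA y₀ n s)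
    (fun n s hs => by
      have hs' := hmem s hs
      refine ((A s).le_opNorm _).trans ?_
      gcongr
      · exact hK s hs'
      · refine (norm_neumannTerm_le hA hK n hs').trans ?_
        gcongr)
    (Metric.mem_ball_self (by positivity))
    ((summable_nat_add_iff 1).2 (hs 0))
    (by rw [Metric.mem_ball, dist_zero_right, Real.norm_eq_abs]; linarith)
  rw [← (A t).map_tsum (hs t)] at h
  have heq : (fun t => ∑' n, neumannTerm A y₀ n t) =
      fun t => y₀ + ∑' n, neumannTerm A y₀ (n + 1) t := by
    ext t
    rw [(hs t).tsum_eq_zero_add]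
    rfl
  rw [heq]
  convert! h.const_add y₀ using 2
  exact (congrFun heq t).symm

end LinearODE

/-- If a function and its derivative both converge at infinity, the derivative converges to `0`. -/
lemma eq_zero_of_tendsto_of_tendsto_deriv {E : Type*} [NormedAddCommGroup E] [NormedSpace ℝ E]
    {f f' : ℝ → E} {a b : E} (hf : ∀ x, HasDerivAt f (f' x) x) (ha : Tendsto f atTop (𝓝 a))
    (hb : Tendsto f' atTop (𝓝 b)) : b = 0 := by
  have h1 : Tendsto (fun x => f (x + 1) - f x - b) atTop (𝓝 (-b)) := by
    have := ((ha.comp (tendsto_atTop_add_const_right atTop (1 : ℝ) tendsto_id)).sub ha).sub_const b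
    simpa [Function.comp_def] using this
  have h2 : Tendsto (fun x => f (x + 1) - f x - b) atTop (𝓝 0) := by
    rw [Metric.tendsto_nhds]
    intro ε hε
    have := (Metric.tendsto_nhds.1 hb) (ε / 2) (by positivity)
    obtain ⟨X, hX⟩ := eventually_atTop.1 this
    filter_upwards [eventually_ge_atTop X] with x hx
    have hg : ∀ y ∈ Set.Icc x (x + 1), HasDerivWithinAt (fun y => f y - y • b) (f' y - b)
        (Set.Icc x (x + 1)) y := by
      intro y _
      have := (hf y).sub ((hasDerivAt_id y).smul_const b)
      rw [one_smul] at this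
      exact this.hasDerivWithinAt
    have := (convex_Icc x (x + 1)).norm_image_sub_le_of_norm_hasDerivWithin_le hg (C := ε / 2)
      (fun y hy => by
        have := hX y (hx.trans hy.1)
        rw [dist_eq_norm] at this
        exact this.le) (Set.left_mem_Icc.2 (by linarith)) (Set.right_mem_Icc.2 (by linarith))
    rw [dist_zero_right]
    have e : f (x + 1) - (x + 1) • b - (f x - x • b) = f (x + 1) - f x - b := by
      rw [add_smul, one_smul]; abel
    rw [e] at this
    simp only [add_sub_cancel_left, norm_one, mul_one] at this
    linarith
  exact neg_eq_zero.1 (tendsto_nhds_unique h1 h2)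

/-! ### Jost solutions on a half line -/

/-- Continuous potentials with a finite first moment at `+∞`. -/
structure IsRightPotential (u : ℝ → ℝ) : Prop where
  continuous : Continuous u
  moment : IntegrableOn (fun x => x * |u x|) (Set.Ioi 0)

lemma integrableOn_Ioi_of_continuous {g : ℝ → ℝ} (hg : Continuous g) {b : ℝ}
    (hi : IntegrableOn g (Set.Ioi b)) (a : ℝ) : IntegrableOn g (Set.Ioi a) := by
  have h1 : IntegrableOn g (Set.Icc a b) := hg.continuousOn.integrableOn_compact isCompact_Icc
  refine (h1.union hi).mono_set fun x hx => ?_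
  rcases le_or_gt x b with h | h
  · exact Or.inl ⟨le_of_lt hx, h⟩
  · exact Or.inr h

lemma IsRightPotential.integrableOn_abs {u : ℝ → ℝ} (hu : IsRightPotential u) (a : ℝ) :
    IntegrableOn (fun y => |u y|) (Set.Ioi a) := by
  have hc := hu.continuous
  have h1 : IntegrableOn (fun y => |u y|) (Set.Ioi 1) := by
    refine Integrable.mono' (hu.moment.mono_set (Set.Ioi_subset_Ioi zero_le_one))
      (by fun_prop : Continuous fun y => |u y|).aestronglyMeasurable ?_
    refine (ae_restrict_iff' measurableSet_Ioi).2 (Eventually.of_forall fun y hy => ?_)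
    have : (1 : ℝ) < y := hy
    rw [Real.norm_eq_abs, abs_abs]
    nlinarith [abs_nonneg (u y)]
  exact integrableOn_Ioi_of_continuous (by fun_prop) h1 a

lemma IsRightPotential.integrableOn_weight {u : ℝ → ℝ} (hu : IsRightPotential u) (a b : ℝ) :
    IntegrableOn (fun y => (y - a) * |u y|) (Set.Ioi b) := by
  have hc := hu.continuous
  refine integrableOn_Ioi_of_continuous (b := 0) (by fun_prop) ?_ b
  have := hu.moment.sub ((hu.integrableOn_abs 0).const_mul a)
  refine this.congr (Eventually.of_forall fun y => ?_)
  simp only [Pi.sub_apply]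
  ring

/-- The weighted tail `∫_x^∞ (y - a) |u(y)| dy`. -/
def tailMoment (u : ℝ → ℝ) (a x : ℝ) : ℝ := ∫ y in Set.Ioi x, (y - a) * |u y|

section tail

variable {u : ℝ → ℝ}

lemma hasDerivAt_tailMoment (hu : IsRightPotential u) (a x : ℝ) :
    HasDerivAt (tailMoment u a) (-((x - a) * |u x|)) x := by
  have hc := hu.continuous
  exact hasDerivAt_integral_Ioi (by fun_prop) (hu.integrableOn_weight a) x

lemma tendsto_tailMoment (hu : IsRightPotential u) (a : ℝ) : Tendsto (tailMoment u a) atTop (𝓝 0) :=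
  tendsto_integral_Ioi_atTop (hu.integrableOn_weight a)

lemma tailMoment_nonneg {a x : ℝ} (h : a ≤ x) : 0 ≤ tailMoment u a x :=
  setIntegral_nonneg measurableSet_Ioi fun y hy =>
    mul_nonneg (by linarith [show x < y from hy]) (abs_nonneg _)

lemma tailMoment_anti (hu : IsRightPotential u) {a x y : ℝ} (h : a ≤ x) (hxy : x ≤ y) :
    tailMoment u a y ≤ tailMoment u a x := by
  refine setIntegral_mono_set (hu.integrableOn_weight a x) ?_
    (LE.le.eventuallyLE (Set.Ioi_subset_Ioi hxy))
  refine (ae_restrict_iff' measurableSet_Ioi).2 (Eventually.of_forall fun y hy => ?_)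
  exact mul_nonneg (by linarith [show x < y from hy]) (abs_nonneg _)

lemma integral_weight_mul_tailMoment_pow (hu : IsRightPotential u) {a x : ℝ} (h : a ≤ x) (n : ℕ) :
    IntegrableOn (fun y => (y - a) * |u y| * tailMoment u a y ^ n) (Set.Ioi x) ∧
      ∫ y in Set.Ioi x, (y - a) * |u y| * tailMoment u a y ^ n =
        tailMoment u a x ^ (n + 1) / (n + 1) := by
  have hd : ∀ y ∈ Set.Ici x, HasDerivAt (fun y => -(tailMoment u a y ^ (n + 1) / (n + 1)))
      ((y - a) * |u y| * tailMoment u a y ^ n) y := by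
    intro y _
    have := (((hasDerivAt_tailMoment hu a y).pow (n + 1)).div_const ((n : ℝ) + 1)).neg
    convert! this using 1
    push_cast
    have : (n : ℝ) + 1 ≠ 0 := by positivity
    field_simp
  have hpos : ∀ y ∈ Set.Ioi x, 0 ≤ (y - a) * |u y| * tailMoment u a y ^ n := by
    intro y hy
    have hy : x < y := hy
    exact mul_nonneg (mul_nonneg (by linarith) (abs_nonneg _))
      (pow_nonneg (tailMoment_nonneg (by linarith)) _)
  have hl : Tendsto (fun y => -(tailMoment u a y ^ (n + 1) / (n + 1))) atTop (𝓝 0) := by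
    have := (((tendsto_tailMoment hu a).pow (n + 1)).div_const ((n : ℝ) + 1)).neg
    simpa using this
  refine ⟨integrableOn_Ioi_deriv_of_nonneg' hd hpos hl, ?_⟩
  rw [integral_Ioi_of_hasDerivAt_of_nonneg' hd hpos hl]
  ring

end tail

/-! The Volterra kernel -/

/-- The kernel `(e^{2iks} - 1) / (2ik)` for `s ≥ 0`, extended by `0` to `s < 0`. -/
def jostKernel (k : ℂ) (s : ℝ) : ℂ := ∫ r in (0 : ℝ)..max s 0, exp (2 * I * k * r)

lemma norm_exp_two_mul_le {k : ℂ} (hk : 0 ≤ k.im) {r : ℝ} (hr : 0 ≤ r) :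
    ‖exp (2 * I * k * r)‖ ≤ 1 := by
  rw [Complex.norm_exp, Real.exp_le_one_iff]
  have : (2 * I * k * r).re = -2 * (k.im * r) := by simp; ring
  rw [this]
  nlinarith [mul_nonneg hk hr]

lemma jostKernel_of_nonpos (k : ℂ) {s : ℝ} (hs : s ≤ 0) : jostKernel k s = 0 := by
  simp [jostKernel, max_eq_right hs]

lemma norm_jostKernel_sub_le {k : ℂ} (hk : 0 ≤ k.im) (s t : ℝ) :
    ‖jostKernel k s - jostKernel k t‖ ≤ |s - t| := by
  have hc : Continuous fun r : ℝ => exp (2 * I * k * r) := by fun_prop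
  rw [jostKernel, jostKernel, intervalIntegral.integral_interval_sub_left
    (hc.intervalIntegrable _ _) (hc.intervalIntegrable _ _)]
  have := intervalIntegral.norm_integral_le_of_norm_le_const (a := max t 0) (b := max s 0)
    (f := fun r : ℝ => exp (2 * I * k * r)) (C := 1) (fun r hr => norm_exp_two_mul_le hk (by
      have := Set.uIoc_subset_uIcc hr
      exact (le_min (le_max_right _ _) (le_max_right _ _)).trans this.1))
  rw [one_mul] at this
  exact this.trans (abs_max_sub_max_le_abs s t 0)

lemma norm_jostKernel_le {k : ℂ} (hk : 0 ≤ k.im) {s : ℝ} (hs : 0 ≤ s) :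
    ‖jostKernel k s‖ ≤ s := by
  have := norm_jostKernel_sub_le hk s 0
  rwa [jostKernel_of_nonpos k le_rfl, sub_zero, sub_zero, abs_of_nonneg hs] at this

lemma continuous_jostKernel (k : ℂ) : Continuous (jostKernel k) := by
  have hc : Continuous fun r : ℝ => exp (2 * I * k * r) := by fun_prop
  exact (intervalIntegral.continuous_primitive (fun a b => hc.intervalIntegrable a b) 0).comp
    (by fun_prop : Continuous fun s : ℝ => max s 0)

lemma continuous_jostKernel_left (s : ℝ) : Continuous fun k => jostKernel k s := by
  apply intervalIntegral.continuous_parametric_intervalIntegral_of_continuous'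
  fun_prop

lemma isOpen_upper : IsOpen {k : ℂ | 0 < k.im} := isOpen_lt continuous_const continuous_im

lemma differentiableOn_jostKernel (s : ℝ) :
    DifferentiableOn ℂ (fun k => jostKernel k s) {k | 0 < k.im} := by
  simp only [jostKernel, intervalIntegral.integral_of_le (le_max_right s 0)]
  have h := differentiableOn_integral_of_dominated (U := {k : ℂ | 0 < k.im})
    (F := fun k r => (Set.Ioc 0 (max s 0)).indicator (fun r : ℝ => exp (2 * I * k * r)) r)
    (b := (Set.Ioc 0 (max s 0)).indicator fun _ => 1) (μ := volume) isOpen_upper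
    (fun k _ => ((by fun_prop : Continuous fun r : ℝ =>
      exp (2 * I * k * r)).aestronglyMeasurable).indicator measurableSet_Ioc)
    (fun k hk y => by
      by_cases hy : y ∈ Set.Ioc 0 (max s 0)
      · simpa [hy] using norm_exp_two_mul_le (le_of_lt hk) hy.1.le
      · simp [hy])
    ((integrable_indicator_iff measurableSet_Ioc).2 (by simp))
    (fun y => by
      by_cases hy : y ∈ Set.Ioc 0 (max s 0)
      · simp only [hy, Set.indicator_of_mem]
        fun_prop
      · simp only [hy, not_false_eq_true, Set.indicator_of_notMem]
        fun_prop)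
  simpa only [integral_indicator measurableSet_Ioc] using h

lemma hasDerivAt_jostKernel (k : ℂ) {s : ℝ} (hs : s ≠ 0) :
    HasDerivAt (jostKernel k) (if 0 < s then exp (2 * I * k * s) else 0) s := by
  have hc : Continuous fun r : ℝ => exp (2 * I * k * r) := by fun_prop
  rcases lt_or_gt_of_ne hs with h | h
  · rw [if_neg (by linarith)]
    refine (hasDerivAt_const s (0 : ℂ)).congr_of_eventuallyEq ?_
    filter_upwards [gt_mem_nhds h] with t ht using jostKernel_of_nonpos k ht.le
  · rw [if_pos h]
    have := intervalIntegral.integral_hasDerivAt_right (hc.intervalIntegrable 0 s)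
      (hc.stronglyMeasurableAtFilter _ _) hc.continuousAt
    refine this.congr_of_eventuallyEq ?_
    filter_upwards [lt_mem_nhds h] with t ht
    simp [jostKernel, max_eq_left ht.le]

lemma norm_jostKernel_le_inv {k : ℂ} (hk : 0 < k.im) (s : ℝ) : ‖jostKernel k s‖ ≤ ‖k‖⁻¹ := by
  have hk0 : k ≠ 0 := by rintro rfl; simp at hk
  have h0 : 2 * I * k ≠ 0 := by simp [hk0]
  have : jostKernel k s = (exp (2 * I * k * (max s 0 : ℝ)) - 1) / (2 * I * k) := by
    rw [jostKernel, integral_exp_mul_complex h0]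
    simp
  rw [this, norm_div]
  have h1 : ‖exp (2 * I * k * (max s 0 : ℝ)) - 1‖ ≤ 2 := by
    refine (norm_sub_le _ _).trans ?_
    have := norm_exp_two_mul_le hk.le (le_max_right s 0)
    rw [norm_one]
    linarith
  have h2 : ‖2 * I * k‖ = 2 * ‖k‖ := by simp
  rw [h2, div_le_iff₀ (by positivity)]
  have : ‖k‖ ≠ 0 := norm_ne_zero_iff.2 hk0
  field_simp
  linarith

lemma conj_jostKernel (k : ℂ) (s : ℝ) : conj (jostKernel k s) = jostKernel (-conj k) s := by
  rw [jostKernel, jostKernel, intervalIntegral.integral_of_le (le_max_right s 0),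
    intervalIntegral.integral_of_le (le_max_right s 0), ← integral_conj]
  congr 1
  ext r
  rw [← Complex.exp_conj]
  simp [Complex.conj_ofNat]

/-- The Volterra operator `h ↦ ∫_x^∞ (e^{2ik(y-x)} - 1)/(2ik) u(y) h(y) dy`. -/
def volterra (u : ℝ → ℝ) (k : ℂ) (h : ℝ → ℂ) (x : ℝ) : ℂ :=
  ∫ y, jostKernel k (y - x) * (u y * h y)

/-- The derivative of the Volterra operator in `x`. -/
def volterraDeriv (u : ℝ → ℝ) (k : ℂ) (h : ℝ → ℂ) (x : ℝ) : ℂ :=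
  -∫ y in Set.Ioi x, exp (2 * I * k * (y - x : ℝ)) * (u y * h y)

section volterra

variable {u : ℝ → ℝ}

lemma norm_volterra_integrand_le {k : ℂ} (hk : 0 ≤ k.im) {h : ℝ → ℂ} {a x : ℝ} (hax : a ≤ x)
    {B : ℝ → ℝ} (hB : ∀ y, x < y → ‖h y‖ ≤ B y) (y : ℝ) :
    ‖jostKernel k (y - x) * (u y * h y)‖ ≤
      (Set.Ioi x).indicator (fun y => (y - a) * |u y| * B y) y := by
  by_cases hy : x < y
  · rw [Set.indicator_of_mem (show y ∈ Set.Ioi x from hy), norm_mul, norm_mul, norm_real,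
      Real.norm_eq_abs, mul_assoc]
    have h1 := norm_jostKernel_le hk (s := y - x) (by linarith)
    have h2 := hB y hy
    have h3 : 0 ≤ B y := (norm_nonneg _).trans h2
    gcongr
    · linarith
    · exact h1.trans (by linarith)
  · rw [jostKernel_of_nonpos k (by linarith), zero_mul, norm_zero]
    rw [Set.indicator_of_notMem (show y ∉ Set.Ioi x from hy)]

lemma norm_volterra_le {k : ℂ} (hk : 0 ≤ k.im) {h : ℝ → ℂ} {a x : ℝ} (hax : a ≤ x)
    {B : ℝ → ℝ} (hB : ∀ y, x < y → ‖h y‖ ≤ B y)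
    (hi : IntegrableOn (fun y => (y - a) * |u y| * B y) (Set.Ioi x)) :
    ‖volterra u k h x‖ ≤ ∫ y in Set.Ioi x, (y - a) * |u y| * B y := by
  rw [← integral_indicator measurableSet_Ioi]
  exact norm_integral_le_of_norm_le ((integrable_indicator_iff measurableSet_Ioi).2 hi)
    (Eventually.of_forall (norm_volterra_integrand_le hk hax hB))

lemma norm_volterraDeriv_integrand_le {k : ℂ} (hk : 0 ≤ k.im) {h : ℝ → ℂ} {x C y : ℝ}
    (hC : ‖h y‖ ≤ C) (hy : x < y) :
    ‖exp (2 * I * k * (y - x : ℝ)) * (u y * h y)‖ ≤ |u y| * C := by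
  rw [norm_mul, norm_mul, norm_real, Real.norm_eq_abs]
  have := norm_exp_two_mul_le hk (r := y - x) (by linarith)
  calc _ ≤ 1 * (|u y| * ‖h y‖) := by gcongr
    _ ≤ |u y| * C := by rw [one_mul]; gcongr

lemma volterra_integrable (hu : IsRightPotential u) {k : ℂ} (hk : 0 ≤ k.im) {h : ℝ → ℂ}
    (hc : Continuous h) {C x : ℝ} (hC : ∀ y, x < y → ‖h y‖ ≤ C) :
    Integrable fun y => jostKernel k (y - x) * (u y * h y) := by
  have h1 := hu.continuous
  have h2 := continuous_jostKernel k
  refine Integrable.mono' ((integrable_indicator_iff measurableSet_Ioi).2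
    ((hu.integrableOn_weight x x).mul_const C))
    (by fun_prop : Continuous fun y => jostKernel k (y - x) * (u y * h y)).aestronglyMeasurable
    (Eventually.of_forall (norm_volterra_integrand_le hk le_rfl (B := fun _ => C) hC))

lemma hasDerivAt_volterra (hu : IsRightPotential u) {k : ℂ} (hk : 0 ≤ k.im) {h : ℝ → ℂ}
    (hc : Continuous h) (hb : ∀ a, ∃ C, ∀ y, a < y → ‖h y‖ ≤ C) (x : ℝ) :
    HasDerivAt (volterra u k h) (volterraDeriv u k h x) x := by
  have h1 := hu.continuous
  have h2 := continuous_jostKernel k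
  obtain ⟨C, hC⟩ := hb (x - 1)
  have hmeas : ∀ x, AEStronglyMeasurable (fun y => jostKernel k (y - x) * (u y * h y)) volume :=
    fun x => (by fun_prop : Continuous fun y =>
      jostKernel k (y - x) * (u y * h y)).aestronglyMeasurable
  have key := (hasDerivAt_integral_of_dominated_loc_of_lip (𝕜 := ℝ)
    (F := fun x y => jostKernel k (y - x) * (u y * h y)) (x₀ := x)
    (F' := (Set.Ioi x).indicator fun y => -(exp (2 * I * k * (y - x : ℝ)) * (u y * h y)))
    (bound := (Set.Ioi (x - 1)).indicator fun y => |u y| * C) (μ := volume)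
    (Metric.ball_mem_nhds x one_pos) (Eventually.of_forall hmeas)
    (volterra_integrable hu hk hc (fun y hy => hC y (by linarith)))
    ((by fun_prop : Continuous fun y => -(exp (2 * I * k * (y - x : ℝ)) *
      (u y * h y))).aestronglyMeasurable.indicator measurableSet_Ioi)
    (Eventually.of_forall fun y => ?_)
    ((integrable_indicator_iff measurableSet_Ioi).2 ((hu.integrableOn_abs (x - 1)).mul_const C))
    ?_).2
  · rw [integral_indicator measurableSet_Ioi, integral_neg] at key
    exact key
  · apply LipschitzOnWith.of_dist_le_mul
    intro s hs t ht
    rw [Metric.mem_ball, Real.dist_eq] at hs ht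
    have hs' := (abs_lt.1 hs).1
    have ht' := (abs_lt.1 ht).1
    rw [dist_eq_norm, ← sub_mul, norm_mul, norm_mul, norm_real, Real.norm_eq_abs, Real.coe_nnabs,
      Real.dist_eq]
    by_cases hy : x - 1 < y
    · rw [Set.indicator_of_mem (show y ∈ Set.Ioi (x - 1) from hy)]
      have h3 := norm_jostKernel_sub_le hk (y - s) (y - t)
      have h4 : |y - s - (y - t)| = |s - t| := by rw [← abs_neg]; congr 1; ring
      rw [h4] at h3
      rw [mul_comm]
      have h5 : |u y| * ‖h y‖ ≤ |(|u y| * C)| :=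
        (mul_le_mul_of_nonneg_left (hC y hy) (abs_nonneg _)).trans (le_abs_self _)
      gcongr
    · rw [jostKernel_of_nonpos k (by linarith), jostKernel_of_nonpos k (by linarith), sub_self,
        norm_zero, zero_mul]
      positivity
  · have : ∀ᵐ y ∂(volume : Measure ℝ), y ≠ x := by
      rw [ae_iff]; simp
    filter_upwards [this] with y hy
    have h3 := (hasDerivAt_jostKernel k (s := y - x) (sub_ne_zero.2 hy)).scomp x
      ((hasDerivAt_id x).const_sub y)
    have h4 := h3.mul_const ((u y : ℂ) * h y)
    convert! h4 using 1
    by_cases hyx : x < y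
    · rw [Set.indicator_of_mem (show y ∈ Set.Ioi x from hyx)]
      simp [hyx]
    · rw [Set.indicator_of_notMem (show y ∉ Set.Ioi x from hyx)]
      simp [hyx]

lemma hasDerivAt_volterraDeriv (hu : IsRightPotential u) {k : ℂ} (hk : 0 ≤ k.im) {h : ℝ → ℂ}
    (hc : Continuous h) (hb : ∀ a, ∃ C, ∀ y, a < y → ‖h y‖ ≤ C) (x : ℝ) :
    HasDerivAt (volterraDeriv u k h) (-(2 * I * k) * volterraDeriv u k h x + u x * h x) x := by
  have h1 := hu.continuous
  have heq : ∀ x, volterraDeriv u k h x =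
      -(exp (-(2 * I * k) * x) * ∫ y in Set.Ioi x, exp (2 * I * k * y) * (u y * h y)) := by
    intro x
    rw [volterraDeriv, ← integral_const_mul]
    congr 2
    ext y
    rw [← mul_assoc (exp _) (exp _), ← Complex.exp_add]
    congr 2
    push_cast
    ring
  have hi : ∀ a, IntegrableOn (fun y : ℝ => exp (2 * I * k * y) * (u y * h y)) (Set.Ioi a) := by
    intro a
    obtain ⟨C, hC⟩ := hb a
    have : IntegrableOn (fun y => exp (2 * I * k * (y - a : ℝ)) * (u y * h y)) (Set.Ioi a) := by
      refine Integrable.mono' ((hu.integrableOn_abs a).mul_const C)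
        (by fun_prop : Continuous fun y => exp (2 * I * k * (y - a : ℝ)) *
          (u y * h y)).aestronglyMeasurable ?_
      refine (ae_restrict_iff' measurableSet_Ioi).2 (Eventually.of_forall fun y hy => ?_)
      exact norm_volterraDeriv_integrand_le hk (hC y hy) hy
    refine (this.const_mul (exp (2 * I * k * a))).congr (Eventually.of_forall fun y => ?_)
    simp only
    rw [← mul_assoc, ← Complex.exp_add]
    congr 2
    push_cast
    ring
  have h2 := hasDerivAt_integral_Ioi
    (g := fun y : ℝ => exp (2 * I * k * y) * (u y * h y)) (by fun_prop) hi x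
  have h3 : HasDerivAt (fun x : ℝ => exp (-(2 * I * k) * x))
      (exp (-(2 * I * k) * x) * (-(2 * I * k))) x := by
    have := ((hasDerivAt_id x).ofReal_comp.const_mul (-(2 * I * k))).cexp
    simpa using this
  have h4 := (h3.mul h2).neg
  rw [funext heq]
  convert! h4 using 1
  have : exp (-(2 * I * k) * x) * exp (2 * I * k * x) = 1 := by
    rw [← Complex.exp_add]; simp
  linear_combination -(u x * h x : ℂ) * this

lemma continuousOn_volterra_param (hu : IsRightPotential u) {h : ℂ → ℝ → ℂ} {x C : ℝ}
    (hc : ∀ k, 0 ≤ k.im → Continuous (h k)) (hC : ∀ k, 0 ≤ k.im → ∀ y, x < y → ‖h k y‖ ≤ C)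
    (hk : ∀ y, ContinuousOn (fun k => h k y) {k | 0 ≤ k.im}) :
    ContinuousOn (fun k => volterra u k (h k) x) {k | 0 ≤ k.im} := by
  have h1 := hu.continuous
  refine continuousOn_of_dominated
    (bound := (Set.Ioi x).indicator fun y => (y - x) * |u y| * C) (fun k hk => ?_)
    (fun k hk => Eventually.of_forall
      (norm_volterra_integrand_le hk le_rfl (B := fun _ => C) (hC k hk)))
    ((integrable_indicator_iff measurableSet_Ioi).2 ((hu.integrableOn_weight x x).mul_const C))
    (Eventually.of_forall fun y => ?_)
  · have h2 := continuous_jostKernel k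
    have h3 := hc k hk
    exact (by fun_prop : Continuous fun y =>
      jostKernel k (y - x) * (u y * h k y)).aestronglyMeasurable
  · exact (continuous_jostKernel_left (y - x)).continuousOn.mul (continuousOn_const.mul (hk y))

lemma differentiableOn_volterra_param (hu : IsRightPotential u) {h : ℂ → ℝ → ℂ} {x C : ℝ}
    (hc : ∀ k, 0 ≤ k.im → Continuous (h k)) (hC : ∀ k, 0 ≤ k.im → ∀ y, x < y → ‖h k y‖ ≤ C)
    (hk : ∀ y, DifferentiableOn ℂ (fun k => h k y) {k | 0 < k.im}) :
    DifferentiableOn ℂ (fun k => volterra u k (h k) x) {k | 0 < k.im} := by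
  have h1 := hu.continuous
  refine differentiableOn_integral_of_dominated
    (b := (Set.Ioi x).indicator fun y => (y - x) * |u y| * C) isOpen_upper (fun k hk => ?_)
    (fun k hk =>
      (norm_volterra_integrand_le (le_of_lt hk) le_rfl (B := fun _ => C) (hC k (le_of_lt hk))))
    ((integrable_indicator_iff measurableSet_Ioi).2 ((hu.integrableOn_weight x x).mul_const C))
    (fun y => ?_)
  · have h2 := continuous_jostKernel k
    have h3 := hc k (le_of_lt hk)
    exact (by fun_prop : Continuous fun y =>
      jostKernel k (y - x) * (u y * h k y)).aestronglyMeasurable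
  · exact (differentiableOn_jostKernel (y - x)).mul ((hk y).const_mul _)

lemma volterraDeriv_eq_indicator (u : ℝ → ℝ) (k : ℂ) (h : ℝ → ℂ) (x : ℝ) :
    volterraDeriv u k h x = -∫ y, (Set.Ioi x).indicator
      (fun y => exp (2 * I * k * (y - x : ℝ)) * (u y * h y)) y := by
  rw [volterraDeriv, integral_indicator measurableSet_Ioi]

lemma norm_volterraDeriv_indicator_le {k : ℂ} (hk : 0 ≤ k.im) {h : ℝ → ℂ} {x C : ℝ}
    (hC : ∀ y, x < y → ‖h y‖ ≤ C) (y : ℝ) :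
    ‖(Set.Ioi x).indicator (fun y => exp (2 * I * k * (y - x : ℝ)) * (u y * h y)) y‖ ≤
      (Set.Ioi x).indicator (fun y => |u y| * C) y := by
  by_cases hy : y ∈ Set.Ioi x
  · simp only [hy, Set.indicator_of_mem]
    exact norm_volterraDeriv_integrand_le hk (hC y hy) hy
  · simp [hy]

lemma norm_volterraDeriv_le (hu : IsRightPotential u) {k : ℂ} (hk : 0 ≤ k.im) {h : ℝ → ℂ} {x C : ℝ}
    (hC : ∀ y, x < y → ‖h y‖ ≤ C) :
    ‖volterraDeriv u k h x‖ ≤ ∫ y in Set.Ioi x, |u y| * C := by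
  rw [volterraDeriv_eq_indicator, norm_neg, ← integral_indicator measurableSet_Ioi]
  exact norm_integral_le_of_norm_le ((integrable_indicator_iff measurableSet_Ioi).2
    ((hu.integrableOn_abs x).mul_const C))
    (Eventually.of_forall (norm_volterraDeriv_indicator_le hk hC))

lemma continuousOn_volterraDeriv_param (hu : IsRightPotential u) {h : ℂ → ℝ → ℂ} {x C : ℝ}
    (hc : ∀ k, 0 ≤ k.im → Continuous (h k)) (hC : ∀ k, 0 ≤ k.im → ∀ y, x < y → ‖h k y‖ ≤ C)
    (hk : ∀ y, ContinuousOn (fun k => h k y) {k | 0 ≤ k.im}) :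
    ContinuousOn (fun k => volterraDeriv u k (h k) x) {k | 0 ≤ k.im} := by
  have h1 := hu.continuous
  simp only [volterraDeriv_eq_indicator]
  refine ContinuousOn.neg (continuousOn_of_dominated
    (bound := (Set.Ioi x).indicator fun y => |u y| * C) (fun k hk => ?_)
    (fun k hk => Eventually.of_forall (norm_volterraDeriv_indicator_le hk (hC k hk)))
    ((integrable_indicator_iff measurableSet_Ioi).2 ((hu.integrableOn_abs x).mul_const C))
    (Eventually.of_forall fun y => ?_))
  · have h3 := hc k hk
    exact (by fun_prop : Continuous fun y : ℝ => exp (2 * I * k * (y - x : ℝ)) *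
      (u y * h k y)).aestronglyMeasurable.indicator measurableSet_Ioi
  · by_cases hy : y ∈ Set.Ioi x
    · simp only [hy, Set.indicator_of_mem]
      exact (by fun_prop : Continuous fun k : ℂ => exp (2 * I * k * (y - x : ℝ))).continuousOn.mul
        (continuousOn_const.mul (hk y))
    · simp only [hy, not_false_eq_true, Set.indicator_of_notMem]
      exact continuousOn_const

lemma differentiableOn_volterraDeriv_param (hu : IsRightPotential u) {h : ℂ → ℝ → ℂ} {x C : ℝ}
    (hc : ∀ k, 0 ≤ k.im → Continuous (h k)) (hC : ∀ k, 0 ≤ k.im → ∀ y, x < y → ‖h k y‖ ≤ C)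
    (hk : ∀ y, DifferentiableOn ℂ (fun k => h k y) {k | 0 < k.im}) :
    DifferentiableOn ℂ (fun k => volterraDeriv u k (h k) x) {k | 0 < k.im} := by
  have h1 := hu.continuous
  simp only [volterraDeriv_eq_indicator]
  refine DifferentiableOn.fun_neg (differentiableOn_integral_of_dominated
    (b := (Set.Ioi x).indicator fun y => |u y| * C) isOpen_upper (fun k hk => ?_)
    (fun k hk => norm_volterraDeriv_indicator_le (le_of_lt hk) (hC k (le_of_lt hk)))
    ((integrable_indicator_iff measurableSet_Ioi).2 ((hu.integrableOn_abs x).mul_const C))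
    (fun y => ?_))
  · have h3 := hc k (le_of_lt hk)
    exact (by fun_prop : Continuous fun y : ℝ => exp (2 * I * k * (y - x : ℝ)) *
      (u y * h k y)).aestronglyMeasurable.indicator measurableSet_Ioi
  · by_cases hy : y ∈ Set.Ioi x
    · simp only [hy, Set.indicator_of_mem]
      exact (by fun_prop : Differentiable ℂ
        fun k : ℂ => exp (2 * I * k * (y - x : ℝ))).differentiableOn.mul ((hk y).const_mul _)
    · simp only [hy, not_false_eq_true, Set.indicator_of_notMem]
      exact differentiableOn_const _

/-- As `k → ∞` along the imaginary axis, the Volterra operator tends to `0`. -/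
lemma tendsto_volterra_imaginary (hu : IsRightPotential u) {h : ℂ → ℝ → ℂ} {x C : ℝ}
    (hc : ∀ k, 0 ≤ k.im → Continuous (h k)) (hC : ∀ k, 0 ≤ k.im → ∀ y, x < y → ‖h k y‖ ≤ C) :
    Tendsto (fun s : ℝ => volterra u (I * s) (h (I * s)) x) atTop (𝓝 0) := by
  have h1 := hu.continuous
  have hpos : ∀ᶠ s : ℝ in atTop, 0 < (I * s : ℂ).im := by
    filter_upwards [eventually_gt_atTop 0] with s hs
    simpa using hs
  rw [← integral_zero ℝ ℂ (μ := volume)]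
  refine tendsto_integral_filter_of_dominated_convergence
    ((Set.Ioi x).indicator fun y => (y - x) * |u y| * C) ?_ ?_
    ((integrable_indicator_iff measurableSet_Ioi).2 ((hu.integrableOn_weight x x).mul_const C)) ?_
  · filter_upwards [hpos] with s hs
    have h2 := continuous_jostKernel (I * s)
    have h3 := hc _ hs.le
    exact (by fun_prop : Continuous fun y =>
      jostKernel (I * s) (y - x) * (u y * h (I * s) y)).aestronglyMeasurable
  · filter_upwards [hpos] with s hs
    exact Eventually.of_forall
      (norm_volterra_integrand_le hs.le le_rfl (B := fun _ => C) (hC _ hs.le))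
  · refine Eventually.of_forall fun y => ?_
    by_cases hy : x < y
    · refine squeeze_zero_norm' (a := fun s : ℝ => s⁻¹ * (|u y| * C)) ?_ ?_
      · filter_upwards [hpos, eventually_gt_atTop 0] with s hs hs0
        rw [norm_mul, norm_mul, norm_real, Real.norm_eq_abs]
        have h2 := norm_jostKernel_le_inv hs (y - x)
        rw [norm_mul, norm_I, one_mul, norm_real, Real.norm_eq_abs, abs_of_pos hs0] at h2
        have := hC _ hs.le y hy
        gcongr
      · simpa using (tendsto_inv_atTop_zero (𝕜 := ℝ)).mul_const (|u y| * C)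
    · simp [jostKernel_of_nonpos _ (show y - x ≤ 0 by linarith)]

lemma tendsto_volterraDeriv_imaginary (hu : IsRightPotential u) {h : ℂ → ℝ → ℂ} {x C : ℝ}
    (hC : ∀ k, 0 ≤ k.im → ∀ y, x < y → ‖h k y‖ ≤ C) :
    Tendsto (fun s : ℝ => volterraDeriv u (I * s) (h (I * s)) x / (I * s)) atTop (𝓝 0) := by
  refine squeeze_zero_norm' (a := fun s : ℝ => (∫ y in Set.Ioi x, |u y| * C) / s) ?_
    (tendsto_const_nhds.div_atTop tendsto_id)
  filter_upwards [eventually_gt_atTop 0] with s hs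
  have hs' : 0 ≤ (I * s : ℂ).im := by simpa using hs.le
  rw [norm_div, norm_mul, norm_I, one_mul, norm_real, Real.norm_eq_abs, abs_of_pos hs]
  gcongr
  exact norm_volterraDeriv_le hu hs' (hC _ hs')

lemma conj_volterra (k : ℂ) (h : ℝ → ℂ) (x : ℝ) :
    conj (volterra u k h x) = volterra u (-conj k) (fun y => conj (h y)) x := by
  rw [volterra, volterra, ← integral_conj]
  simp [conj_jostKernel]

end volterra

/-- The terms of the Neumann series for `e^{-ikx}` times the right Jost solution. -/
def jostTerm (u : ℝ → ℝ) (k : ℂ) : ℕ → ℝ → ℂ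
  | 0, _ => 1
  | n + 1, x => volterra u k (jostTerm u k n) x

/-- `e^{-ikx}` times the right Jost solution. -/
def jostAmp (u : ℝ → ℝ) (k : ℂ) (x : ℝ) : ℂ := ∑' n, jostTerm u k n x

/-- The derivative of `jostAmp` in `x`. -/
def jostAmpDeriv (u : ℝ → ℝ) (k : ℂ) (x : ℝ) : ℂ := volterraDeriv u k (jostAmp u k) x

section

variable {u : ℝ → ℝ}

lemma jostTerm_continuous_and_le (hu : IsRightPotential u) {k : ℂ} (hk : 0 ≤ k.im) (n : ℕ) :
    Continuous (jostTerm u k n) ∧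
      ∀ a x, a ≤ x → ‖jostTerm u k n x‖ ≤ tailMoment u a x ^ n / n.factorial := by
  induction n with
  | zero => exact ⟨continuous_const, fun a x _ => by simp [jostTerm]⟩
  | succ n ih =>
    obtain ⟨hc, hb⟩ := ih
    refine ⟨?_, ?_⟩
    · refine continuous_iff_continuousAt.2 fun x => (hasDerivAt_volterra hu hk hc ?_ x).continuousAt
      intro a
      refine ⟨tailMoment u a a ^ n / n.factorial, fun y hy => (hb a y hy.le).trans ?_⟩
      have := tailMoment_nonneg (u := u) hy.le
      have := tailMoment_anti hu le_rfl hy.le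
      gcongr
    · intro a x hax
      obtain ⟨hi, he⟩ := integral_weight_mul_tailMoment_pow hu hax n
      have h := norm_volterra_le hk (h := jostTerm u k n) (u := u) hax
        (B := fun y => tailMoment u a y ^ n / n.factorial)
        (fun y hy => hb a y (by linarith))
        (by
          refine (hi.div_const (n.factorial : ℝ)).congr (Eventually.of_forall fun y => ?_)
          simp only
          ring)
      refine h.trans (le_of_eq ?_)
      calc ∫ y in Set.Ioi x, (y - a) * |u y| * (tailMoment u a y ^ n / n.factorial)
          = (∫ y in Set.Ioi x, (y - a) * |u y| * tailMoment u a y ^ n) / n.factorial := by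
            rw [← integral_div]
            congr 1
            ext y
            ring
        _ = _ := by
            rw [he, Nat.factorial_succ]
            push_cast
            field_simp

lemma norm_jostTerm_le (hu : IsRightPotential u) {k : ℂ} (hk : 0 ≤ k.im) (n : ℕ) {a x : ℝ}
    (h : a ≤ x) : ‖jostTerm u k n x‖ ≤ tailMoment u a a ^ n / n.factorial := by
  refine ((jostTerm_continuous_and_le hu hk n).2 a x h).trans ?_
  have := tailMoment_nonneg (u := u) h
  have := tailMoment_anti hu le_rfl h
  gcongr

lemma summable_jostTerm (hu : IsRightPotential u) {k : ℂ} (hk : 0 ≤ k.im) (x : ℝ) :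
    Summable fun n => jostTerm u k n x :=
  Summable.of_norm_bounded (Real.summable_pow_div_factorial (tailMoment u x x))
    fun n => norm_jostTerm_le hu hk n le_rfl

lemma norm_jostAmp_le (hu : IsRightPotential u) {k : ℂ} (hk : 0 ≤ k.im) {a x : ℝ} (h : a ≤ x) :
    ‖jostAmp u k x‖ ≤ Real.exp (tailMoment u a a) := by
  rw [Real.exp_eq_exp_ℝ, NormedSpace.exp_eq_tsum_div]
  exact tsum_of_norm_bounded (Real.summable_pow_div_factorial _).hasSum
    fun n => norm_jostTerm_le hu hk n h

lemma continuous_jostAmp (hu : IsRightPotential u) {k : ℂ} (hk : 0 ≤ k.im) :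
    Continuous (jostAmp u k) := by
  refine continuous_iff_continuousAt.2 fun x => ?_
  have : ContinuousOn (jostAmp u k) (Set.Ici (x - 1)) :=
    continuousOn_tsum (fun n => (jostTerm_continuous_and_le hu hk n).1.continuousOn)
      (Real.summable_pow_div_factorial (tailMoment u (x - 1) (x - 1)))
      fun n y hy => norm_jostTerm_le hu hk n hy
  exact this.continuousAt (Ici_mem_nhds (by linarith))

lemma jostAmp_bdd (hu : IsRightPotential u) {k : ℂ} (hk : 0 ≤ k.im) (a : ℝ) :
    ∃ C, ∀ y, a < y → ‖jostAmp u k y‖ ≤ C :=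
  ⟨_, fun _ hy => norm_jostAmp_le hu hk hy.le⟩

/-- The Volterra integral equation. -/
lemma jostAmp_eq (hu : IsRightPotential u) {k : ℂ} (hk : 0 ≤ k.im) (x : ℝ) :
    jostAmp u k x = 1 + volterra u k (jostAmp u k) x := by
  have hs := Real.summable_pow_div_factorial (tailMoment u x x)
  have hi : ∀ n, Integrable fun y => jostKernel k (y - x) * (u y * jostTerm u k n y) := fun n =>
    volterra_integrable hu hk (jostTerm_continuous_and_le hu hk n).1
      (fun y hy => norm_jostTerm_le hu hk n hy.le)
  have h := hasSum_integral_of_summable_integral_norm hi (by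
    refine Summable.of_nonneg_of_le (fun n => integral_nonneg fun y => norm_nonneg _) (fun n => ?_)
      (hs.mul_left (tailMoment u x x))
    have h1 := norm_volterra_integrand_le (u := u) hk (h := jostTerm u k n) (le_refl x)
      (B := fun _ => tailMoment u x x ^ n / n.factorial)
      (fun y hy => norm_jostTerm_le hu hk n hy.le)
    refine (integral_mono (hi n).norm ((integrable_indicator_iff measurableSet_Ioi).2
      ((hu.integrableOn_weight x x).mul_const _)) h1).trans (le_of_eq ?_)
    rw [integral_indicator measurableSet_Ioi, integral_mul_const]
    rfl)
  rw [jostAmp, (summable_jostTerm hu hk x).tsum_eq_zero_add]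
  congr 1
  refine h.tsum_eq.trans ?_
  rw [volterra]
  congr 1
  ext y
  rw [tsum_mul_left, tsum_mul_left]
  rfl

lemma hasDerivAt_jostAmp (hu : IsRightPotential u) {k : ℂ} (hk : 0 ≤ k.im) (x : ℝ) :
    HasDerivAt (jostAmp u k) (jostAmpDeriv u k x) x := by
  rw [funext (jostAmp_eq hu hk)]
  exact (hasDerivAt_volterra hu hk (continuous_jostAmp hu hk) (jostAmp_bdd hu hk) x).const_add 1

lemma hasDerivAt_jostAmpDeriv (hu : IsRightPotential u) {k : ℂ} (hk : 0 ≤ k.im) (x : ℝ) :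
    HasDerivAt (jostAmpDeriv u k)
      (-(2 * I * k) * jostAmpDeriv u k x + u x * jostAmp u k x) x :=
  hasDerivAt_volterraDeriv hu hk (continuous_jostAmp hu hk) (jostAmp_bdd hu hk) x

lemma tendsto_jostAmp (hu : IsRightPotential u) {k : ℂ} (hk : 0 ≤ k.im) :
    Tendsto (jostAmp u k) atTop (𝓝 1) := by
  rw [funext (jostAmp_eq hu hk)]
  suffices Tendsto (volterra u k (jostAmp u k)) atTop (𝓝 0) by simpa using this.const_add 1
  refine squeeze_zero_norm' (a := fun x => tailMoment u 0 x * Real.exp (tailMoment u 0 0)) ?_ ?_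
  · filter_upwards [eventually_ge_atTop 0] with x hx
    refine (norm_volterra_le hk hx (B := fun _ => Real.exp (tailMoment u 0 0))
      (fun y hy => norm_jostAmp_le hu hk (by linarith))
      ((hu.integrableOn_weight 0 x).mul_const _)).trans (le_of_eq ?_)
    rw [integral_mul_const]
    rfl
  · simpa using (tendsto_tailMoment hu 0).mul_const (Real.exp (tailMoment u 0 0))

lemma tendsto_jostAmpDeriv (hu : IsRightPotential u) {k : ℂ} (hk : 0 ≤ k.im) :
    Tendsto (jostAmpDeriv u k) atTop (𝓝 0) := by
  refine squeeze_zero_norm'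
    (a := fun x => ∫ y in Set.Ioi x, |u y| * Real.exp (tailMoment u 0 0)) ?_
    (tendsto_integral_Ioi_atTop fun a => (hu.integrableOn_abs a).mul_const _)
  filter_upwards [eventually_ge_atTop 0] with x hx
  exact norm_volterraDeriv_le hu hk fun y hy => norm_jostAmp_le hu hk (by linarith)

lemma continuousOn_jostTerm (hu : IsRightPotential u) (n : ℕ) (x : ℝ) :
    ContinuousOn (fun k => jostTerm u k n x) {k | 0 ≤ k.im} := by
  induction n generalizing x with
  | zero => exact continuousOn_const
  | succ n ih =>
    exact continuousOn_volterra_param hu (fun k hk => (jostTerm_continuous_and_le hu hk n).1)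
      (fun k hk y hy => norm_jostTerm_le hu hk n (a := x) hy.le) ih

lemma differentiableOn_jostTerm (hu : IsRightPotential u) (n : ℕ) (x : ℝ) :
    DifferentiableOn ℂ (fun k => jostTerm u k n x) {k | 0 < k.im} := by
  induction n generalizing x with
  | zero => exact differentiableOn_const _
  | succ n ih =>
    exact differentiableOn_volterra_param hu (fun k hk => (jostTerm_continuous_and_le hu hk n).1)
      (fun k hk y hy => norm_jostTerm_le hu hk n (a := x) hy.le) ih

lemma continuousOn_jostAmp_param (hu : IsRightPotential u) (x : ℝ) :
    ContinuousOn (fun k => jostAmp u k x) {k | 0 ≤ k.im} :=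
  continuousOn_tsum (fun n => continuousOn_jostTerm hu n x)
    (Real.summable_pow_div_factorial (tailMoment u x x))
    fun n _ hk => norm_jostTerm_le hu hk n le_rfl

lemma differentiableOn_jostAmp_param (hu : IsRightPotential u) (x : ℝ) :
    DifferentiableOn ℂ (fun k => jostAmp u k x) {k | 0 < k.im} :=
  differentiableOn_tsum_of_summable_norm (Real.summable_pow_div_factorial (tailMoment u x x))
    (fun n => differentiableOn_jostTerm hu n x) isOpen_upper
    fun n _ hk => norm_jostTerm_le hu (le_of_lt hk) n le_rfl

lemma continuousOn_jostAmpDeriv_param (hu : IsRightPotential u) (x : ℝ) :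
    ContinuousOn (fun k => jostAmpDeriv u k x) {k | 0 ≤ k.im} :=
  continuousOn_volterraDeriv_param hu (fun _ hk => continuous_jostAmp hu hk)
    (fun _ hk _ hy => norm_jostAmp_le hu hk (a := x) hy.le) (continuousOn_jostAmp_param hu)

lemma differentiableOn_jostAmpDeriv_param (hu : IsRightPotential u) (x : ℝ) :
    DifferentiableOn ℂ (fun k => jostAmpDeriv u k x) {k | 0 < k.im} :=
  differentiableOn_volterraDeriv_param hu (fun _ hk => continuous_jostAmp hu hk)
    (fun _ hk _ hy => norm_jostAmp_le hu hk (a := x) hy.le) (differentiableOn_jostAmp_param hu)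

lemma tendsto_jostAmp_imaginary (hu : IsRightPotential u) (x : ℝ) :
    Tendsto (fun s : ℝ => jostAmp u (I * s) x) atTop (𝓝 1) := by
  have h := (tendsto_volterra_imaginary hu (h := jostAmp u) (x := x)
    (fun _ hk => continuous_jostAmp hu hk)
    (fun _ hk _ hy => norm_jostAmp_le hu hk (a := x) hy.le)).const_add 1
  rw [add_zero] at h
  refine h.congr' ?_
  filter_upwards [eventually_ge_atTop 0] with s hs
  exact (jostAmp_eq hu (by simpa using hs) x).symm

lemma tendsto_jostAmpDeriv_imaginary (hu : IsRightPotential u) (x : ℝ) :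
    Tendsto (fun s : ℝ => jostAmpDeriv u (I * s) x / (I * s)) atTop (𝓝 0) :=
  tendsto_volterraDeriv_imaginary hu (h := jostAmp u) (x := x)
    (fun _ hk _ hy => norm_jostAmp_le hu hk (a := x) hy.le)

lemma conj_jostTerm (k : ℂ) (n : ℕ) (x : ℝ) :
    conj (jostTerm u k n x) = jostTerm u (-conj k) n x := by
  induction n generalizing x with
  | zero => simp [jostTerm]
  | succ n ih =>
    simp only [jostTerm, conj_volterra, ih]

lemma conj_jostAmp (k : ℂ) (x : ℝ) : conj (jostAmp u k x) = jostAmp u (-conj k) x := by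
  simp only [jostAmp, Complex.conj_tsum, conj_jostTerm]

/-- The right Jost solution. -/
def jost (u : ℝ → ℝ) (k : ℂ) (x : ℝ) : ℂ := exp (I * k * x) * jostAmp u k x

/-- The derivative of the right Jost solution. -/
def jostDeriv (u : ℝ → ℝ) (k : ℂ) (x : ℝ) : ℂ :=
  exp (I * k * x) * (I * k * jostAmp u k x + jostAmpDeriv u k x)

lemma hasDerivAt_exp_I_mul (k : ℂ) (x : ℝ) :
    HasDerivAt (fun x : ℝ => exp (I * k * x)) (I * k * exp (I * k * x)) x := by
  have := ((hasDerivAt_id x).ofReal_comp.const_mul (I * k)).cexp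
  simpa [mul_comm] using this

lemma hasDerivAt_jost (hu : IsRightPotential u) {k : ℂ} (hk : 0 ≤ k.im) (x : ℝ) :
    HasDerivAt (jost u k) (jostDeriv u k x) x := by
  convert! (hasDerivAt_exp_I_mul k x).mul (hasDerivAt_jostAmp hu hk x) using 1
  rw [jostDeriv]
  ring

lemma deriv_jost (hu : IsRightPotential u) {k : ℂ} (hk : 0 ≤ k.im) :
    deriv (jost u k) = jostDeriv u k :=
  funext fun x => (hasDerivAt_jost hu hk x).deriv

lemma hasDerivAt_jostDeriv (hu : IsRightPotential u) {k : ℂ} (hk : 0 ≤ k.im) (x : ℝ) :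
    HasDerivAt (jostDeriv u k) ((u x - k ^ 2) * jost u k x) x := by
  convert! (hasDerivAt_exp_I_mul k x).mul
    (((hasDerivAt_jostAmp hu hk x).const_mul (I * k)).add (hasDerivAt_jostAmpDeriv hu hk x)) using 1
  rw [jost, Pi.add_apply]
  linear_combination (-(k ^ 2) * exp (I * k * x) * jostAmp u k x) * I_sq

lemma solves_jost (hu : IsRightPotential u) {k : ℂ} (hk : 0 ≤ k.im) :
    Solves u (k ^ 2) (jost u k) := by
  refine ⟨fun x => (hasDerivAt_jost hu hk x).differentiableAt, fun x => ?_⟩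
  rw [deriv_jost hu hk]
  exact hasDerivAt_jostDeriv hu hk x

lemma exp_neg_mul_jost (u : ℝ → ℝ) (k : ℂ) (x : ℝ) :
    exp (-(I * k * x)) * jost u k x = jostAmp u k x := by
  rw [jost, ← mul_assoc, ← Complex.exp_add]
  simp

lemma exp_neg_mul_jostDeriv (u : ℝ → ℝ) (k : ℂ) (x : ℝ) :
    exp (-(I * k * x)) * jostDeriv u k x = I * k * jostAmp u k x + jostAmpDeriv u k x := by
  rw [jostDeriv, ← mul_assoc, ← Complex.exp_add]
  simp

lemma isJostRight_jost (hu : IsRightPotential u) {k : ℂ} (hk : 0 ≤ k.im) :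
    IsJostRight u k (jost u k) := by
  refine ⟨solves_jost hu hk, ?_⟩
  simp only [exp_neg_mul_jost]
  exact tendsto_jostAmp hu hk

lemma tendsto_exp_neg_mul_jostDeriv (hu : IsRightPotential u) {k : ℂ} (hk : 0 ≤ k.im) :
    Tendsto (fun x : ℝ => exp (-(I * k * x)) * jostDeriv u k x) atTop (𝓝 (I * k)) := by
  simp only [exp_neg_mul_jostDeriv]
  simpa using ((tendsto_jostAmp hu hk).const_mul (I * k)).add (tendsto_jostAmpDeriv hu hk)

lemma conj_jost (k : ℂ) (x : ℝ) : conj (jost u k x) = jost u (-conj k) x := by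
  rw [jost, jost, map_mul, conj_jostAmp, ← Complex.exp_conj]
  simp

lemma conj_jostDeriv (hu : IsRightPotential u) {k : ℂ} (hk : 0 ≤ k.im) (x : ℝ) :
    conj (jostDeriv u k x) = jostDeriv u (-conj k) x := by
  have h1 := (hasDerivAt_jost hu hk x).star
  have h2 := hasDerivAt_jost hu (k := -conj k) (by simpa using hk) x
  have : (fun x => star (jost u k x)) = jost u (-conj k) := funext fun x => conj_jost k x
  rw [this] at h1
  exact h1.unique h2

lemma continuousOn_jost_param (hu : IsRightPotential u) (x : ℝ) :
    ContinuousOn (fun k => jost u k x) {k | 0 ≤ k.im} :=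
  (by fun_prop : Continuous fun k : ℂ => exp (I * k * x)).continuousOn.mul
    (continuousOn_jostAmp_param hu x)

lemma continuousOn_jostDeriv_param (hu : IsRightPotential u) (x : ℝ) :
    ContinuousOn (fun k => jostDeriv u k x) {k | 0 ≤ k.im} :=
  (by fun_prop : Continuous fun k : ℂ => exp (I * k * x)).continuousOn.mul
    (((by fun_prop : Continuous fun k : ℂ => I * k).continuousOn.mul
      (continuousOn_jostAmp_param hu x)).add (continuousOn_jostAmpDeriv_param hu x))

lemma differentiableOn_jost_param (hu : IsRightPotential u) (x : ℝ) :
    DifferentiableOn ℂ (fun k => jost u k x) {k | 0 < k.im} :=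
  (by fun_prop : Differentiable ℂ fun k : ℂ => exp (I * k * x)).differentiableOn.mul
    (differentiableOn_jostAmp_param hu x)

lemma differentiableOn_jostDeriv_param (hu : IsRightPotential u) (x : ℝ) :
    DifferentiableOn ℂ (fun k => jostDeriv u k x) {k | 0 < k.im} :=
  (by fun_prop : Differentiable ℂ fun k : ℂ => exp (I * k * x)).differentiableOn.mul
    (((by fun_prop : Differentiable ℂ fun k : ℂ => I * k).differentiableOn.mul
      (differentiableOn_jostAmp_param hu x)).add (differentiableOn_jostAmpDeriv_param hu x))

end

/-! ### Wronskians and uniqueness -/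

/-- The Wronskian `f g' - f' g`. -/
def wron (f g : ℝ → ℂ) (x : ℝ) : ℂ := f x * deriv g x - deriv f x * g x

lemma Solves.hasDerivAt {p : ℝ → ℝ} {z : ℂ} {f : ℝ → ℂ} (h : Solves p z f) (x : ℝ) :
    HasDerivAt f (deriv f x) x := (h.1 x).hasDerivAt

lemma Solves.hasDerivAt_wron {p : ℝ → ℝ} {z w : ℂ} {f g : ℝ → ℂ} (hf : Solves p z f)
    (hg : Solves p w g) (x : ℝ) : HasDerivAt (wron f g) ((z - w) * (f x * g x)) x := by
  convert! ((hf.hasDerivAt x).mul (hg.2 x)).sub ((hf.2 x).mul (hg.hasDerivAt x)) using 1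
  ring

lemma Solves.wron_eq {p : ℝ → ℝ} {z : ℂ} {f g : ℝ → ℂ} (hf : Solves p z f)
    (hg : Solves p z g) (x y : ℝ) : wron f g x = wron f g y := by
  have h : ∀ x, HasDerivAt (wron f g) 0 x := fun x => by
    simpa using hf.hasDerivAt_wron hg x
  exact is_const_of_deriv_eq_zero (fun x => (h x).differentiableAt) (fun x => (h x).deriv) x y

lemma Solves.const_mul {p : ℝ → ℝ} {z : ℂ} {f : ℝ → ℂ} (hf : Solves p z f) (b : ℂ) :
    Solves p z (fun x => b * f x) := by
  refine ⟨hf.1.const_mul b, fun x => ?_⟩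
  have : deriv (fun x => b * f x) = fun x => b * deriv f x :=
    funext fun x => ((hf.hasDerivAt x).const_mul b).deriv
  rw [this]
  convert! (hf.2 x).const_mul b using 1
  ring

lemma Solves.sub {p : ℝ → ℝ} {z : ℂ} {f g : ℝ → ℂ} (hf : Solves p z f) (hg : Solves p z g) :
    Solves p z (fun x => f x - g x) := by
  refine ⟨hf.1.sub hg.1, fun x => ?_⟩
  have : deriv (fun x => f x - g x) = fun x => deriv f x - deriv g x :=
    funext fun x => ((hf.hasDerivAt x).sub (hg.hasDerivAt x)).deriv
  rw [this]
  convert! (hf.2 x).sub (hg.2 x) using 1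
  ring

lemma Solves.conj {p : ℝ → ℝ} {z : ℂ} {f : ℝ → ℂ} (hf : Solves p z f) :
    Solves p (conj z) (fun x => conj (f x)) := by
  have h1 : ∀ x, HasDerivAt (fun x => conj (f x)) (conj (deriv f x)) x := fun x =>
    (hf.hasDerivAt x).star
  refine ⟨fun x => (h1 x).differentiableAt, fun x => ?_⟩
  rw [funext fun x => (h1 x).deriv]
  convert! (hf.2 x).star using 1
  simp

lemma deriv_conj {f : ℝ → ℂ} {x : ℝ} (hf : DifferentiableAt ℝ f x) :
    deriv (fun x => conj (f x)) x = conj (deriv f x) :=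
  (hf.hasDerivAt.star).deriv

lemma Solves.eq_zero {p : ℝ → ℝ} (hp : Continuous p) {z : ℂ} {f : ℝ → ℂ} (hf : Solves p z f)
    (h0 : f 0 = 0) (h1 : deriv f 0 = 0) (x : ℝ) : f x = 0 := by
  have h := eq_zero_of_norm_deriv_le (E := ℂ × ℂ) (f := fun x => (f x, deriv f x))
    (f' := fun x => (deriv f x, ((p x : ℂ) - z) * f x))
    (fun x => (hf.hasDerivAt x).prodMk (hf.2 x)) (fun T => ?_) (by simp [h0, h1]) x
  · exact congrArg Prod.fst h
  · obtain ⟨K, hK⟩ := (isCompact_Icc (a := -T) (b := T)).exists_bound_of_continuousOn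
      (f := fun x => (p x : ℂ) - z) (by fun_prop)
    refine ⟨max K 1, fun t ht => ?_⟩
    have h2 := hK t (abs_le.1 ht)
    rw [Prod.norm_def, Prod.norm_def]
    refine max_le ?_ ?_
    · calc ‖deriv f t‖ ≤ 1 * max ‖f t‖ ‖deriv f t‖ := by rw [one_mul]; exact le_max_right _ _
        _ ≤ _ := by gcongr; exact le_max_right _ _
    · rw [norm_mul]
      gcongr
      · exact h2.trans (le_max_left _ _)
      · exact le_max_left _ _

lemma Solves.exists_eq_const_mul {p : ℝ → ℝ} (hp : Continuous p) {z : ℂ} {f g : ℝ → ℂ}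
    (hf : Solves p z f) (hg : Solves p z g) (hf0 : f ≠ 0) (hw : wron g f 0 = 0) :
    ∃ b : ℂ, ∀ x, g x = b * f x := by
  rw [wron] at hw
  have key : ∀ b : ℂ, g 0 = b * f 0 → deriv g 0 = b * deriv f 0 → ∀ x, g x = b * f x := by
    intro b h0 h1 x
    refine sub_eq_zero.1 ((hg.sub (hf.const_mul b)).eq_zero hp (by simp [h0]) ?_ x)
    have h2 : HasDerivAt (fun x => g x - b * f x) (deriv g 0 - b * deriv f 0) 0 :=
      (hg.hasDerivAt 0).sub ((hf.hasDerivAt 0).const_mul b)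
    rw [h2.deriv, h1, sub_self]
  by_cases h0 : f 0 = 0
  · have h1 : deriv f 0 ≠ 0 := fun h1 => hf0 (funext (hf.eq_zero hp h0 h1))
    refine ⟨deriv g 0 / deriv f 0, key _ ?_ ?_⟩
    · rw [h0, mul_zero, sub_zero] at hw
      rw [h0, mul_zero]
      exact (mul_eq_zero.1 hw).resolve_right h1
    · field_simp
  · refine ⟨g 0 / f 0, key _ ?_ ?_⟩
    · field_simp
    · field_simp
      linear_combination -hw

lemma jost_ne_zero {u : ℝ → ℝ} (hu : IsRightPotential u) {k : ℂ} (hk : 0 ≤ k.im) :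
    jost u k ≠ 0 := by
  intro h
  have h1 := (isJostRight_jost hu hk).2
  rw [h] at h1
  simp only [Pi.zero_apply, mul_zero] at h1
  exact zero_ne_one (tendsto_nhds_unique tendsto_const_nhds h1)

lemma norm_exp_I_mul (k : ℂ) (x : ℝ) : ‖exp (I * k * x)‖ = Real.exp (-k.im * x) := by
  rw [Complex.norm_exp]
  congr 1
  simp

lemma isJostRight_unique {u : ℝ → ℝ} (hu : IsRightPotential u) {k : ℂ} (hk : 0 ≤ k.im)
    {ψ : ℝ → ℂ} (hψ : IsJostRight u k ψ) : ψ = jost u k := by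
  have hf := solves_jost hu hk
  have hh := hψ.1.sub hf
  set h : ℝ → ℂ := fun x => ψ x - jost u k x with hdef
  have hv : Tendsto (fun x : ℝ => exp (-(I * k * x)) * h x) atTop (𝓝 0) := by
    have := hψ.2.sub (isJostRight_jost hu hk).2
    simp only [sub_self] at this
    refine this.congr fun x => ?_
    simp only [hdef]
    ring
  set w := wron h (jost u k) 0 with hw
  have hV : Tendsto (fun x : ℝ => exp (I * k * x) * h x) atTop (𝓝 0) := by
    refine squeeze_zero_norm' (a := fun x : ℝ => ‖exp (-(I * k * x)) * h x‖) ?_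
      (by simpa only [norm_zero] using hv.norm)
    filter_upwards [eventually_ge_atTop 0] with x hx
    have : exp (I * k * x) * h x = exp (2 * I * k * x) * (exp (-(I * k * x)) * h x) := by
      rw [← mul_assoc, ← Complex.exp_add]
      congr 2
      ring
    rw [this, norm_mul]
    exact mul_le_of_le_one_left (norm_nonneg _) (norm_exp_two_mul_le hk hx)
  have hVd : ∀ x : ℝ, HasDerivAt (fun x : ℝ => exp (I * k * x) * h x)
      (I * k * exp (I * k * x) * h x + exp (I * k * x) * deriv h x) x := fun x =>
    (hasDerivAt_exp_I_mul k x).mul (hh.hasDerivAt x)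
  have hm := tendsto_jostAmp hu hk
  have hprod : Tendsto (fun x : ℝ => (I * k * exp (I * k * x) * h x +
      exp (I * k * x) * deriv h x) * jostAmp u k x) atTop (𝓝 (-w)) := by
    have h1 := (((hV.mul hm).const_mul (I * k)).add
      (hV.mul (tendsto_exp_neg_mul_jostDeriv hu hk))).sub_const w
    rw [zero_mul, mul_zero, zero_mul, zero_add, zero_sub] at h1
    refine h1.congr fun x => ?_
    have hwx : w = wron h (jost u k) x := hh.wron_eq hf 0 x
    rw [hwx, wron, deriv_jost hu hk, ← exp_neg_mul_jost u k x]
    have : exp (I * k * x) * exp (-(I * k * x)) = 1 := by rw [← Complex.exp_add]; simp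
    linear_combination (h x * jostDeriv u k x - deriv h x * jost u k x) * this
  have hVt := hprod.div hm one_ne_zero
  rw [div_one] at hVt
  have hVt' : Tendsto (fun x : ℝ => I * k * exp (I * k * x) * h x +
      exp (I * k * x) * deriv h x) atTop (𝓝 (-w)) := by
    refine hVt.congr' ?_
    filter_upwards [hm.eventually_ne one_ne_zero] with x hx
    simp only [Pi.div_apply]
    field_simp
  have hw0 : w = 0 := neg_eq_zero.1 (eq_zero_of_tendsto_of_tendsto_deriv hVd hV hVt')
  obtain ⟨b, hb⟩ := hf.exists_eq_const_mul hu.continuous hh (jost_ne_zero hu hk) hw0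
  have hb0 : b = 0 := by
    have h1 := hm.const_mul b
    rw [mul_one] at h1
    refine tendsto_nhds_unique h1 (hv.congr fun x => ?_)
    rw [hb x, ← exp_neg_mul_jost u k x]
    ring
  ext x
  have := hb x
  rw [hb0, zero_mul] at this
  exact sub_eq_zero.1 this

lemma phi_eq_jost {p : ℝ → ℝ} (hp : IsRightPotential p) {k : ℂ} (hk : 0 ≤ k.im) :
    phi p k = jost p k :=
  isJostRight_unique hp hk (Classical.epsilon_spec ⟨_, isJostRight_jost hp hk⟩)

/-- The reflected potential that turns left Jost solutions into right ones. -/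
def leftPot (c : ℝ) (p : ℝ → ℝ) (x : ℝ) : ℝ := p (-x) + c ^ 2

lemma leftPot_neg (c : ℝ) (p : ℝ → ℝ) (x : ℝ) : leftPot c p (-x) - c ^ 2 = p x := by
  simp [leftPot]

lemma Solves.comp_neg {p : ℝ → ℝ} {z : ℂ} {ψ : ℝ → ℂ} (h : Solves p z ψ) (a : ℝ) :
    Solves (fun x => p (-x) + a) (z + a) (fun x => ψ (-x)) := by
  have h1 : ∀ x, HasDerivAt (fun x => ψ (-x)) (-deriv ψ (-x)) x := fun x => by
    have := (h.hasDerivAt (-x)).scomp x (hasDerivAt_neg x)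
    simpa [Function.comp_def] using this
  refine ⟨fun x => (h1 x).differentiableAt, fun x => ?_⟩
  rw [funext fun x => (h1 x).deriv]
  have := ((h.2 (-x)).scomp x (hasDerivAt_neg x)).neg
  convert! this using 1
  push_cast
  simp

lemma Solves.congr {p p' : ℝ → ℝ} {z z' : ℂ} {ψ : ℝ → ℂ} (h : Solves p z ψ) (hp : p = p')
    (hz : z = z') : Solves p' z' ψ := by
  subst hp hz; exact h

lemma IsJostLeft.isJostRight {c : ℝ} {p : ℝ → ℝ} {l : ℂ} {ψ : ℝ → ℂ} (h : IsJostLeft c p l ψ) :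
    IsJostRight (leftPot c p) l (fun x => ψ (-x)) := by
  refine ⟨(h.1.comp_neg (c ^ 2)).congr rfl (by push_cast; ring), ?_⟩
  have := h.2.comp tendsto_neg_atTop_atBot
  simpa [Function.comp_def] using this

lemma solves_leftJost {c : ℝ} {p : ℝ → ℝ} (hp : IsRightPotential (leftPot c p)) {l : ℂ}
    (hl : 0 ≤ l.im) : Solves p (l ^ 2 - c ^ 2) (fun x => jost (leftPot c p) l (-x)) :=
  ((solves_jost hp hl).comp_neg (-c ^ 2)).congr
    (funext fun x => by rw [← leftPot_neg c p x]; ring) (by push_cast; ring)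

lemma isJostLeft_jost {c : ℝ} {p : ℝ → ℝ} (hp : IsRightPotential (leftPot c p)) {l : ℂ}
    (hl : 0 ≤ l.im) : IsJostLeft c p l (fun x => jost (leftPot c p) l (-x)) := by
  refine ⟨solves_leftJost hp hl, ?_⟩
  have := (isJostRight_jost hp hl).2.comp tendsto_neg_atBot_atTop
  simpa [Function.comp_def] using this

lemma phiOne_eq_jost {c : ℝ} {p : ℝ → ℝ} (hp : IsRightPotential (leftPot c p)) {k : ℂ}
    (hk : 0 ≤ (kOne c k).im) :
    phiOne c p k = fun x => jost (leftPot c p) (kOne c k) (-x) := by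
  have h1 : IsJostLeft c p (kOne c k) (phiOne c p k) :=
    Classical.epsilon_spec ⟨_, isJostLeft_jost hp hk⟩
  have h2 := isJostRight_unique hp hk h1.isJostRight
  ext x
  have := congrFun h2 (-x)
  simpa using this

lemma hasDerivAt_leftJost {u : ℝ → ℝ} (hu : IsRightPotential u) {l : ℂ} (hl : 0 ≤ l.im) (x : ℝ) :
    HasDerivAt (fun x => jost u l (-x)) (-jostDeriv u l (-x)) x := by
  have := (hasDerivAt_jost hu hl (-x)).scomp x (hasDerivAt_neg x)
  simpa [Function.comp_def] using this

/-! ### Decay and the derivative of Jost solutions with respect to the spectral parameter -/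

section decay

variable {u : ℝ → ℝ}

lemma norm_jost_le (hu : IsRightPotential u) {k : ℂ} (hk : 0 ≤ k.im) {a x : ℝ} (h : a ≤ x) :
    ‖jost u k x‖ ≤ Real.exp (-k.im * x) * Real.exp (tailMoment u a a) := by
  rw [jost, norm_mul, norm_exp_I_mul]
  gcongr
  exact norm_jostAmp_le hu hk h

lemma norm_jostDeriv_le (hu : IsRightPotential u) {k : ℂ} (hk : 0 ≤ k.im) (a : ℝ) :
    ∃ C, ∀ x, a ≤ x → ‖jostDeriv u k x‖ ≤ Real.exp (-k.im * x) * C := by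
  refine ⟨‖k‖ * Real.exp (tailMoment u a a) +
    ∫ y in Set.Ioi a, |u y| * Real.exp (tailMoment u a a), fun x hx => ?_⟩
  rw [jostDeriv, norm_mul, norm_exp_I_mul]
  gcongr
  refine (norm_add_le _ _).trans ?_
  rw [norm_mul, norm_mul, norm_I, one_mul]
  have h1 := norm_jostAmp_le hu hk hx
  have h2 : ‖jostAmpDeriv u k x‖ ≤ ∫ y in Set.Ioi a, |u y| * Real.exp (tailMoment u a a) := by
    refine (norm_volterraDeriv_le hu hk (C := Real.exp (tailMoment u a a)) fun y hy =>
      norm_jostAmp_le hu hk (by linarith)).trans ?_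
    refine setIntegral_mono_set ((hu.integrableOn_abs a).mul_const _)
      (Eventually.of_forall fun y => by positivity)
      (LE.le.eventuallyLE (Set.Ioi_subset_Ioi hx))
  gcongr

lemma tendsto_exp_neg_mul_const {b : ℝ} (hb : 0 < b) (C : ℝ) :
    Tendsto (fun x => Real.exp (-b * x) * C) atTop (𝓝 0) := by
  have h : Tendsto (fun x : ℝ => -b * x) atTop atBot :=
    tendsto_id.const_mul_atTop_of_neg (by linarith)
  simpa using (Real.tendsto_exp_atBot.comp h).mul_const C

lemma tendsto_jost_zero (hu : IsRightPotential u) {k : ℂ} (hk : 0 < k.im) :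
    Tendsto (jost u k) atTop (𝓝 0) := by
  refine squeeze_zero_norm' ?_ (tendsto_exp_neg_mul_const hk (Real.exp (tailMoment u 0 0)))
  filter_upwards [eventually_ge_atTop 0] with x hx using norm_jost_le hu hk.le hx

lemma tendsto_jostDeriv_zero (hu : IsRightPotential u) {k : ℂ} (hk : 0 < k.im) :
    Tendsto (jostDeriv u k) atTop (𝓝 0) := by
  obtain ⟨C, hC⟩ := norm_jostDeriv_le hu hk.le 0
  refine squeeze_zero_norm' ?_ (tendsto_exp_neg_mul_const hk C)
  filter_upwards [eventually_ge_atTop 0] with x hx using hC x hx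

lemma continuous_jost (hu : IsRightPotential u) {k : ℂ} (hk : 0 ≤ k.im) : Continuous (jost u k) :=
  continuous_iff_continuousAt.2 fun x => (hasDerivAt_jost hu hk x).continuousAt

lemma continuous_jostDeriv (hu : IsRightPotential u) {k : ℂ} (hk : 0 ≤ k.im) :
    Continuous (jostDeriv u k) :=
  continuous_iff_continuousAt.2 fun x => (hasDerivAt_jostDeriv hu hk x).continuousAt

lemma norm_jost_mul_jost_le (hu : IsRightPotential u) {k₀ k : ℂ} (hk₀ : 0 < k₀.im)
    (hk : 0 < k.im) {x : ℝ} (hx : 0 ≤ x) :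
    ‖jost u k₀ x * jost u k x‖ ≤ Real.exp (-k₀.im * x) * Real.exp (tailMoment u 0 0) ^ 2 := by
  rw [norm_mul, pow_two, ← mul_assoc]
  have h1 := norm_jost_le hu hk₀.le hx
  have h2 := norm_jost_le hu hk.le hx
  have h3 : Real.exp (-k.im * x) ≤ 1 := Real.exp_le_one_iff.2 (by nlinarith)
  gcongr
  refine h2.trans (mul_le_of_le_one_left (Real.exp_pos _).le h3)

lemma integrableOn_jost_bound {k₀ : ℂ} (hk₀ : 0 < k₀.im) (C : ℝ) :
    IntegrableOn (fun x : ℝ => Real.exp (-k₀.im * x) * C) (Set.Ioi 0) :=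
  (exp_neg_integrableOn_Ioi 0 hk₀).mul_const C

lemma jost_wronskian_eq_integral (hu : IsRightPotential u) {k₀ k : ℂ} (hk₀ : 0 < k₀.im)
    (hk : 0 < k.im) :
    jost u k₀ 0 * jostDeriv u k 0 - jostDeriv u k₀ 0 * jost u k 0 =
      (k ^ 2 - k₀ ^ 2) * ∫ x in Set.Ioi (0 : ℝ), jost u k₀ x * jost u k x := by
  have hW := fun x => (solves_jost hu hk₀.le).hasDerivAt_wron (solves_jost hu hk.le) x
  have hint : IntegrableOn (fun x => jost u k₀ x * jost u k x) (Set.Ioi 0) := by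
    refine Integrable.mono' (integrableOn_jost_bound hk₀ (Real.exp (tailMoment u 0 0) ^ 2))
      ((continuous_jost hu hk₀.le).mul (continuous_jost hu hk.le)).aestronglyMeasurable ?_
    exact (ae_restrict_iff' measurableSet_Ioi).2 (Eventually.of_forall fun x hx =>
      norm_jost_mul_jost_le hu hk₀ hk (le_of_lt hx))
  have hlim : Tendsto (wron (jost u k₀) (jost u k)) atTop (𝓝 0) := by
    have := ((tendsto_jost_zero hu hk₀).mul (tendsto_jostDeriv_zero hu hk)).sub
      ((tendsto_jostDeriv_zero hu hk₀).mul (tendsto_jost_zero hu hk))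
    rw [mul_zero, sub_zero] at this
    refine this.congr fun x => ?_
    rw [wron, deriv_jost hu hk₀.le, deriv_jost hu hk.le]
  have := integral_Ioi_of_hasDerivAt_of_tendsto' (a := 0) (fun x _ => hW x)
    (hint.const_mul _) hlim
  rw [integral_const_mul, wron, deriv_jost hu hk₀.le, deriv_jost hu hk.le] at this
  linear_combination this

lemma hasDerivAt_jost_wronskian (hu : IsRightPotential u) {k₀ : ℂ} (hk₀ : 0 < k₀.im) :
    HasDerivAt (fun k => jost u k₀ 0 * jostDeriv u k 0 - jostDeriv u k₀ 0 * jost u k 0)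
      (2 * k₀ * ∫ x in Set.Ioi (0 : ℝ), jost u k₀ x ^ 2) k₀ := by
  have hev : ∀ᶠ k : ℂ in 𝓝 k₀, 0 < k.im := isOpen_upper.mem_nhds hk₀
  have hG : Tendsto (fun k => ∫ x in Set.Ioi (0 : ℝ), jost u k₀ x * jost u k x) (𝓝 k₀)
      (𝓝 (∫ x in Set.Ioi (0 : ℝ), jost u k₀ x * jost u k₀ x)) := by
    refine tendsto_integral_filter_of_dominated_convergence _ ?_ ?_
      (integrableOn_jost_bound hk₀ (Real.exp (tailMoment u 0 0) ^ 2)) ?_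
    · filter_upwards [hev] with k hk
      exact ((continuous_jost hu hk₀.le).mul (continuous_jost hu hk.le)).aestronglyMeasurable
    · filter_upwards [hev] with k hk
      exact (ae_restrict_iff' measurableSet_Ioi).2 (Eventually.of_forall fun x hx =>
        norm_jost_mul_jost_le hu hk₀ hk (le_of_lt hx))
    · refine Eventually.of_forall fun x => ?_
      exact ((differentiableOn_jost_param hu x).differentiableAt
        (isOpen_upper.mem_nhds hk₀)).continuousAt.tendsto.const_mul _
  rw [hasDerivAt_iff_tendsto_slope]
  have h1 : Tendsto (fun k => (k + k₀) * ∫ x in Set.Ioi (0 : ℝ), jost u k₀ x * jost u k x)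
      (𝓝[≠] k₀) (𝓝 (2 * k₀ * ∫ x in Set.Ioi (0 : ℝ), jost u k₀ x ^ 2)) := by
    have h2 : Tendsto (fun k : ℂ => k + k₀) (𝓝 k₀) (𝓝 (k₀ + k₀)) :=
      (continuous_id.add continuous_const).tendsto k₀
    have := (h2.mul hG).mono_left (nhdsWithin_le_nhds (s := {k₀}ᶜ))
    simpa [two_mul, pow_two] using this
  refine h1.congr' ?_
  filter_upwards [nhdsWithin_le_nhds hev, self_mem_nhdsWithin] with k hk hne
  rw [slope_def_field, jost_wronskian_eq_integral hu hk₀ hk,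
    jost_wronskian_eq_integral hu hk₀ hk₀]
  have : k - k₀ ≠ 0 := sub_ne_zero.2 hne
  field_simp
  ring

end decay

/-! ### Scattering theory of a steplike potential -/

/-- Continuous potentials that tend to `0` at `+∞` and to `-c²` at `-∞` with finite first moments of
the perturbation. -/
structure IsSteplikePotential (c : ℝ) (p : ℝ → ℝ) : Prop where
  right : IsRightPotential p
  left : IsRightPotential (leftPot c p)

/-- The Wronskian of the left Jost solution with parameter `l` and the right Jost solution with
parameter `k`, as a function of two independent variables. -/
def jostW (c : ℝ) (p : ℝ → ℝ) (k l : ℂ) : ℂ :=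
  jost (leftPot c p) l 0 * jostDeriv p k 0 + jostDeriv (leftPot c p) l 0 * jost p k 0

section

variable {c : ℝ} {p : ℝ → ℝ}

lemma wron_leftJost_jost (hp : IsSteplikePotential c p) {k l : ℂ} (hk : 0 ≤ k.im)
    (hl : 0 ≤ l.im) :
    wron (fun x => jost (leftPot c p) l (-x)) (jost p k) 0 = jostW c p k l := by
  rw [wron, deriv_jost hp.right hk, (hasDerivAt_leftJost hp.left hl 0).deriv, jostW]
  simp

lemma wronskian_eq_jostW (hp : IsSteplikePotential c p) {k : ℂ} (hk : 0 ≤ k.im)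
    (hl : 0 ≤ (kOne c k).im) : wronskian c p k = jostW c p k (kOne c k) := by
  rw [← wron_leftJost_jost hp hk hl, wronskian, phi_eq_jost hp.right hk,
    phiOne_eq_jost hp.left hl, wron]

lemma tendsto_jost_param {u : ℝ → ℝ} (hu : IsRightPotential u) {ι : Type*} {F : Filter ι}
    {f : ι → ℂ} {k₀ : ℂ} (hf : Tendsto f F (𝓝 k₀)) (hfi : ∀ᶠ i in F, 0 ≤ (f i).im)
    (hk₀ : 0 ≤ k₀.im) (x : ℝ) : Tendsto (fun i => jost u (f i) x) F (𝓝 (jost u k₀ x)) :=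
  (continuousOn_jost_param hu x k₀ hk₀).tendsto.comp
    (tendsto_nhdsWithin_iff.2 ⟨hf, hfi⟩)

lemma tendsto_jostDeriv_param {u : ℝ → ℝ} (hu : IsRightPotential u) {ι : Type*} {F : Filter ι}
    {f : ι → ℂ} {k₀ : ℂ} (hf : Tendsto f F (𝓝 k₀)) (hfi : ∀ᶠ i in F, 0 ≤ (f i).im)
    (hk₀ : 0 ≤ k₀.im) (x : ℝ) :
    Tendsto (fun i => jostDeriv u (f i) x) F (𝓝 (jostDeriv u k₀ x)) :=
  (continuousOn_jostDeriv_param hu x k₀ hk₀).tendsto.comp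
    (tendsto_nhdsWithin_iff.2 ⟨hf, hfi⟩)

lemma tendsto_jostW (hp : IsSteplikePotential c p) {ι : Type*} {F : Filter ι} {f g : ι → ℂ}
    {k₀ l₀ : ℂ} (hf : Tendsto f F (𝓝 k₀)) (hfi : ∀ᶠ i in F, 0 ≤ (f i).im) (hk₀ : 0 ≤ k₀.im)
    (hg : Tendsto g F (𝓝 l₀)) (hgi : ∀ᶠ i in F, 0 ≤ (g i).im) (hl₀ : 0 ≤ l₀.im) :
    Tendsto (fun i => jostW c p (f i) (g i)) F (𝓝 (jostW c p k₀ l₀)) :=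
  ((tendsto_jost_param hp.left hg hgi hl₀ 0).mul
    (tendsto_jostDeriv_param hp.right hf hfi hk₀ 0)).add
  ((tendsto_jostDeriv_param hp.left hg hgi hl₀ 0).mul
    (tendsto_jost_param hp.right hf hfi hk₀ 0))

lemma conj_jostW (hp : IsSteplikePotential c p) {k l : ℂ} (hk : 0 ≤ k.im) (hl : 0 ≤ l.im) :
    conj (jostW c p k l) = jostW c p (-conj k) (-conj l) := by
  simp [jostW, conj_jost, conj_jostDeriv hp.left hl, conj_jostDeriv hp.right hk]

/-- If the Wronskian vanishes, the Jost solutions are proportional. -/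
lemma exists_leftJost_eq (hp : IsSteplikePotential c p) {k l : ℂ} (hk : 0 ≤ k.im)
    (hl : 0 ≤ l.im) (hkl : l ^ 2 = k ^ 2 + c ^ 2) (hW : jostW c p k l = 0) :
    ∃ b : ℂ, ∀ x, jost (leftPot c p) l (-x) = b * jost p k x := by
  refine (solves_jost hp.right hk).exists_eq_const_mul hp.right.continuous
    ((solves_leftJost hp.left hl).congr rfl (by rw [hkl]; ring)) (jost_ne_zero hp.right hk) ?_
  rw [wron_leftJost_jost hp hk hl, hW]

lemma leftJost_deriv_eq (hp : IsSteplikePotential c p) {k l : ℂ} (hk : 0 ≤ k.im)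
    (hl : 0 ≤ l.im) {b : ℂ} (hb : ∀ x, jost (leftPot c p) l (-x) = b * jost p k x) (x : ℝ) :
    -jostDeriv (leftPot c p) l (-x) = b * jostDeriv p k x := by
  have h1 := hasDerivAt_leftJost hp.left hl x
  rw [funext hb] at h1
  exact h1.unique ((hasDerivAt_jost hp.right hk x).const_mul b)

lemma leftJost_coeff_ne_zero (hp : IsSteplikePotential c p) {k l : ℂ} (hl : 0 ≤ l.im) {b : ℂ}
    (hb : ∀ x, jost (leftPot c p) l (-x) = b * jost p k x) : b ≠ 0 := by
  rintro rfl
  apply jost_ne_zero hp.left hl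
  ext x
  simpa using hb (-x)

lemma jost_wron_conj {u : ℝ → ℝ} (hu : IsRightPotential u) (l : ℝ) (x : ℝ) :
    jost u l x * conj (jostDeriv u l x) - jostDeriv u l x * conj (jost u l x) = -(2 * I * l) := by
  have hl : 0 ≤ (l : ℂ).im := by simp
  have hs := solves_jost hu hl
  have hc : Solves u ((l : ℂ) ^ 2) (fun x => conj (jost u l x)) :=
    hs.conj.congr rfl (by simp)
  have hw : ∀ x, wron (jost u l) (fun x => conj (jost u l x)) x =
      jost u l x * conj (jostDeriv u l x) - jostDeriv u l x * conj (jost u l x) := by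
    intro x
    rw [wron, deriv_conj (hs.1 x), deriv_jost hu hl]
  rw [← hw x]
  have hlim : Tendsto (wron (jost u l) (fun x => conj (jost u l x))) atTop
      (𝓝 (1 * conj (I * l) - I * l * conj 1)) := by
    have h1 := (isJostRight_jost hu hl).2
    have h2 := tendsto_exp_neg_mul_jostDeriv hu hl
    have h3 := (Complex.continuous_conj.tendsto _).comp h1
    have h4 := (Complex.continuous_conj.tendsto _).comp h2
    refine ((h1.mul h4).sub (h2.mul h3)).congr fun x => ?_
    have : exp (-(I * l * x)) * conj (exp (-(I * l * x))) = 1 := by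
      rw [← Complex.exp_conj, ← Complex.exp_add]
      simp
    simp only [Function.comp_apply, map_mul]
    rw [hw]
    linear_combination (jost u l x * conj (jostDeriv u l x) -
      jostDeriv u l x * conj (jost u l x)) * this
  have hconst : Tendsto (wron (jost u l) (fun x => conj (jost u l x))) atTop
      (𝓝 (wron (jost u l) (fun x => conj (jost u l x)) x)) :=
    tendsto_const_nhds.congr fun y => hs.wron_eq hc x y
  rw [tendsto_nhds_unique hconst hlim]
  simp
  ring

lemma conj_jost_imaginary {u : ℝ → ℝ} (y : ℝ) (x : ℝ) :
    conj (jost u (I * y) x) = jost u (I * y) x := by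
  rw [conj_jost]
  simp

lemma conj_jostDeriv_imaginary {u : ℝ → ℝ} (hu : IsRightPotential u) {y : ℝ} (hy : 0 ≤ y) (x : ℝ) :
    conj (jostDeriv u (I * y) x) = jostDeriv u (I * y) x := by
  rw [conj_jostDeriv hu (by simpa using hy)]
  simp

/-- The Wronskian does not vanish on the boundary of the upper half plane and of the cut, except
possibly at the branch point. -/
lemma jostW_ne_zero_of_real (hp : IsSteplikePotential c p) {k : ℂ} {l : ℝ} (hl : l ≠ 0)
    (hkl : (l : ℂ) ^ 2 = k ^ 2 + c ^ 2)
    (hk : (∃ r : ℝ, k = r ∧ 0 ≤ r * l) ∨ ∃ y : ℝ, k = I * y ∧ 0 ≤ y) : jostW c p k l ≠ 0 := by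
  intro hW
  have hk0 : 0 ≤ k.im := by
    rcases hk with ⟨r, rfl, _⟩ | ⟨y, rfl, hy⟩
    · simp
    · simpa using hy
  have hl0 : 0 ≤ (l : ℂ).im := by simp
  obtain ⟨b, hb⟩ := exists_leftJost_eq hp hk0 hl0 hkl hW
  have h0 := hb 0
  have h1 := leftJost_deriv_eq hp hk0 hl0 hb 0
  rw [neg_zero] at h0 h1
  have h2 := jost_wron_conj hp.left l 0
  have h1' : jostDeriv (leftPot c p) l 0 = -(b * jostDeriv p k 0) := by rw [← h1]; ring
  rw [h0, h1'] at h2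
  simp only [map_neg, map_mul] at h2
  rcases hk with ⟨r, rfl, hr⟩ | ⟨y, rfl, hy⟩
  · have h3 := jost_wron_conj hp.right r 0
    have h4 : (b * conj b) * (2 * I * r) = -(2 * I * l) := by
      linear_combination h2 + b * conj b * h3
    rw [Complex.mul_conj] at h4
    have h5 : (Complex.normSq b : ℂ) * r = -l := by
      have : (2 * I : ℂ) ≠ 0 := by simp
      apply mul_left_cancel₀ this
      linear_combination h4
    have h6 : Complex.normSq b * r = -l := by exact_mod_cast h5
    have h7 := Complex.normSq_nonneg b
    have h8 : l ^ 2 = -(Complex.normSq b * (r * l)) := by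
      linear_combination l * h6
    have h9 : l ^ 2 ≤ 0 := by
      rw [h8]; nlinarith [mul_nonneg h7 hr]
    exact hl (pow_eq_zero_iff (two_ne_zero) |>.1 (le_antisymm h9 (sq_nonneg l)))
  · rw [conj_jost_imaginary, conj_jostDeriv_imaginary hp.right hy] at h2
    have h3 : (2 * I * l : ℂ) = 0 := by linear_combination h2
    simp [hl] at h3

/-- Zeros of the Wronskian in the upper half plane lie on the imaginary axis. -/
lemma re_eq_zero_of_jostW_eq_zero (hp : IsSteplikePotential c p) {k l : ℂ} (hk : 0 < k.im)
    (hl : 0 < l.im) (hkl : l ^ 2 = k ^ 2 + c ^ 2) (hW : jostW c p k l = 0) : k.re = 0 := by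
  by_contra hre
  obtain ⟨b, hb⟩ := exists_leftJost_eq hp hk.le hl.le hkl hW
  have hb0 := leftJost_coeff_ne_zero hp hl.le hb
  have hb' := leftJost_deriv_eq hp hk.le hl.le hb
  have hs := solves_jost hp.right hk.le
  set f := jost p k with hf
  set s : ℂ := k ^ 2 - conj (k ^ 2) with hsdef
  have hs0 : s ≠ 0 := by
    intro h
    have := congrArg Complex.im h
    rw [hsdef, pow_two] at this
    simp at this
    have : k.re * k.im = 0 := by linarith
    rcases mul_eq_zero.1 this with h | h
    · exact hre h
    · exact hk.ne' h
  have hd : ∀ x, HasDerivAt (fun x => (wron f (fun x => conj (f x)) x / s).re)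
      (Complex.normSq (f x)) x := by
    intro x
    have h1 := ((hs.hasDerivAt_wron hs.conj x).div_const s)
    have h2 := (Complex.reCLM.hasFDerivAt (x := wron f (fun x => conj (f x)) x / s)).comp_hasDerivAt
      x h1
    convert! h2 using 1
    rw [Complex.mul_conj, ← hsdef, mul_div_cancel_left₀ _ hs0]
    simp
  have hmono : Monotone fun x => (wron f (fun x => conj (f x)) x / s).re :=
    monotone_of_deriv_nonneg (fun x => (hd x).differentiableAt)
      fun x => by rw [(hd x).deriv]; exact Complex.normSq_nonneg _
  have hlim : ∀ F : Filter ℝ, Tendsto f F (𝓝 0) → Tendsto (jostDeriv p k) F (𝓝 0) →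
      Tendsto (fun x => (wron f (fun x => conj (f x)) x / s).re) F (𝓝 0) := by
    intro F h1 h2
    have h3 := (Complex.continuous_conj.tendsto _).comp h1
    have h4 := (Complex.continuous_conj.tendsto _).comp h2
    have h5 := ((h1.mul h4).sub (h2.mul h3)).div_const s
    have h6 := (Complex.continuous_re.tendsto _).comp h5
    simp only [map_zero, mul_zero, sub_zero, zero_div, zero_re] at h6
    refine h6.congr fun x => ?_
    simp only [Function.comp_apply]
    rw [wron, deriv_conj (hs.1 x), deriv_jost hp.right hk.le]
  have htop := hlim atTop (tendsto_jost_zero hp.right hk) (tendsto_jostDeriv_zero hp.right hk)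
  have hbot := hlim atBot (by
    have := ((tendsto_jost_zero hp.left hl).comp tendsto_neg_atBot_atTop).const_mul b⁻¹
    rw [mul_zero] at this
    refine this.congr fun x => ?_
    simp only [Function.comp_apply]
    rw [hb x]
    field_simp) (by
    have := ((tendsto_jostDeriv_zero hp.left hl).comp tendsto_neg_atBot_atTop).const_mul (-b⁻¹)
    rw [mul_zero] at this
    refine this.congr fun x => ?_
    simp only [Function.comp_apply]
    have := hb' x
    field_simp
    linear_combination this)
  have hzero : (fun x => (wron f (fun x => conj (f x)) x / s).re) = fun _ => 0 :=
    funext fun x => le_antisymm (hmono.ge_of_tendsto htop x) (hmono.le_of_tendsto hbot x)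
  apply jost_ne_zero hp.right hk.le
  ext x
  have h1 := hd x
  rw [hzero] at h1
  exact Complex.normSq_eq_zero.1 (h1.unique (hasDerivAt_const x 0))

/-- The derivative of the Wronskian at a zero. -/
lemma hasDerivAt_jostW (hp : IsSteplikePotential c p) {k₀ : ℂ} {l : ℂ → ℂ} (hk₀ : 0 < k₀.im)
    (hl₀ : 0 < (l k₀).im) (hl : HasDerivAt l (k₀ / l k₀) k₀) {b : ℂ} (hb0 : b ≠ 0)
    (hb : ∀ x, jost (leftPot c p) (l k₀) (-x) = b * jost p k₀ x) :
    HasDerivAt (fun k => jostW c p k (l k))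
      (2 * k₀ * b * ((∫ x in Set.Ioi (0 : ℝ), jost p k₀ x ^ 2) +
        ∫ x in Set.Iic (0 : ℝ), jost p k₀ x ^ 2)) k₀ := by
  have e0 := hb 0
  have e1 := leftJost_deriv_eq hp hk₀.le hl₀.le hb 0
  rw [neg_zero] at e0 e1
  have hl0 : l k₀ ≠ 0 := by intro h; rw [h] at hl₀; simp at hl₀
  have d1 := ((differentiableOn_jost_param hp.right 0).differentiableAt
    (isOpen_upper.mem_nhds hk₀)).hasDerivAt
  have d2 := ((differentiableOn_jostDeriv_param hp.right 0).differentiableAt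
    (isOpen_upper.mem_nhds hk₀)).hasDerivAt
  have d3 := ((differentiableOn_jost_param hp.left 0).differentiableAt
    (isOpen_upper.mem_nhds hl₀)).hasDerivAt
  have d4 := ((differentiableOn_jostDeriv_param hp.left 0).differentiableAt
    (isOpen_upper.mem_nhds hl₀)).hasDerivAt
  have w1 := (hasDerivAt_jost_wronskian hp.right hk₀).unique ((d2.const_mul _).sub (d1.const_mul _))
  have w2 := (hasDerivAt_jost_wronskian hp.left hl₀).unique ((d4.const_mul _).sub (d3.const_mul _))
  have hI : ∫ x in Set.Ioi (0 : ℝ), jost (leftPot c p) (l k₀) x ^ 2 =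
      b ^ 2 * ∫ x in Set.Iic (0 : ℝ), jost p k₀ x ^ 2 := by
    have h1 := integral_comp_neg_Iic (0 : ℝ) (fun x => jost (leftPot c p) (l k₀) x ^ 2)
    rw [neg_zero] at h1
    rw [← h1, ← integral_const_mul]
    congr 1
    ext x
    rw [hb x]
    ring
  rw [hI] at w2
  have key := ((d3.comp k₀ hl).mul d2).add ((d4.comp k₀ hl).mul d1)
  refine key.congr_deriv ?_
  simp only [Function.comp_apply]
  set A1 := deriv (fun k => jost p k 0) k₀
  set A2 := deriv (fun k => jostDeriv p k 0) k₀
  set A3 := deriv (fun k => jost (leftPot c p) k 0) (l k₀)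
  set A4 := deriv (fun k => jostDeriv (leftPot c p) k 0) (l k₀)
  set J1 := ∫ x in Set.Ioi (0 : ℝ), jost p k₀ x ^ 2
  set J2 := ∫ x in Set.Iic (0 : ℝ), jost p k₀ x ^ 2
  have e1' : jostDeriv (leftPot c p) (l k₀) 0 = -(b * jostDeriv p k₀ 0) := by rw [← e1]; ring
  rw [e0, e1'] at w2 ⊢
  have w2' : 2 * l k₀ * (b * J2) = jost p k₀ 0 * A4 + jostDeriv p k₀ 0 * A3 := by
    apply mul_left_cancel₀ hb0
    linear_combination w2
  field_simp
  linear_combination (-k₀) * w2' - l k₀ * b * w1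

end

/-! ### The function `k₁` -/

section kOne

variable {c : ℝ}

lemma kOne_of_im_ne_zero {k : ℂ} (hk : k.im ≠ 0) :
    kOne c k = I * (-(k ^ 2 + (c : ℂ) ^ 2)) ^ (2⁻¹ : ℂ) := by
  rw [kOne, if_neg hk, one_div]

lemma kOne_ofReal_of_nonneg {r : ℝ} (hr : 0 ≤ r) : kOne c r = Real.sqrt (r ^ 2 + c ^ 2) := by
  simp [kOne, hr]

lemma kOne_ofReal_of_neg {r : ℝ} (hr : r < 0) : kOne c r = -Real.sqrt (r ^ 2 + c ^ 2) := by
  simp [kOne, hr.not_ge]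

lemma cpow_half_sq (z : ℂ) : (z ^ (2⁻¹ : ℂ)) ^ 2 = z := by
  simp

lemma kOne_sq (k : ℂ) : kOne c k ^ 2 = k ^ 2 + c ^ 2 := by
  by_cases hk : k.im = 0
  · have hk' : k = (k.re : ℂ) := by apply Complex.ext <;> simp [hk]
    have hs : Real.sqrt (k.re ^ 2 + c ^ 2) ^ 2 = k.re ^ 2 + c ^ 2 := Real.sq_sqrt (by positivity)
    rw [hk']
    rcases le_or_gt 0 k.re with h | h
    · rw [kOne_ofReal_of_nonneg h]
      exact_mod_cast hs
    · rw [kOne_ofReal_of_neg h, neg_sq]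
      exact_mod_cast hs
  · rw [kOne_of_im_ne_zero hk, mul_pow, cpow_half_sq, I_sq]
    ring

lemma kOne_im_nonneg (k : ℂ) : 0 ≤ (kOne c k).im := by
  by_cases hk : k.im = 0
  · rw [kOne, if_pos hk]
    split_ifs <;> simp
  · rw [kOne_of_im_ne_zero hk]
    simp only [mul_im, I_re, I_im, zero_mul, one_mul, zero_add]
    rw [Complex.cpow_inv_two_re]
    positivity

lemma kOne_im_pos (hc : 0 < c) {k : ℂ} (hk : k ∉ contour c) : 0 < (kOne c k).im := by
  refine lt_of_le_of_ne (kOne_im_nonneg k) fun h => hk ?_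
  have h1 : kOne c k = ((kOne c k).re : ℂ) := by apply Complex.ext <;> simp [h.symm]
  have h2 := kOne_sq (c := c) k
  rw [h1] at h2
  have him := congrArg Complex.im h2
  have hre := congrArg Complex.re h2
  simp [pow_two] at him hre
  by_cases h0 : k.im = 0
  · exact Or.inl h0
  · have h3 : k.re = 0 := by
      have : k.re * k.im = 0 := by linarith
      exact (mul_eq_zero.1 this).resolve_right h0
    refine Or.inr ⟨h3, ?_⟩
    rw [h3] at hre
    exact abs_le_of_sq_le_sq (by nlinarith [mul_self_nonneg (kOne c k).re]) hc.le

lemma im_ne_zero_of_notMem_contour {k : ℂ} (hk : k ∉ contour c) : k.im ≠ 0 :=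
  fun h => hk (Or.inl h)

lemma isClosed_contour (c : ℝ) : IsClosed (contour c) := by
  refine (isClosed_eq continuous_im continuous_const).union ?_
  exact (isClosed_eq continuous_re continuous_const).inter
    (isClosed_le (continuous_abs.comp continuous_im) continuous_const)

lemma differentiableAt_kOne (hc : 0 < c) {k : ℂ} (hk : k ∉ contour c) :
    DifferentiableAt ℂ (kOne c) k := by
  have hev : kOne c =ᶠ[𝓝 k] fun k => I * (-(k ^ 2 + (c : ℂ) ^ 2)) ^ (2⁻¹ : ℂ) := by
    filter_upwards [(isClosed_contour c).isOpen_compl.mem_nhds hk] with z hz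
    exact kOne_of_im_ne_zero (im_ne_zero_of_notMem_contour hz)
  refine DifferentiableAt.congr_of_eventuallyEq ?_ hev
  have hslit : -(k ^ 2 + (c : ℂ) ^ 2) ∈ slitPlane := by
    rw [Complex.mem_slitPlane_iff]
    by_contra! h
    apply hk
    obtain ⟨h1, h2⟩ := h
    simp [pow_two] at h1 h2
    by_cases h0 : k.im = 0
    · exact Or.inl h0
    · have h3 : k.re = 0 := by
        have : k.re * k.im = 0 := by linarith
        exact (mul_eq_zero.1 this).resolve_right h0
      refine Or.inr ⟨h3, abs_le_of_sq_le_sq ?_ hc.le⟩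
      rw [h3] at h1
      nlinarith
  have hd : DifferentiableAt ℂ (fun k : ℂ => -(k ^ 2 + (c : ℂ) ^ 2)) k := by fun_prop
  exact ((hd.hasDerivAt.cpow_const hslit).differentiableAt).const_mul I

lemma hasDerivAt_kOne (hc : 0 < c) {k : ℂ} (hk : k ∉ contour c) :
    HasDerivAt (kOne c) (k / kOne c k) k := by
  have h := (differentiableAt_kOne hc hk).hasDerivAt
  have h1 := h.pow 2
  have h2 : HasDerivAt (fun k : ℂ => k ^ 2 + (c : ℂ) ^ 2) (2 * k) k := by
    simpa using (hasDerivAt_pow 2 k).add_const ((c : ℂ) ^ 2)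
  have h3 : kOne c ^ 2 = fun k : ℂ => k ^ 2 + (c : ℂ) ^ 2 := funext fun k => kOne_sq k
  rw [h3] at h1
  have h4 := h1.unique h2
  have h5 : kOne c k ≠ 0 := by
    intro h0
    have := kOne_im_pos hc hk
    rw [h0] at this
    simp at this
  refine h.congr_deriv ?_
  field_simp
  simp at h4
  linear_combination h4 / 2

lemma eq_of_sq_eq_of_im_pos {a b : ℂ} (h : a ^ 2 = b ^ 2) (ha : 0 < a.im) (hb : 0 < b.im) :
    a = b := by
  rcases sq_eq_sq_iff_eq_or_eq_neg.1 h with h | h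
  · exact h
  · rw [h] at ha
    simp at ha
    linarith

lemma neg_conj_mem_contour {k : ℂ} : -conj k ∈ contour c ↔ k ∈ contour c := by
  simp [contour]

lemma kOne_neg_conj (hc : 0 < c) {k : ℂ} (hk : k ∉ contour c) :
    kOne c (-conj k) = -conj (kOne c k) := by
  refine eq_of_sq_eq_of_im_pos ?_ (kOne_im_pos hc (neg_conj_mem_contour.not.2 hk)) ?_
  · rw [kOne_sq, neg_sq, neg_sq, ← map_pow, ← map_pow, kOne_sq]
    simp
  · simpa using kOne_im_pos hc hk

lemma notMem_contour_of_re_pos {k : ℂ} (hre : 0 < k.re) (him : 0 < k.im) : k ∉ contour c := by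
  rintro (h | h)
  · exact him.ne' h
  · exact hre.ne' h.1

lemma kOne_eq_cpow (hc : 0 < c) {k : ℂ} (hre : 0 < k.re) (him : 0 < k.im) :
    kOne c k = (k ^ 2 + (c : ℂ) ^ 2) ^ (2⁻¹ : ℂ) := by
  refine eq_of_sq_eq_of_im_pos ?_ (kOne_im_pos hc (notMem_contour_of_re_pos hre him)) ?_
  · rw [kOne_sq, cpow_half_sq]
  · have h1 : 0 ≤ ((k ^ 2 + (c : ℂ) ^ 2) ^ (2⁻¹ : ℂ)).re := by
      rw [Complex.cpow_inv_two_re]; positivity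
    have h2 := congrArg Complex.im (cpow_half_sq (k ^ 2 + (c : ℂ) ^ 2))
    simp only [pow_two ((k ^ 2 + (c : ℂ) ^ 2) ^ (2⁻¹ : ℂ)), mul_im] at h2
    have h3 : (k ^ 2 + (c : ℂ) ^ 2).im = 2 * (k.re * k.im) := by
      simp [pow_two]; ring
    rw [h3] at h2
    have h4 : 0 < k.re * k.im := mul_pos hre him
    by_contra hcon
    nlinarith

/-- Boundary values of `k₁` from the first quadrant. -/
lemma tendsto_kOne_quadrant (hc : 0 < c) {k₀ : ℂ} {l : ℝ} (hl : 0 ≤ l)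
    (hkl : (l : ℂ) ^ 2 = k₀ ^ 2 + c ^ 2) :
    Tendsto (kOne c) (𝓝[{k | 0 < k.re ∧ 0 < k.im}] k₀) (𝓝 l) := by
  have h0 : (l : ℂ) = (k₀ ^ 2 + (c : ℂ) ^ 2) ^ (2⁻¹ : ℂ) := by
    rw [← hkl]
    have : ((l : ℂ) ^ 2) = ((l ^ 2 : ℝ) : ℂ) := by push_cast; ring
    have h2 : (2⁻¹ : ℂ) = ((2⁻¹ : ℝ) : ℂ) := by push_cast; ring
    rw [this, h2, ← Complex.ofReal_cpow (by positivity), ← one_div, ← Real.sqrt_eq_rpow, Real.sqrt_sq hl]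
  have hcont : ContinuousAt (fun k : ℂ => (k ^ 2 + (c : ℂ) ^ 2) ^ (2⁻¹ : ℂ)) k₀ := by
    have h1 : ContinuousAt (fun z : ℂ => z ^ (2⁻¹ : ℂ)) (k₀ ^ 2 + (c : ℂ) ^ 2) := by
      refine Complex.continuousAt_cpow_const_of_re_pos (Or.inl ?_) (by norm_num)
      rw [← hkl, ← ofReal_pow, ofReal_re]
      positivity
    exact ContinuousAt.comp (f := fun k : ℂ => k ^ 2 + (c : ℂ) ^ 2) h1 (by fun_prop)
  rw [h0]
  refine (hcont.tendsto.mono_left nhdsWithin_le_nhds).congr' ?_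
  filter_upwards [self_mem_nhdsWithin] with k hk
  exact (kOne_eq_cpow hc hk.1 hk.2).symm

lemma kOne_imaginary (hc : 0 < c) {s : ℝ} (hs : c ≤ s) :
    kOne c (I * s) = I * Real.sqrt (s ^ 2 - c ^ 2) := by
  have hs0 : 0 < s := hc.trans_le hs
  rw [kOne_of_im_ne_zero (by simpa using hs0.ne')]
  congr 1
  have h1 : -((I * s) ^ 2 + (c : ℂ) ^ 2) = ((s ^ 2 - c ^ 2 : ℝ) : ℂ) := by
    rw [mul_pow, I_sq]; push_cast; ring
  have h2 : (2⁻¹ : ℂ) = ((2⁻¹ : ℝ) : ℂ) := by push_cast; ring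
  rw [h1, h2, ← Complex.ofReal_cpow (by nlinarith), ← one_div, ← Real.sqrt_eq_rpow]

lemma I_mul_notMem_contour (hc : 0 < c) {s : ℝ} (hs : c < s) : I * s ∉ contour c := by
  have hs0 : 0 < s := hc.trans hs
  rintro (h | h)
  · simp at h; linarith
  · have := h.2
    simp only [mul_im, I_re, I_im, ofReal_re, ofReal_im, zero_mul, one_mul, zero_add] at this
    rw [abs_of_pos hs0] at this
    linarith

end kOne

/-! ### The Wronskian as a function of `k` -/

section wronskian

variable {c : ℝ} {p : ℝ → ℝ}

lemma wronskian_eq (hp : IsSteplikePotential c p) {k : ℂ} (hk : 0 ≤ k.im) :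
    wronskian c p k = jostW c p k (kOne c k) :=
  wronskian_eq_jostW hp hk (kOne_im_nonneg k)

lemma phiOne_eq (hp : IsSteplikePotential c p) (k : ℂ) :
    phiOne c p k = fun x => jost (leftPot c p) (kOne c k) (-x) :=
  phiOne_eq_jost hp.left (kOne_im_nonneg k)

lemma exists_eq_of_wronskian_eq_zero (hc : 0 < c) (hp : IsSteplikePotential c p) {k : ℂ}
    (hk : 0 < k.im) (hkc : k ∉ contour c) (hW : wronskian c p k = 0) :
    ∃ κ : ℝ, c < κ ∧ k = I * κ := by
  rw [wronskian_eq hp hk.le] at hW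
  have hre := re_eq_zero_of_jostW_eq_zero hp hk (kOne_im_pos hc hkc) (kOne_sq k) hW
  refine ⟨k.im, ?_, ?_⟩
  · by_contra h
    exact hkc (Or.inr ⟨hre, by rw [abs_of_pos hk]; linarith⟩)
  · apply Complex.ext <;> simp [hre]

lemma differentiableAt_phiOne (hc : 0 < c) (hp : IsSteplikePotential c p) {k : ℂ}
    (hkc : k ∉ contour c) (x : ℝ) : DifferentiableAt ℂ (fun k => phiOne c p k x) k := by
  have h1 := (differentiableOn_jost_param hp.left (-x)).differentiableAt
    (isOpen_upper.mem_nhds (kOne_im_pos hc hkc))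
  have h2 := h1.comp k (differentiableAt_kOne hc hkc)
  refine h2.congr_of_eventuallyEq (Eventually.of_forall fun k => ?_)
  simp only [phiOne_eq hp]
  rfl

lemma differentiableAt_phi (hp : IsSteplikePotential c p) {k : ℂ} (hk : 0 < k.im) (x : ℝ) :
    DifferentiableAt ℂ (fun k => phi p k x) k := by
  refine ((differentiableOn_jost_param hp.right x).differentiableAt
    (isOpen_upper.mem_nhds hk)).congr_of_eventuallyEq ?_
  filter_upwards [isOpen_upper.mem_nhds hk] with z hz
  rw [phi_eq_jost hp.right (le_of_lt hz)]

lemma differentiableAt_wronskian (hc : 0 < c) (hp : IsSteplikePotential c p) {k : ℂ}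
    (hk : 0 < k.im) (hkc : k ∉ contour c) : DifferentiableAt ℂ (wronskian c p) k := by
  have hl := isOpen_upper.mem_nhds (kOne_im_pos hc hkc)
  have hk' := isOpen_upper.mem_nhds hk
  have h1 := ((differentiableOn_jost_param hp.left 0).differentiableAt hl).comp k
    (differentiableAt_kOne hc hkc)
  have h2 := ((differentiableOn_jostDeriv_param hp.left 0).differentiableAt hl).comp k
    (differentiableAt_kOne hc hkc)
  have h3 := (differentiableOn_jost_param hp.right 0).differentiableAt hk'
  have h4 := (differentiableOn_jostDeriv_param hp.right 0).differentiableAt hk'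
  refine ((h1.mul h4).add (h2.mul h3)).congr_of_eventuallyEq ?_
  filter_upwards [hk'] with z hz
  rw [wronskian_eq hp (le_of_lt hz)]
  rfl

lemma integrableOn_norm_jost_sq {u : ℝ → ℝ} (hu : IsRightPotential u) {k : ℂ} (hk : 0 < k.im) :
    IntegrableOn (fun x => ‖jost u k x‖ ^ 2) (Set.Ioi 0) := by
  refine Integrable.mono' (integrableOn_jost_bound hk (Real.exp (tailMoment u 0 0) ^ 2))
    ((continuous_jost hu hk.le).norm.pow 2).aestronglyMeasurable ?_
  refine (ae_restrict_iff' measurableSet_Ioi).2 (Eventually.of_forall fun x hx => ?_)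
  have := norm_jost_mul_jost_le hu hk hk (le_of_lt hx)
  rw [norm_mul] at this
  rw [norm_pow, norm_norm, pow_two]
  exact this

lemma integrable_norm_jost_sq (hp : IsSteplikePotential c p) {k l : ℂ} (hk : 0 < k.im)
    (hl : 0 < l.im) {b : ℂ} (hb0 : b ≠ 0)
    (hb : ∀ x, jost (leftPot c p) l (-x) = b * jost p k x) :
    Integrable fun x => ‖jost p k x‖ ^ 2 := by
  have h1 := integrableOn_norm_jost_sq hp.right hk
  have h2 := integrableOn_norm_jost_sq hp.left hl
  have h3 : IntegrableOn (fun x => ‖jost p k x‖ ^ 2) (Set.Iic 0) := by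
    rw [← neg_zero, ← integrableOn_Ici_iff_integrableOn_Ioi, neg_zero] at h2
    have h4 : IntegrableOn (fun x => ‖jost (leftPot c p) l (-x)‖ ^ 2) (Set.Iic 0) :=
      IntegrableOn.comp_neg_Iic (c := (0 : ℝ)) (f := fun x => ‖jost (leftPot c p) l x‖ ^ 2)
        (by simpa using h2)
    refine (h4.const_mul ((‖b‖ ^ 2)⁻¹)).congr (Eventually.of_forall fun x => ?_)
    have hb1 : ‖b‖ ≠ 0 := norm_ne_zero_iff.2 hb0
    simp only [hb x, norm_mul]
    field_simp
  rw [← integrableOn_univ, ← Set.Iic_union_Ioi (a := (0 : ℝ))]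
  exact h3.union h1

lemma integral_norm_sq_pos {f : ℝ → ℂ} (hf : Continuous f) (h0 : f ≠ 0)
    (hi : Integrable fun x => ‖f x‖ ^ 2) : 0 < ∫ x, ‖f x‖ ^ 2 := by
  rw [integral_pos_iff_support_of_nonneg (fun x => by positivity) hi]
  refine (hf.norm.pow 2).isOpen_support.measure_pos volume ?_
  obtain ⟨x, hx⟩ := Function.ne_iff.1 h0
  exact ⟨x, by simpa using hx⟩

/-- Zeros of the Wronskian on the imaginary axis are simple. -/
lemma hasDerivAt_wronskian (hc : 0 < c) (hp : IsSteplikePotential c p) {κ : ℝ} (hκ : c < κ)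
    (hW : wronskian c p (I * κ) = 0) :
    ∃ b : ℂ, b ≠ 0 ∧ (∀ x, phiOne c p (I * κ) x = b * phi p (I * κ) x) ∧
      Integrable (fun x => ‖phi p (I * κ) x‖ ^ 2) ∧ 0 < ∫ x, ‖phi p (I * κ) x‖ ^ 2 ∧
      HasDerivAt (wronskian c p)
        (2 * (I * κ) * b * ((∫ x, ‖phi p (I * κ) x‖ ^ 2 : ℝ) : ℂ)) (I * κ) := by
  have hκ0 : 0 < κ := hc.trans hκ
  have hk : 0 < (I * κ : ℂ).im := by simpa using hκ0
  have hkc := I_mul_notMem_contour hc hκ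
  have hl := kOne_im_pos hc hkc
  rw [wronskian_eq hp hk.le] at hW
  obtain ⟨b, hb⟩ := exists_leftJost_eq hp hk.le hl.le (kOne_sq _) hW
  have hb0 := leftJost_coeff_ne_zero hp hl.le hb
  have hphi := phi_eq_jost hp.right hk.le
  have hint := integrable_norm_jost_sq hp hk hl hb0 hb
  rw [hphi]
  refine ⟨b, hb0, fun x => by rw [phiOne_eq hp]; exact hb x, hint,
    integral_norm_sq_pos (continuous_jost hp.right hk.le) (jost_ne_zero hp.right hk.le) hint, ?_⟩
  have hd := hasDerivAt_jostW hp hk hl (hasDerivAt_kOne hc hkc) hb0 hb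
  have hsq : ∀ x, jost p (I * κ) x ^ 2 = ((‖jost p (I * κ) x‖ ^ 2 : ℝ) : ℂ) := by
    intro x
    rw [← Complex.normSq_eq_norm_sq, ← Complex.mul_conj, conj_jost_imaginary, pow_two]
  simp only [hsq] at hd
  have hre : ∀ S : Set ℝ, ∫ x in S, ((‖jost p (I * κ) x‖ ^ 2 : ℝ) : ℂ) =
      ((∫ x in S, ‖jost p (I * κ) x‖ ^ 2 : ℝ) : ℂ) := fun S => integral_ofReal
  rw [hre, hre, ← ofReal_add, add_comm (∫ x in Set.Ioi (0 : ℝ), _),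
    intervalIntegral.integral_Iic_add_Ioi hint.integrableOn hint.integrableOn] at hd
  refine hd.congr_of_eventuallyEq ?_
  filter_upwards [isOpen_upper.mem_nhds hk] with z hz
  exact wronskian_eq hp (le_of_lt hz)

lemma tendsto_sqrt_sq_sub (c : ℝ) :
    Tendsto (fun s : ℝ => Real.sqrt (s ^ 2 - c ^ 2)) atTop atTop := by
  refine Real.tendsto_sqrt_atTop.comp ?_
  exact tendsto_atTop_add_const_right _ _ (tendsto_pow_atTop two_ne_zero)

lemma tendsto_sqrt_sq_sub_sub (c : ℝ) :
    Tendsto (fun s : ℝ => Real.sqrt (s ^ 2 - c ^ 2) - s) atTop (𝓝 0) := by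
  have h : Tendsto (fun s : ℝ => -c ^ 2 / (Real.sqrt (s ^ 2 - c ^ 2) + s)) atTop (𝓝 0) :=
    tendsto_const_nhds.div_atTop ((tendsto_sqrt_sq_sub c).atTop_add_atTop tendsto_id)
  refine h.congr' ?_
  filter_upwards [eventually_gt_atTop |c|] with s hs
  have h0 : 0 ≤ |c| := abs_nonneg c
  have h1 : 0 ≤ s ^ 2 - c ^ 2 := by rw [← sq_abs c]; nlinarith
  have h2 := Real.sqrt_nonneg (s ^ 2 - c ^ 2)
  have h3 := Real.sq_sqrt h1
  rw [div_eq_iff (by linarith)]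
  linear_combination -h3

lemma tendsto_sqrt_sq_sub_div (c : ℝ) :
    Tendsto (fun s : ℝ => Real.sqrt (s ^ 2 - c ^ 2) / s) atTop (𝓝 1) := by
  have h := ((tendsto_sqrt_sq_sub_sub c).div_atTop tendsto_id).add_const 1
  rw [zero_add] at h
  refine h.congr' ?_
  filter_upwards [eventually_gt_atTop 0] with s hs
  simp only [id]
  field_simp
  ring

/-- The transmission coefficient tends to `1` along the imaginary axis. -/
lemma tendsto_transT (hc : 0 < c) (hp : IsSteplikePotential c p) :
    Tendsto (fun s : ℝ => transT c p (I * s)) atTop (𝓝 1) := by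
  have hs1 := tendsto_sqrt_sq_sub c
  have f0 := tendsto_jostAmp_imaginary hp.right 0
  have f1 := tendsto_jostAmpDeriv_imaginary hp.right 0
  have g0 := (tendsto_jostAmp_imaginary hp.left 0).comp hs1
  have g1 := (tendsto_jostAmpDeriv_imaginary hp.left 0).comp hs1
  have r : Tendsto (fun s : ℝ => ((Real.sqrt (s ^ 2 - c ^ 2) / s : ℝ) : ℂ)) atTop (𝓝 ((1 : ℝ) : ℂ)) :=
    (Complex.continuous_ofReal.tendsto _).comp (tendsto_sqrt_sq_sub_div c)
  have h := ((((g0.mul (f0.add (f1.div_const I))).add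
    ((r.mul (g0.add (g1.div_const I))).mul f0)).div_const 2)).inv₀
    (by norm_num)
  have e : ((1 * (1 + 0 / I) + ((1 : ℝ) : ℂ) * (1 + 0 / I) * 1) / 2 : ℂ)⁻¹ = 1 := by norm_num
  rw [e] at h
  refine h.congr' ?_
  filter_upwards [eventually_gt_atTop c] with s hs
  have hs0 : 0 < s := hc.trans hs
  have hr : 0 < Real.sqrt (s ^ 2 - c ^ 2) := Real.sqrt_pos.2 (by nlinarith)
  have hsC : (s : ℂ) ≠ 0 := by exact_mod_cast hs0.ne'
  have hrC : (Real.sqrt (s ^ 2 - c ^ 2) : ℂ) ≠ 0 := by exact_mod_cast hr.ne'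
  rw [transT, wronskian_eq hp (by simpa using hs0.le), kOne_imaginary hc hs.le, jostW]
  simp only [jost, jostDeriv, Function.comp_apply, ofReal_zero, mul_zero, Complex.exp_zero, one_mul,
    ofReal_div]
  set A := jostAmp p (I * s) 0
  set B := jostAmpDeriv p (I * s) 0
  set C := jostAmp (leftPot c p) (I * Real.sqrt (s ^ 2 - c ^ 2)) 0
  set D := jostAmpDeriv (leftPot c p) (I * Real.sqrt (s ^ 2 - c ^ 2)) 0
  set R : ℂ := (Real.sqrt (s ^ 2 - c ^ 2) : ℂ)
  rw [inv_eq_one_div, ← mul_div_mul_left 1 _ (show 2 * I * (I * (s : ℂ)) ≠ 0 by simp [hsC]), mul_one]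
  congr 1
  field_simp

lemma continuousWithinAt_wronskian_imaginary (hc : 0 < c) (hp : IsSteplikePotential c p) {s₀ : ℝ}
    (hs₀ : c ≤ s₀) :
    ContinuousWithinAt (fun s : ℝ => wronskian c p (I * s)) (Set.Ici c) s₀ := by
  have hpos : 0 < s₀ := hc.trans_le hs₀
  have h := tendsto_jostW hp (F := 𝓝[Set.Ici c] s₀) (f := fun s : ℝ => I * s)
    (g := fun s : ℝ => I * Real.sqrt (s ^ 2 - c ^ 2)) (k₀ := I * s₀)
    (l₀ := I * Real.sqrt (s₀ ^ 2 - c ^ 2))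
    ((by fun_prop : Continuous fun s : ℝ => (I * s : ℂ)).continuousWithinAt)
    (by
      filter_upwards [self_mem_nhdsWithin] with s hs
      simpa using hc.le.trans hs) (by simpa using hpos.le)
    ((by fun_prop : Continuous fun s : ℝ =>
      (I * (Real.sqrt (s ^ 2 - c ^ 2) : ℝ) : ℂ)).continuousWithinAt)
    (Eventually.of_forall fun s => by simp [Real.sqrt_nonneg]) (by simp [Real.sqrt_nonneg])
  rw [ContinuousWithinAt, wronskian_eq hp (by simpa using hpos.le), kOne_imaginary hc hs₀]
  refine h.congr' ?_
  filter_upwards [self_mem_nhdsWithin] with s hs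
  rw [wronskian_eq hp (by simpa using hc.le.trans hs), kOne_imaginary hc hs]

/-- The Wronskian has finitely many zeros in the upper half plane. -/
lemma finite_zeros (hc : 0 < c) (hp : IsSteplikePotential c p)
    (hnr : wronskian c p (I * c) ≠ 0) :
    {κ : ℝ | c < κ ∧ wronskian c p (I * κ) = 0}.Finite := by
  by_contra hinf
  obtain ⟨K, hK⟩ := eventually_atTop.1 ((tendsto_transT hc hp).eventually_ne one_ne_zero)
  have hsub : {κ : ℝ | c < κ ∧ wronskian c p (I * κ) = 0} ⊆ Set.Icc c K := by
    rintro κ ⟨h1, h2⟩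
    refine ⟨h1.le, ?_⟩
    by_contra h
    exact hK κ (by linarith) (by rw [transT, h2, div_zero])
  obtain ⟨s, hs, hacc⟩ := Set.Infinite.exists_accPt_of_subset_isCompact hinf isCompact_Icc hsub
  rw [accPt_iff_frequently] at hacc
  have key : ∀ᶠ κ in 𝓝 s, κ ≠ s → c < κ → wronskian c p (I * κ) ≠ 0 := by
    by_cases h0 : wronskian c p (I * s) = 0
    · have hcs : c < s := lt_of_le_of_ne hs.1 (by rintro rfl; exact hnr h0)
      obtain ⟨b, hb0, -, -, hpos, hd⟩ := hasDerivAt_wronskian hc hp hcs h0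
      have hs0 : (s : ℂ) ≠ 0 := by exact_mod_cast (hc.trans hcs).ne'
      have hI : ((∫ x, ‖phi p (I * s) x‖ ^ 2 : ℝ) : ℂ) ≠ 0 := by exact_mod_cast hpos.ne'
      have hev := hd.eventually_ne (c := 0) (by
        refine mul_ne_zero (mul_ne_zero (by simp [hs0]) hb0) hI)
      rw [eventually_nhdsWithin_iff] at hev
      have hcont : Tendsto (fun κ : ℝ => (I * κ : ℂ)) (𝓝 s) (𝓝 (I * s)) :=
        (by fun_prop : Continuous fun κ : ℝ => (I * κ : ℂ)).tendsto s
      filter_upwards [hcont.eventually hev] with κ hκ hne _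
      exact hκ (by simpa using hne)
    · have hev := (continuousWithinAt_wronskian_imaginary hc hp hs.1).eventually_ne h0
      rw [eventually_nhdsWithin_iff] at hev
      filter_upwards [hev] with κ hκ _ hcκ
      exact hκ hcκ.le
  obtain ⟨κ, ⟨hne, hm⟩, hκ⟩ := (hacc.and_eventually key).exists
  exact hκ hne hm.1 hm.2

end wronskian

/-! ### Eigenvalues -/

section eigenvalue

lemma eq_zero_of_memLp_const {a : ℝ} {w : ℂ}
    (h : MemLp (fun _ : ℝ => w) 2 (volume.restrict (Set.Ioi a))) : w = 0 := by
  rcases (memLp_const_iff two_ne_zero ENNReal.ofNat_ne_top).1 h with h | h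
  · exact h
  · simp at h

/-- A square integrable solution is proportional to the Jost solution. -/
lemma exists_eq_jost_of_memLp {u : ℝ → ℝ} (hu : IsRightPotential u) {k : ℂ} (hk : 0 ≤ k.im)
    {ψ : ℝ → ℂ} (hψ : Solves u (k ^ 2) ψ) (h0 : MemLp ψ 2) (h1 : MemLp (deriv ψ) 2) :
    ∃ b : ℂ, ∀ x, ψ x = b * jost u k x := by
  refine (solves_jost hu hk).exists_eq_const_mul hu.continuous hψ (jost_ne_zero hu hk) ?_
  apply eq_zero_of_memLp_const (a := 0)
  obtain ⟨C, hC⟩ := norm_jostDeriv_le hu hk 0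
  have hexp : ∀ x : ℝ, 0 ≤ x → Real.exp (-k.im * x) ≤ 1 := fun x hx =>
    Real.exp_le_one_iff.2 (by nlinarith)
  have hC0 : 0 ≤ C := by
    have := (norm_nonneg _).trans (hC 0 le_rfl)
    simpa using this
  have m1 : MemLp (fun x => ψ x * jostDeriv u k x) 2 (volume.restrict (Set.Ioi 0)) := by
    refine MemLp.of_le_mul (c := C) (h0.restrict _)
      ((h0.restrict _).aestronglyMeasurable.mul
        (continuous_jostDeriv hu hk).aestronglyMeasurable) ?_
    refine (ae_restrict_iff' measurableSet_Ioi).2 (Eventually.of_forall fun x hx => ?_)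
    rw [norm_mul, mul_comm]
    have hx : (0 : ℝ) ≤ x := le_of_lt hx
    gcongr
    exact (hC x hx).trans (mul_le_of_le_one_left hC0 (hexp x hx))
  have m2 : MemLp (fun x => deriv ψ x * jost u k x) 2 (volume.restrict (Set.Ioi 0)) := by
    refine MemLp.of_le_mul (c := Real.exp (tailMoment u 0 0)) (h1.restrict _)
      ((h1.restrict _).aestronglyMeasurable.mul
        (continuous_jost hu hk).aestronglyMeasurable) ?_
    refine (ae_restrict_iff' measurableSet_Ioi).2 (Eventually.of_forall fun x hx => ?_)
    rw [norm_mul, mul_comm]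
    have hx : (0 : ℝ) ≤ x := le_of_lt hx
    gcongr
    exact (norm_jost_le hu hk hx).trans (mul_le_of_le_one_left (Real.exp_pos _).le (hexp x hx))
  refine (m1.sub m2).congr_norm aestronglyMeasurable_const (Eventually.of_forall fun x => ?_)
  rw [hψ.wron_eq (solves_jost hu hk) 0 x, wron, deriv_jost hu hk]
  rfl

lemma not_memLp_jost_real {u : ℝ → ℝ} (hu : IsRightPotential u) {l : ℝ} {b : ℂ}
    (h : MemLp (fun x => b * jost u l x) 2) : b = 0 := by
  have hl : 0 ≤ (l : ℂ).im := by simp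
  have h1 := (tendsto_jostAmp hu hl).norm
  rw [norm_one] at h1
  obtain ⟨X, hX⟩ := eventually_atTop.1 (h1.eventually (lt_mem_nhds (show (1 / 2 : ℝ) < 1 by norm_num)))
  apply eq_zero_of_memLp_const (a := X)
  refine MemLp.of_le_mul (c := 2) (h.restrict _) aestronglyMeasurable_const ?_
  refine (ae_restrict_iff' measurableSet_Ioi).2 (Eventually.of_forall fun x hx => ?_)
  have h2 := hX x (le_of_lt hx)
  rw [norm_mul, jost, norm_mul, norm_exp_I_mul]
  simp only [ofReal_im, neg_zero, zero_mul, Real.exp_zero, one_mul]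
  nlinarith [norm_nonneg b]

lemma memLp_comp_neg {ψ : ℝ → ℂ} (h : MemLp ψ 2) : MemLp (fun x => ψ (-x)) 2 :=
  h.comp_measurePreserving (Measure.measurePreserving_neg volume)

variable {c : ℝ} {p : ℝ → ℝ}

lemma wronskian_eq_zero_of_isEigenvalue (hc : 0 < c) (hp : IsSteplikePotential c p) {lam : ℝ}
    (h : IsEigenvalue p lam) :
    ∃ κ : ℝ, c < κ ∧ wronskian c p (I * κ) = 0 ∧ lam = -κ ^ 2 := by
  obtain ⟨ψ, hψ0, hψ, m0, m1, -⟩ := h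
  have hleft : ∀ l : ℂ, 0 ≤ l.im → l ^ 2 = lam + c ^ 2 →
      ∃ b : ℂ, ∀ x, ψ (-x) = b * jost (leftPot c p) l x := by
    intro l hl hl2
    have hs : Solves (leftPot c p) (l ^ 2) (fun x => ψ (-x)) :=
      (hψ.comp_neg (c ^ 2)).congr rfl (by rw [hl2]; push_cast; ring)
    refine exists_eq_jost_of_memLp hp.left hl hs (memLp_comp_neg m0) ?_
    have hd : deriv (fun x => ψ (-x)) = fun x => -deriv ψ (-x) := by
      ext x
      have := (hψ.hasDerivAt (-x)).scomp x (hasDerivAt_neg x)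
      simpa [Function.comp_def] using this.deriv
    rw [hd]
    exact (memLp_comp_neg m1).neg
  have hlt : lam + c ^ 2 < 0 := by
    by_contra hcon
    push Not at hcon
    obtain ⟨b, hb⟩ := hleft (Real.sqrt (lam + c ^ 2) : ℝ) (by simp) (by
      rw [← ofReal_pow, Real.sq_sqrt hcon]; push_cast; ring)
    have hb0 : b = 0 := by
      apply not_memLp_jost_real hp.left (l := Real.sqrt (lam + c ^ 2))
      rw [← funext hb]
      exact memLp_comp_neg m0
    apply hψ0
    ext x
    have := hb (-x)
    rw [neg_neg, hb0, zero_mul] at this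
    exact this
  have hneg : 0 ≤ -lam := by nlinarith
  have hκ2 := Real.sq_sqrt hneg
  set κ := Real.sqrt (-lam) with hκ
  have hcκ : c < κ := by
    rw [hκ]
    exact Real.lt_sqrt_of_sq_lt (by linarith)
  have hκ0 : 0 < κ := hc.trans hcκ
  have hk : 0 ≤ (I * κ : ℂ).im := by simpa using hκ0.le
  have hk2 : (I * κ : ℂ) ^ 2 = lam := by
    rw [mul_pow, I_sq, ← ofReal_pow, hκ2]; push_cast; ring
  have hl := kOne_im_nonneg (c := c) (I * κ)
  obtain ⟨b, hb⟩ := hleft (kOne c (I * κ)) hl (by rw [kOne_sq, hk2])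
  obtain ⟨a, ha⟩ := exists_eq_jost_of_memLp hp.right hk (hψ.congr rfl hk2.symm) m0 m1
  have ha0 : a ≠ 0 := by
    rintro rfl
    exact hψ0 (funext fun x => by simpa using ha x)
  have hb0 : b ≠ 0 := by
    rintro rfl
    exact hψ0 (funext fun x => by simpa using hb (-x))
  refine ⟨κ, hcκ, ?_, by linarith⟩
  rw [wronskian_eq hp hk, ← wron_leftJost_jost hp hk hl]
  have he : ∀ x, jost (leftPot c p) (kOne c (I * κ)) (-x) = b⁻¹ * a * jost p (I * κ) x := by
    intro x
    have h1 := hb (-x)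
    rw [neg_neg] at h1
    rw [mul_assoc, ← ha x, h1]
    field_simp
  rw [funext he, wron, ((hasDerivAt_jost hp.right hk 0).const_mul _).deriv, deriv_jost hp.right hk]
  ring

lemma isEigenvalue_of_wronskian_eq_zero (hc : 0 < c) (hp : IsSteplikePotential c p)
    (hbd : ∃ M, ∀ x, |p x| ≤ M) {κ : ℝ} (hκ : c < κ) (hW : wronskian c p (I * κ) = 0) :
    IsEigenvalue p (-κ ^ 2) := by
  have hκ0 : 0 < κ := hc.trans hκ
  have hk : 0 < (I * κ : ℂ).im := by simpa using hκ0
  have hl := kOne_im_pos hc (I_mul_notMem_contour hc hκ)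
  rw [wronskian_eq hp hk.le] at hW
  obtain ⟨b, hb⟩ := exists_leftJost_eq hp hk.le hl.le (kOne_sq _) hW
  have hb0 := leftJost_coeff_ne_zero hp hl.le hb
  have hb' := leftJost_deriv_eq hp hk.le hl.le hb
  have hs : Solves p ((-κ ^ 2 : ℝ) : ℂ) (jost p (I * κ)) :=
    (solves_jost hp.right hk.le).congr rfl (by rw [mul_pow, I_sq]; push_cast; ring)
  have hc0 := continuous_jost hp.right hk.le
  have hc1 := continuous_jostDeriv hp.right hk.le
  have m0 : MemLp (jost p (I * κ)) 2 := by
    rw [memLp_two_iff_integrable_sq_norm hc0.aestronglyMeasurable]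
    exact integrable_norm_jost_sq hp hk hl hb0 hb
  have m1 : MemLp (jostDeriv p (I * κ)) 2 := by
    rw [memLp_two_iff_integrable_sq_norm hc1.aestronglyMeasurable, ← integrableOn_univ,
      ← Set.Iic_union_Ioi (a := (0 : ℝ))]
    have hexp : ∀ {a x : ℝ}, 0 < a → 0 ≤ x → Real.exp (-a * x) ^ 2 ≤ Real.exp (-a * x) := by
      intro a x ha hx
      have h1 : Real.exp (-a * x) ≤ 1 := Real.exp_le_one_iff.2 (by nlinarith)
      nlinarith [Real.exp_pos (-a * x)]
    refine IntegrableOn.union ?_ ?_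
    · obtain ⟨C, hC⟩ := norm_jostDeriv_le hp.left hl.le 0
      have hi := (integrableOn_exp_mul_Iic hl 0).mul_const ((‖b‖⁻¹ * C) ^ 2)
      refine Integrable.mono' hi (hc1.norm.pow 2).aestronglyMeasurable ?_
      refine (ae_restrict_iff' measurableSet_Iic).2 (Eventually.of_forall fun x hx => ?_)
      have hx : x ≤ 0 := hx
      have h1 := hC (-x) (by linarith)
      have h2 : ‖jostDeriv p (I * κ) x‖ ≤ Real.exp (-(kOne c (I * κ)).im * -x) * (‖b‖⁻¹ * C) := by
        have h3 := congrArg norm (hb' x)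
        rw [norm_neg, norm_mul] at h3
        have hb1 : 0 < ‖b‖ := norm_pos_iff.2 hb0
        rw [h3] at h1
        rw [← mul_le_mul_iff_right₀ hb1]
        refine h1.trans (le_of_eq ?_)
        field_simp
      rw [norm_pow, norm_norm]
      calc ‖jostDeriv p (I * κ) x‖ ^ 2
          ≤ (Real.exp (-(kOne c (I * κ)).im * -x) * (‖b‖⁻¹ * C)) ^ 2 := by gcongr
        _ = Real.exp (-(kOne c (I * κ)).im * -x) ^ 2 * (‖b‖⁻¹ * C) ^ 2 := by ring
        _ ≤ Real.exp (-(kOne c (I * κ)).im * -x) * (‖b‖⁻¹ * C) ^ 2 := by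
            gcongr; exact hexp hl (by linarith)
        _ = _ := by congr 2; ring
    · obtain ⟨C, hC⟩ := norm_jostDeriv_le hp.right hk.le 0
      refine Integrable.mono' (integrableOn_jost_bound hk (C ^ 2))
        (hc1.norm.pow 2).aestronglyMeasurable ?_
      refine (ae_restrict_iff' measurableSet_Ioi).2 (Eventually.of_forall fun x hx => ?_)
      have hx : (0 : ℝ) < x := hx
      rw [norm_pow, norm_norm]
      calc ‖jostDeriv p (I * κ) x‖ ^ 2 ≤ (Real.exp (-(I * κ : ℂ).im * x) * C) ^ 2 := by
            gcongr; exact hC x hx.le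
        _ = Real.exp (-(I * κ : ℂ).im * x) ^ 2 * C ^ 2 := by ring
        _ ≤ _ := by gcongr; exact hexp hk hx.le
  refine ⟨jost p (I * κ), jost_ne_zero hp.right hk.le, hs, m0, ?_, ?_⟩
  · rwa [deriv_jost hp.right hk.le]
  · obtain ⟨M, hM⟩ := hbd
    have hd : deriv (deriv (jost p (I * κ))) =
        fun x => ((p x : ℂ) - ((-κ ^ 2 : ℝ) : ℂ)) * jost p (I * κ) x :=
      funext fun x => (hs.2 x).deriv
    rw [hd]
    have hpc := hp.right.continuous
    refine MemLp.of_le_mul (c := M + κ ^ 2) m0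
      (by fun_prop : Continuous fun x =>
        ((p x : ℂ) - ((-κ ^ 2 : ℝ) : ℂ)) * jost p (I * κ) x).aestronglyMeasurable
      (Eventually.of_forall fun x => ?_)
    rw [norm_mul]
    gcongr
    refine (norm_sub_le _ _).trans ?_
    rw [norm_real, norm_real, Real.norm_eq_abs, Real.norm_eq_abs, abs_neg, abs_of_nonneg (sq_nonneg κ)]
    linarith [hM x]

/-- The eigenvalues are the squares of the zeros of the Wronskian. -/
lemma isEigenvalue_iff (hc : 0 < c) (hp : IsSteplikePotential c p)
    (hbd : ∃ M, ∀ x, |p x| ≤ M) (lam : ℝ) :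
    IsEigenvalue p lam ↔ ∃ κ : ℝ, (c < κ ∧ wronskian c p (I * κ) = 0) ∧ lam = -κ ^ 2 := by
  constructor
  · intro h
    obtain ⟨κ, h1, h2, h3⟩ := wronskian_eq_zero_of_isEigenvalue hc hp h
    exact ⟨κ, ⟨h1, h2⟩, h3⟩
  · rintro ⟨κ, ⟨h1, h2⟩, rfl⟩
    exact isEigenvalue_of_wronskian_eq_zero hc hp hbd h1 h2

end eigenvalue

/-! ### The Lax pair -/

/-- The coefficient of the diagonal part. -/
def laxDiag : ℂ × ℂ →L[ℝ] ℂ × ℂ :=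
  (ContinuousLinearMap.fst ℝ ℂ ℂ).prod (-ContinuousLinearMap.snd ℝ ℂ ℂ)

/-- `(a, b) ↦ (b, 0)`. -/
def laxUp : ℂ × ℂ →L[ℝ] ℂ × ℂ := (ContinuousLinearMap.snd ℝ ℂ ℂ).prod 0

/-- `(a, b) ↦ (0, a)`. -/
def laxDown : ℂ × ℂ →L[ℝ] ℂ × ℂ :=
  ContinuousLinearMap.prod 0 (ContinuousLinearMap.fst ℝ ℂ ℂ)

/-- The matrix of the `x`-equation of the Lax pair. -/
def laxU (a₀ z : ℂ) : ℂ × ℂ →L[ℝ] ℂ × ℂ := laxUp + (a₀ - z) • laxDown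

/-- The matrix of the `t`-equation of the Lax pair, where `a₀, a₁, a₂` stand for `q, qₓ, qₓₓ`. -/
def laxV (z a₀ a₁ a₂ : ℂ) : ℂ × ℂ →L[ℝ] ℂ × ℂ :=
  (-a₁) • laxDiag + (2 * a₀ + 4 * z) • laxUp +
    (-a₂ + (2 * a₀ + 4 * z) * (a₀ - z)) • laxDown

/-- The derivative of `laxV` in `x`. -/
def laxVDeriv (z a₀ a₁ a₂ a₃ : ℂ) : ℂ × ℂ →L[ℝ] ℂ × ℂ :=
  (-a₂) • laxDiag + (2 * a₁) • laxUp +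
    (-a₃ + (2 * a₁ * (a₀ - z) + (2 * a₀ + 4 * z) * a₁)) • laxDown

lemma laxU_apply (a₀ z : ℂ) (y : ℂ × ℂ) : laxU a₀ z y = (y.2, (a₀ - z) * y.1) := by
  simp [laxU, laxUp, laxDown]

lemma laxV_apply (z a₀ a₁ a₂ : ℂ) (y : ℂ × ℂ) :
    laxV z a₀ a₁ a₂ y = (-a₁ * y.1 + (2 * a₀ + 4 * z) * y.2,
      (-a₂ + (2 * a₀ + 4 * z) * (a₀ - z)) * y.1 + a₁ * y.2) := by
  simp [laxV, laxUp, laxDown, laxDiag]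
  ring

lemma laxVDeriv_apply (z a₀ a₁ a₂ a₃ : ℂ) (y : ℂ × ℂ) :
    laxVDeriv z a₀ a₁ a₂ a₃ y = (-a₂ * y.1 + 2 * a₁ * y.2,
      (-a₃ + (2 * a₁ * (a₀ - z) + (2 * a₀ + 4 * z) * a₁)) * y.1 + a₂ * y.2) := by
  simp [laxVDeriv, laxUp, laxDown, laxDiag]
  ring

lemma laxV_smul (z a₀ a₁ a₂ b : ℂ) (y : ℂ × ℂ) :
    laxV z a₀ a₁ a₂ (b • y) = b • laxV z a₀ a₁ a₂ y := by
  simp only [laxV_apply, Prod.smul_mk, Prod.smul_fst, Prod.smul_snd, smul_eq_mul, Prod.mk.injEq]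
  constructor <;> ring

/-- The zero curvature condition. -/
lemma lax_compatibility (z a₀ a₁ a₂ a₃ : ℂ) (y : ℂ × ℂ) :
    (6 * a₀ * a₁ - a₃) • laxDown y + laxU a₀ z (laxV z a₀ a₁ a₂ y) =
      laxVDeriv z a₀ a₁ a₂ a₃ y + laxV z a₀ a₁ a₂ (laxU a₀ z y) := by
  simp only [laxU_apply, laxV_apply, laxVDeriv_apply]
  simp [laxDown]
  constructor <;> ring

lemma laxV_eigenvector (z a₀ ν : ℂ) (h : ν ^ 2 = a₀ - z) :
    laxV z a₀ 0 0 (1, ν) = ((2 * a₀ + 4 * z) * ν) • ((1 : ℂ), ν) := by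
  rw [laxV_apply]
  simp only [Prod.smul_mk, smul_eq_mul, Prod.mk.injEq]
  constructor
  · ring
  · linear_combination (-(2 * a₀ + 4 * z)) * h

lemma continuous_laxV {α : Type*} [TopologicalSpace α] (z : ℂ) {a₀ a₁ a₂ : α → ℂ}
    (h0 : Continuous a₀) (h1 : Continuous a₁) (h2 : Continuous a₂) :
    Continuous fun s => laxV z (a₀ s) (a₁ s) (a₂ s) := by
  unfold laxV
  fun_prop

lemma continuous_laxVDeriv {α : Type*} [TopologicalSpace α] (z : ℂ) {a₀ a₁ a₂ a₃ : α → ℂ}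
    (h0 : Continuous a₀) (h1 : Continuous a₁) (h2 : Continuous a₂) (h3 : Continuous a₃) :
    Continuous fun s => laxVDeriv z (a₀ s) (a₁ s) (a₂ s) (a₃ s) := by
  unfold laxVDeriv
  fun_prop

lemma hasDerivAt_laxV (z : ℂ) {a₀ a₁ a₂ : ℝ → ℂ} {a₃ : ℂ} {x : ℝ}
    (h0 : HasDerivAt a₀ (a₁ x) x) (h1 : HasDerivAt a₁ (a₂ x) x) (h2 : HasDerivAt a₂ a₃ x) :
    HasDerivAt (fun x => laxV z (a₀ x) (a₁ x) (a₂ x))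
      (laxVDeriv z (a₀ x) (a₁ x) (a₂ x) a₃) x := by
  have hB := (h0.const_mul 2).add_const (4 * z)
  exact ((h1.neg.smul_const laxDiag).add (hB.smul_const laxUp)).add
    ((h2.neg.add (hB.mul (h0.sub_const z))).smul_const laxDown)

section compatibility

/-- If the coefficients satisfy the zero curvature condition, solutions of the `t`-equation whose
initial values satisfy the `x`-equation satisfy it for all times. -/
lemma hasDerivAt_of_zeroCurvature {E : Type*} [NormedAddCommGroup E] [NormedSpace ℝ E]
    {A A' U U' : ℝ → ℝ → E →L[ℝ] E} {Θ : ℝ → ℝ → E}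
    (hA : Continuous fun s : ℝ × ℝ => A s.1 s.2) (hA' : Continuous fun s : ℝ × ℝ => A' s.1 s.2)
    (hAd : ∀ x t, HasDerivAt (fun x => A x t) (A' x t) x)
    (hUd : ∀ x t, HasDerivAt (fun t => U x t) (U' x t) t)
    (hcurv : ∀ x t y, U' x t y + U x t (A x t y) = A' x t y + A x t (U x t y))
    (hΘ : ∀ x t, HasDerivAt (Θ x) (A x t (Θ x t)) t)
    (h0 : ∀ x, HasDerivAt (fun x => Θ x 0) (U x 0 (Θ x 0)) x) (x t : ℝ) :
    HasDerivAt (fun x => Θ x t) (U x t (Θ x t)) x := by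
  set T := |t| with hT
  have hΘc : ∀ x, Continuous (Θ x) := fun x =>
    continuous_iff_continuousAt.2 fun t => (hΘ x t).continuousAt
  have hUc : Continuous fun t => U x t :=
    continuous_iff_continuousAt.2 fun t => (hUd x t).continuousAt
  have hGc : Continuous fun s => U x s (Θ x s) := hUc.clm_apply (hΘc x)
  have hAc : Continuous fun s => A x s := hA.comp (by fun_prop : Continuous fun s : ℝ => (x, s))
  have hcomp : IsCompact (Set.Icc (-T) T) := isCompact_Icc
  obtain ⟨K, hK⟩ := hcomp.exists_bound_of_continuousOn hAc.continuousOn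
  obtain ⟨C1, hC1⟩ := hcomp.exists_bound_of_continuousOn (hΘc x).continuousOn
  obtain ⟨C2, hC2⟩ := hcomp.exists_bound_of_continuousOn hGc.continuousOn
  have hT0 : (0 : ℝ) ∈ Set.Icc (-T) T := by
    constructor <;> linarith [abs_nonneg t]
  have hK0 : 0 ≤ K := (norm_nonneg _).trans (hK 0 hT0)
  have hC10 : 0 ≤ C1 := (norm_nonneg _).trans (hC1 0 hT0)
  have hC20 : 0 ≤ C2 := (norm_nonneg _).trans (hC2 0 hT0)
  set M := Real.exp ((K + 1) * T) + (C1 + C2) / (K + 1) * (Real.exp ((K + 1) * T) - 1) with hM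
  have hexp : 1 ≤ Real.exp ((K + 1) * T) := Real.one_le_exp (by positivity)
  have hMpos : 0 < M := by
    have : 0 ≤ (C1 + C2) / (K + 1) * (Real.exp ((K + 1) * T) - 1) :=
      mul_nonneg (by positivity) (by linarith)
    linarith
  rw [hasDerivAt_iff_isLittleO_nhds_zero, Asymptotics.isLittleO_iff]
  intro ε₀ hε₀
  set ε := min (ε₀ / M) 1 with hε
  have hεpos : 0 < ε := lt_min (by positivity) one_pos
  have hx0 := hasDerivAt_iff_isLittleO_nhds_zero.1 (h0 x)
  rw [Asymptotics.isLittleO_iff] at hx0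
  have ev1 := hcomp.eventually_forall_of_forall_eventually (x₀ := x)
    (P := fun y s => ‖A' y s - A' x s‖ < ε) (fun s _ => by
      have hc : Continuous fun z : ℝ × ℝ => ‖A' z.1 z.2 - A' x z.2‖ :=
        (hA'.sub (hA'.comp (by fun_prop : Continuous fun z : ℝ × ℝ => (x, z.2)))).norm
      exact hc.continuousAt.eventually_lt_const (by simpa using hεpos))
  have ev2 := hcomp.eventually_forall_of_forall_eventually (x₀ := x)
    (P := fun y s => ‖A y s - A x s‖ < ε) (fun s _ => by
      have hc : Continuous fun z : ℝ × ℝ => ‖A z.1 z.2 - A x z.2‖ :=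
        (hA.sub (hA.comp (by fun_prop : Continuous fun z : ℝ × ℝ => (x, z.2)))).norm
      exact hc.continuousAt.eventually_lt_const (by simpa using hεpos))
  obtain ⟨δ, hδ, hball⟩ := Metric.eventually_nhds_iff_ball.1 (ev1.and ev2)
  filter_upwards [hx0 hεpos, Metric.ball_mem_nhds (0 : ℝ) hδ] with h hh hhδ
  have hmem : x + h ∈ Metric.ball x δ := by
    rw [Metric.mem_ball, dist_zero_right] at hhδ
    rw [Metric.mem_ball, dist_eq_norm, add_sub_cancel_left]
    exact hhδ
  have hdiff : ∀ s ∈ Set.Icc (-T) T, ‖A (x + h) s - A x s - h • A' x s‖ ≤ ε * ‖h‖ := by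
    intro s hs
    have := (convex_ball x δ).norm_image_sub_le_of_norm_hasDerivWithin_le
      (f := fun y => A y s - y • A' x s) (f' := fun y => A' y s - A' x s) (C := ε)
      (fun y hy => by
        have := (hAd y s).sub ((hasDerivAt_id y).smul_const (A' x s))
        rw [one_smul] at this
        exact this.hasDerivWithinAt)
      (fun y hy => ((hball y hy).1 s hs).le) (Metric.mem_ball_self hδ) hmem
    rw [add_sub_cancel_left] at this
    refine le_trans (le_of_eq ?_) this
    congr 1
    rw [add_smul]
    abel
  have hA1 : ∀ s ∈ Set.Icc (-T) T, ‖A (x + h) s - A x s‖ ≤ ε := fun s hs =>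
    ((hball _ hmem).2 s hs).le
  set e : ℝ → E := fun s => Θ (x + h) s - Θ x s - h • U x s (Θ x s) with he
  have hG : ∀ s, HasDerivAt (fun s => U x s (Θ x s))
      (A' x s (Θ x s) + A x s (U x s (Θ x s))) s := by
    intro s
    rw [← hcurv]
    exact (hUd x s).clm_apply (hΘ x s)
  have hed : ∀ s, |s| ≤ T → HasDerivAt e (A (x + h) s (Θ (x + h) s) - A x s (Θ x s) -
      h • (A' x s (Θ x s) + A x s (U x s (Θ x s)))) s := fun s _ =>
    ((hΘ (x + h) s).sub (hΘ x s)).sub ((hG s).const_smul h)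
  have hebd : ∀ s, |s| ≤ T → ‖A (x + h) s (Θ (x + h) s) - A x s (Θ x s) -
      h • (A' x s (Θ x s) + A x s (U x s (Θ x s)))‖ ≤
      (K + 1) * ‖e s‖ + (C1 + C2) * (ε * ‖h‖) := by
    intro s hs
    have hs' := abs_le.1 hs
    have hdec : A (x + h) s (Θ (x + h) s) - A x s (Θ x s) -
        h • (A' x s (Θ x s) + A x s (U x s (Θ x s))) =
        A (x + h) s (e s) + (A (x + h) s - A x s - h • A' x s) (Θ x s) +
          h • (A (x + h) s - A x s) (U x s (Θ x s)) := by
      simp only [he, map_sub, map_smul, sub_apply,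
        smul_apply, smul_sub, smul_add]
      abel
    rw [hdec]
    have n1 : ‖A (x + h) s‖ ≤ K + 1 := by
      have h1 := norm_sub_norm_le (A (x + h) s) (A x s)
      have h2 := hA1 s hs'
      have h3 := hK s hs'
      have h4 : ε ≤ 1 := min_le_right _ _
      linarith
    have n2 : ‖A (x + h) s (e s)‖ ≤ (K + 1) * ‖e s‖ :=
      (ContinuousLinearMap.le_opNorm _ _).trans (by gcongr)
    have n3 : ‖(A (x + h) s - A x s - h • A' x s) (Θ x s)‖ ≤ ε * ‖h‖ * C1 :=
      (ContinuousLinearMap.le_opNorm _ _).trans (by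
        gcongr
        · exact hdiff s hs'
        · exact hC1 s hs')
    have n4 : ‖h • (A (x + h) s - A x s) (U x s (Θ x s))‖ ≤ ‖h‖ * (ε * C2) := by
      rw [norm_smul]
      gcongr
      exact (ContinuousLinearMap.le_opNorm _ _).trans (by
        gcongr
        · exact hA1 s hs'
        · exact hC2 s hs')
    refine (norm_add₃_le).trans ?_
    linarith
  have hgr := norm_le_gronwallBound_abs hed hebd (le_of_eq hT.symm)
  have hK1 : K + 1 ≠ 0 := by positivity
  rw [gronwallBound_of_K_ne_0 hK1] at hgr
  refine hgr.trans ?_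
  have he0 : ‖e 0‖ ≤ ε * ‖h‖ := hh
  calc ‖e 0‖ * Real.exp ((K + 1) * |t|) +
        (C1 + C2) * (ε * ‖h‖) / (K + 1) * (Real.exp ((K + 1) * |t|) - 1)
      ≤ ε * ‖h‖ * Real.exp ((K + 1) * T) +
        (C1 + C2) * (ε * ‖h‖) / (K + 1) * (Real.exp ((K + 1) * T) - 1) := by
        rw [← hT]; gcongr
    _ = ε * M * ‖h‖ := by rw [hM]; ring
    _ ≤ ε₀ * ‖h‖ := by
        gcongr
        calc ε * M ≤ ε₀ / M * M := by gcongr; exact min_le_left _ _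
          _ = ε₀ := by field_simp

end compatibility

/-- Solutions of a family of linear equations converge if the coefficients converge boundedly. -/
lemma tendsto_linearODE {E : Type*} [NormedAddCommGroup E] [NormedSpace ℝ E] [CompleteSpace E]
    {ι : Type*} {F : Filter ι} [F.IsCountablyGenerated] {A : ι → ℝ → E →L[ℝ] E}
    {A₀ : E →L[ℝ] E} {Y : ι → ℝ → E} {Y₀ : ℝ → E} {T K : ℝ}
    (hA : ∀ i, Continuous (A i)) (hK : ∀ i t, |t| ≤ T → ‖A i t‖ ≤ K)
    (hlim : ∀ t, |t| ≤ T → Tendsto (fun i => A i t) F (𝓝 A₀))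
    (hY : ∀ i t, HasDerivAt (Y i) (A i t (Y i t)) t)
    (hY₀ : ∀ t, HasDerivAt Y₀ (A₀ (Y₀ t)) t)
    (h0 : Tendsto (fun i => Y i 0) F (𝓝 (Y₀ 0))) {t : ℝ} (ht : |t| ≤ T) :
    Tendsto (fun i => Y i t) F (𝓝 (Y₀ t)) := by
  have hT : 0 ≤ T := (abs_nonneg t).trans ht
  have hY₀c : Continuous Y₀ := continuous_iff_continuousAt.2 fun t => (hY₀ t).continuousAt
  set η : ι → ℝ := fun i => ∫ s in Set.Icc (-T) T, ‖(A i s - A₀) (Y₀ s)‖ with hη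
  set J : ι → ℝ → E := fun i t => ∫ s in (0 : ℝ)..t, (A i s - A₀) (Y₀ s) with hJ
  have hgc : ∀ i, Continuous fun s => (A i s - A₀) (Y₀ s) := fun i =>
    ((hA i).sub continuous_const).clm_apply hY₀c
  obtain ⟨C, hC⟩ := (isCompact_Icc (a := -T) (b := T)).exists_bound_of_continuousOn
    hY₀c.continuousOn
  have hη0 : Tendsto η F (𝓝 0) := by
    rw [← integral_zero ℝ ℝ (μ := volume.restrict (Set.Icc (-T) T))]
    refine tendsto_integral_filter_of_dominated_convergence (fun _ => (K + ‖A₀‖) * C) ?_ ?_ ?_ ?_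
    · exact Eventually.of_forall fun i => (hgc i).norm.aestronglyMeasurable
    · refine Eventually.of_forall fun i => ?_
      refine (ae_restrict_iff' measurableSet_Icc).2 (Eventually.of_forall fun s hs => ?_)
      rw [norm_norm]
      refine (ContinuousLinearMap.le_opNorm _ _).trans ?_
      have h1 := hK i s (abs_le.2 hs)
      have h2 := hC s hs
      have h3 : 0 ≤ K := (norm_nonneg _).trans h1
      gcongr
      exact (norm_sub_le _ _).trans (by gcongr)
    · exact integrable_const _
    · refine (ae_restrict_iff' measurableSet_Icc).2 (Eventually.of_forall fun s hs => ?_)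
      have h1 := (hlim s (abs_le.2 hs)).sub_const A₀
      rw [sub_self] at h1
      have h2 := (((ContinuousLinearMap.apply ℝ E (Y₀ s)).continuous.tendsto _).comp h1).norm
      simpa [Function.comp_def] using h2
  have hJη : ∀ i s, |s| ≤ T → ‖J i s‖ ≤ η i := by
    intro i s hs
    refine (intervalIntegral.norm_integral_le_integral_norm_uIoc).trans ?_
    refine setIntegral_mono_set ((hgc i).norm.continuousOn.integrableOn_compact isCompact_Icc)
      (Eventually.of_forall fun s => norm_nonneg _) (LE.le.eventuallyLE ?_)
    intro r hr
    have h1 : r ∈ Set.uIcc 0 s := Set.uIoc_subset_uIcc hr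
    have h2 := Set.abs_sub_left_of_mem_uIcc h1
    simp only [sub_zero] at h2
    exact abs_le.1 (h2.trans hs)
  have hJd : ∀ i s, HasDerivAt (J i) ((A i s - A₀) (Y₀ s)) s := fun i s =>
    intervalIntegral.integral_hasDerivAt_right ((hgc i).intervalIntegrable _ _)
      ((hgc i).stronglyMeasurableAtFilter _ _) (hgc i).continuousAt
  set K' := |K| + 1 with hK'
  have hK'0 : 0 < K' := by positivity
  have hgr : ∀ i, ‖Y i t - Y₀ t - J i t‖ ≤ ‖Y i 0 - Y₀ 0‖ * Real.exp (K' * |t|) +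
      η i * (Real.exp (K' * |t|) - 1) := by
    intro i
    have h := norm_le_gronwallBound_abs (f := fun s => Y i s - Y₀ s - J i s)
      (f' := fun s => A i s (Y i s - Y₀ s)) (K := K') (ε := K' * η i) (T := T)
      (fun s _ => by
        refine (((hY i s).sub (hY₀ s)).sub (hJd i s)).congr_deriv ?_
        simp only [map_sub, sub_apply]
        abel)
      (fun s hs => by
        refine (ContinuousLinearMap.le_opNorm _ _).trans ?_
        have h1 : ‖A i s‖ ≤ K' := (hK i s hs).trans (by linarith [le_abs_self K])
        have h2 : ‖Y i s - Y₀ s‖ ≤ ‖Y i s - Y₀ s - J i s‖ + η i := by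
          calc ‖Y i s - Y₀ s‖ = ‖(Y i s - Y₀ s - J i s) + J i s‖ := by rw [sub_add_cancel]
            _ ≤ _ := (norm_add_le _ _).trans (by gcongr; exact hJη i s hs)
        rw [← mul_add]
        gcongr) ht
    rw [gronwallBound_of_K_ne_0 hK'0.ne'] at h
    simp only [hJ, intervalIntegral.integral_same, sub_zero] at h
    rwa [mul_div_cancel_left₀ _ hK'0.ne'] at h
  have hF : Tendsto (fun i => Y i t - Y₀ t - J i t) F (𝓝 0) := by
    refine squeeze_zero_norm hgr ?_
    have h1 := (h0.sub_const (Y₀ 0)).norm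
    rw [sub_self, norm_zero] at h1
    simpa using (h1.mul_const (Real.exp (K' * |t|))).add
      (hη0.mul_const (Real.exp (K' * |t|) - 1))
  have hJ0 : Tendsto (fun i => J i t) F (𝓝 0) :=
    squeeze_zero_norm (fun i => hJη i t ht) hη0
  have := (hF.add hJ0).add_const (Y₀ t)
  rw [add_zero, zero_add] at this
  refine this.congr fun i => ?_
  abel

/-! ### Time evolution of the Jost solutions -/

/-- The `n`-th derivative of `q` in `x`. -/
def xDeriv (q : ℝ → ℝ → ℝ) (n : ℕ) (x t : ℝ) : ℝ := iteratedDeriv n (fun y => q y t) x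

section evolution

variable {c : ℝ} {q : ℝ → ℝ → ℝ}

lemma xDeriv_zero (q : ℝ → ℝ → ℝ) (x t : ℝ) : xDeriv q 0 x t = q x t := by
  simp [xDeriv]

lemma hasDerivAt_xDeriv (hq : IsKdVSolution c q) {n : ℕ} (hn : n < 3) (x t : ℝ) :
    HasDerivAt (fun x => xDeriv q n x t) (xDeriv q (n + 1) x t) x := by
  have h := (hq.contDiff t).differentiable_iteratedDeriv n (by exact_mod_cast hn) x
  have h2 := h.hasDerivAt
  rw [← iteratedDeriv_succ] at h2
  exact h2

lemma continuous_xDeriv (hq : IsKdVSolution c q) {n : ℕ} (hn : n ≤ 3) :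
    Continuous fun s : ℝ × ℝ => xDeriv q n s.1 s.2 := hq.continuous n hn

lemma continuous_xDeriv_left (hq : IsKdVSolution c q) {n : ℕ} (hn : n ≤ 3) (t : ℝ) :
    Continuous fun x => xDeriv q n x t :=
  (continuous_xDeriv hq hn).comp (by fun_prop : Continuous fun x : ℝ => (x, t))

lemma continuous_potential (hq : IsKdVSolution c q) (t : ℝ) : Continuous fun x => q x t := by
  simpa only [xDeriv_zero] using continuous_xDeriv_left hq (n := 0) (by norm_num) t

lemma integrable_xDeriv (hq : IsKdVSolution c q) {n : ℕ} (h1 : 1 ≤ n) (h3 : n ≤ 3) (t : ℝ) :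
    Integrable fun x => xDeriv q n x t := by
  obtain ⟨M, hM⟩ := hq.deriv_integrable |t|
  have h := hM t le_rfl n h1 h3
  have hc := continuous_xDeriv_left hq h3 t
  rw [← integrable_norm_iff hc.aestronglyMeasurable]
  exact (lintegral_ofReal_ne_top_iff_integrable hc.norm.aestronglyMeasurable
    (Eventually.of_forall fun x => norm_nonneg _)).1 (ne_top_of_le_ne_top ENNReal.ofReal_ne_top h)

lemma integral_abs_xDeriv_le (hq : IsKdVSolution c q) (τ : ℝ) :
    ∃ M : ℝ, 0 ≤ M ∧ ∀ t, |t| ≤ τ → ∀ n : ℕ, 1 ≤ n → n ≤ 3 → ∫ x, |xDeriv q n x t| ≤ M := by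
  obtain ⟨M, hM⟩ := hq.deriv_integrable τ
  refine ⟨max M 0, le_max_right _ _, fun t ht n h1 h3 => ?_⟩
  rw [integral_eq_lintegral_of_nonneg_ae (Eventually.of_forall fun x => abs_nonneg _)
    (continuous_xDeriv_left hq h3 t).abs.aestronglyMeasurable]
  exact ENNReal.toReal_le_of_le_ofReal (le_max_right _ _)
    ((hM t ht n h1 h3).trans (ENNReal.ofReal_le_ofReal (le_max_left _ _)))

/-- A solution in the steplike class is a steplike potential at all times. -/
lemma isSteplikePotential (hq : IsKdVSolution c q) (t : ℝ) :
    IsSteplikePotential c (fun x => q x t) := by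
  have hc := continuous_potential hq t
  obtain ⟨M, hM⟩ := hq.moment |t|
  have h := hM t le_rfl
  have hc1 : Continuous fun x => |x| * (|q x t| + |q (-x) t + c ^ 2|) := by fun_prop
  have hi : IntegrableOn (fun x => |x| * (|q x t| + |q (-x) t + c ^ 2|)) (Set.Ioi 0) :=
    (lintegral_ofReal_ne_top_iff_integrable hc1.aestronglyMeasurable
      (Eventually.of_forall fun x => by positivity)).1
      (ne_top_of_le_ne_top ENNReal.ofReal_ne_top h)
  have key : ∀ u : ℝ → ℝ, Continuous u →
      (∀ x, |u x| ≤ |q x t| + |q (-x) t + c ^ 2|) → IsRightPotential u := by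
    intro u hu hle
    refine ⟨hu, Integrable.mono' hi (by fun_prop : Continuous fun x =>
      x * |u x|).aestronglyMeasurable (Eventually.of_forall fun x => ?_)⟩
    rw [norm_mul, Real.norm_eq_abs, Real.norm_eq_abs, abs_abs]
    gcongr
    exact hle x
  refine ⟨key _ hc fun x => by linarith [abs_nonneg (q (-x) t + c ^ 2)],
    key _ (by unfold leftPot; fun_prop) fun x => ?_⟩
  simp only [leftPot]
  linarith [abs_nonneg (q x t)]

lemma tendsto_xDeriv_atTop (hq : IsKdVSolution c q) {n : ℕ} (h1 : 1 ≤ n) (h3 : n < 3) (t : ℝ) :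
    Tendsto (fun x => xDeriv q n x t) atTop (𝓝 0) :=
  tendsto_zero_of_hasDerivAt_of_integrableOn_Ioi (a := 0)
    (fun x _ => hasDerivAt_xDeriv hq h3 x t)
    (integrable_xDeriv hq (by omega) (by omega) t).integrableOn
    (integrable_xDeriv hq h1 h3.le t).integrableOn

lemma tendsto_xDeriv_atBot (hq : IsKdVSolution c q) {n : ℕ} (h1 : 1 ≤ n) (h3 : n < 3) (t : ℝ) :
    Tendsto (fun x => xDeriv q n x t) atBot (𝓝 0) :=
  tendsto_zero_of_hasDerivAt_of_integrableOn_Iic (a := 0)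
    (fun x _ => hasDerivAt_xDeriv hq h3 x t)
    (integrable_xDeriv hq (by omega) (by omega) t).integrableOn
    (integrable_xDeriv hq h1 h3.le t).integrableOn

lemma hasDerivAt_potential (hq : IsKdVSolution c q) (x t : ℝ) :
    HasDerivAt (fun x => q x t) (xDeriv q 1 x t) x := by
  simpa only [xDeriv_zero] using hasDerivAt_xDeriv hq (n := 0) (by norm_num) x t

lemma IsRightPotential.integrableOn {u : ℝ → ℝ} (hu : IsRightPotential u) (a : ℝ) :
    IntegrableOn u (Set.Ioi a) :=
  (integrable_norm_iff hu.continuous.aestronglyMeasurable).1 (hu.integrableOn_abs a)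

lemma tendsto_potential_atTop (hq : IsKdVSolution c q) (t : ℝ) :
    Tendsto (fun x => q x t) atTop (𝓝 0) :=
  tendsto_zero_of_hasDerivAt_of_integrableOn_Ioi (a := 0)
    (fun x _ => hasDerivAt_potential hq x t)
    (integrable_xDeriv hq (n := 1) le_rfl (by norm_num) t).integrableOn
    ((isSteplikePotential hq t).right.integrableOn 0)

lemma tendsto_potential_atBot (hq : IsKdVSolution c q) (t : ℝ) :
    Tendsto (fun x => q x t) atBot (𝓝 (-c ^ 2)) := by
  have h1 : Tendsto (leftPot c fun x => q x t) atTop (𝓝 0) :=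
    tendsto_zero_of_hasDerivAt_of_integrableOn_Ioi (a := 0) (f' := fun x => -xDeriv q 1 (-x) t)
      (fun x _ => by
        have h := ((hasDerivAt_potential hq (-x) t).scomp x (hasDerivAt_neg x)).add_const (c ^ 2)
        rw [neg_one_smul] at h
        exact h)
      ((integrable_xDeriv hq (n := 1) le_rfl (by norm_num) t).comp_neg.neg.integrableOn)
      ((isSteplikePotential hq t).left.integrableOn 0)
  have h2 := (h1.comp tendsto_neg_atBot_atTop).sub_const (c ^ 2)
  rw [zero_sub] at h2
  refine h2.congr fun x => ?_
  simp [leftPot]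

lemma abs_le_integral_abs_deriv {f f' : ℝ → ℝ} (hf : ∀ x, HasDerivAt f (f' x) x)
    (hi : Integrable f') (hl : Tendsto f atTop (𝓝 0)) (x : ℝ) : |f x| ≤ ∫ y, |f' y| := by
  have h := integral_Ioi_of_hasDerivAt_of_tendsto' (a := x) (fun y _ => hf y) hi.integrableOn hl
  have h1 : |f x| = ‖∫ y in Set.Ioi x, f' y‖ := by
    rw [h, zero_sub, norm_neg, Real.norm_eq_abs]
  rw [h1]
  refine (norm_integral_le_integral_norm _).trans ?_
  exact setIntegral_le_integral hi.norm (Eventually.of_forall fun y => norm_nonneg _)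

lemma abs_xDeriv_le (hq : IsKdVSolution c q) (τ : ℝ) :
    ∃ M : ℝ, 0 ≤ M ∧ ∀ t, |t| ≤ τ → ∀ n : ℕ, n < 3 → ∀ x, |xDeriv q n x t| ≤ M := by
  obtain ⟨M, hM0, hM⟩ := integral_abs_xDeriv_le hq τ
  refine ⟨M, hM0, fun t ht n hn x => ?_⟩
  refine (abs_le_integral_abs_deriv (fun x => hasDerivAt_xDeriv hq hn x t)
    (integrable_xDeriv hq (by omega) (by omega) t) ?_ x).trans (hM t ht (n + 1) (by omega) (by omega))
  rcases Nat.eq_zero_or_pos n with rfl | hpos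
  · simpa only [xDeriv_zero] using tendsto_potential_atTop hq t
  · exact tendsto_xDeriv_atTop hq hpos hn t

/-- The matrix of the `t`-equation of the Lax pair for the solution `q`. -/
def laxA (q : ℝ → ℝ → ℝ) (z : ℂ) (x t : ℝ) : ℂ × ℂ →L[ℝ] ℂ × ℂ :=
  laxV z (xDeriv q 0 x t) (xDeriv q 1 x t) (xDeriv q 2 x t)

lemma continuous_laxA (hq : IsKdVSolution c q) (z : ℂ) :
    Continuous fun s : ℝ × ℝ => laxA q z s.1 s.2 :=
  continuous_laxV z
    (Complex.continuous_ofReal.comp (continuous_xDeriv hq (n := 0) (by norm_num)))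
    (Complex.continuous_ofReal.comp (continuous_xDeriv hq (n := 1) (by norm_num)))
    (Complex.continuous_ofReal.comp (continuous_xDeriv hq (n := 2) (by norm_num)))

lemma norm_laxA_le (hq : IsKdVSolution c q) (z : ℂ) (τ : ℝ) :
    ∃ K : ℝ, ∀ x t, |t| ≤ τ → ‖laxA q z x t‖ ≤ K := by
  obtain ⟨M, hM0, hM⟩ := abs_xDeriv_le hq τ
  have hc : Continuous fun s : ℂ × ℂ × ℂ => laxV z s.1 s.2.1 s.2.2 :=
    continuous_laxV z (by fun_prop) (by fun_prop) (by fun_prop)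
  obtain ⟨K, hK⟩ := (isCompact_closedBall (0 : ℂ × ℂ × ℂ) M).exists_bound_of_continuousOn
    hc.continuousOn
  refine ⟨K, fun x t ht => hK (xDeriv q 0 x t, xDeriv q 1 x t, xDeriv q 2 x t) ?_⟩
  rw [mem_closedBall_zero_iff, Prod.norm_def, Prod.norm_def]
  simp only [norm_real, Real.norm_eq_abs]
  exact max_le (hM t ht 0 (by norm_num) x)
    (max_le (hM t ht 1 (by norm_num) x) (hM t ht 2 (by norm_num) x))

lemma tendsto_laxA (z : ℂ) {F : Filter ℝ} {a s : ℝ} (h0 : Tendsto (fun x => q x s) F (𝓝 a))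
    (h1 : Tendsto (fun x => xDeriv q 1 x s) F (𝓝 0))
    (h2 : Tendsto (fun x => xDeriv q 2 x s) F (𝓝 0)) :
    Tendsto (fun x => laxA q z x s) F (𝓝 (laxV z a 0 0)) := by
  have hcont : Continuous fun s : ℝ × ℝ × ℝ => laxV z s.1 s.2.1 s.2.2 :=
    continuous_laxV z (by fun_prop) (by fun_prop) (by fun_prop)
  have h := Tendsto.comp (g := fun s : ℝ × ℝ × ℝ => laxV z s.1 s.2.1 s.2.2)
    (hcont.tendsto (a, 0, 0)) (h0.prodMk_nhds (h1.prodMk_nhds h2))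
  simp only [ofReal_zero] at h
  refine h.congr fun x => ?_
  rw [laxA, xDeriv_zero]
  rfl

/-- Joint solutions of the Lax pair with given initial value, and their asymptotics. -/
lemma exists_lax_solution (hq : IsKdVSolution c q) {z : ℂ} {ψ ψ' : ℝ → ℂ}
    (hψ : ∀ x, HasDerivAt ψ (ψ' x) x) (hψ' : ∀ x, HasDerivAt ψ' ((q x 0 - z) * ψ x) x)
    {F : Filter ℝ} [F.IsCountablyGenerated] {a : ℝ} {ν : ℂ} (hν : ν ^ 2 = a - z) {e : ℝ → ℂ}
    (hF0 : ∀ t, Tendsto (fun x => q x t) F (𝓝 a))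
    (hF1 : ∀ t, Tendsto (fun x => xDeriv q 1 x t) F (𝓝 0))
    (hF2 : ∀ t, Tendsto (fun x => xDeriv q 2 x t) F (𝓝 0))
    (he : Tendsto (fun x => e x * ψ x) F (𝓝 1)) (he' : Tendsto (fun x => e x * ψ' x) F (𝓝 ν)) :
    ∃ Θ : ℝ → ℝ → ℂ × ℂ, (∀ x, Θ x 0 = (ψ x, ψ' x)) ∧
      (∀ x t, HasDerivAt (Θ x) (laxA q z x t (Θ x t)) t) ∧
      (∀ x t, HasDerivAt (fun x => Θ x t) (laxU (q x t) z (Θ x t)) x) ∧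
      ∀ t, Tendsto (fun x => e x • Θ x t) F
        (𝓝 (exp ((2 * a + 4 * z) * ν * t) • ((1 : ℂ), ν))) := by
  have hAc := continuous_laxA hq z
  have hAx : ∀ x, Continuous (laxA q z x) := fun x => by
    have h := Continuous.comp (g := fun s : ℝ × ℝ => laxA q z s.1 s.2)
      (f := fun t : ℝ => (x, t)) hAc (by fun_prop)
    exact h
  choose Θ hΘ0 hΘ using fun x => exists_linearODE_solution (hAx x) (ψ x, ψ' x)
  refine ⟨Θ, hΘ0, hΘ, ?_, ?_⟩
  · have hA' : Continuous fun s : ℝ × ℝ => laxVDeriv z (xDeriv q 0 s.1 s.2) (xDeriv q 1 s.1 s.2)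
        (xDeriv q 2 s.1 s.2) (xDeriv q 3 s.1 s.2) := continuous_laxVDeriv z
      (a₀ := fun s : ℝ × ℝ => (xDeriv q 0 s.1 s.2 : ℂ))
      (a₁ := fun s : ℝ × ℝ => (xDeriv q 1 s.1 s.2 : ℂ))
      (a₂ := fun s : ℝ × ℝ => (xDeriv q 2 s.1 s.2 : ℂ))
      (a₃ := fun s : ℝ × ℝ => (xDeriv q 3 s.1 s.2 : ℂ))
      (Complex.continuous_ofReal.comp (continuous_xDeriv hq (n := 0) (by norm_num)))
      (Complex.continuous_ofReal.comp (continuous_xDeriv hq (n := 1) (by norm_num)))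
      (Complex.continuous_ofReal.comp (continuous_xDeriv hq (n := 2) (by norm_num)))
      (Complex.continuous_ofReal.comp (continuous_xDeriv hq (n := 3) (by norm_num)))
    have hAd : ∀ x t, HasDerivAt (fun x => laxA q z x t) (laxVDeriv z (xDeriv q 0 x t)
        (xDeriv q 1 x t) (xDeriv q 2 x t) (xDeriv q 3 x t)) x := fun x t =>
      hasDerivAt_laxV z (a₀ := fun x => (xDeriv q 0 x t : ℂ)) (a₁ := fun x => (xDeriv q 1 x t : ℂ))
        (a₂ := fun x => (xDeriv q 2 x t : ℂ))
        (hasDerivAt_xDeriv hq (n := 0) (by norm_num) x t).ofReal_comp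
        (hasDerivAt_xDeriv hq (n := 1) (by norm_num) x t).ofReal_comp
        (hasDerivAt_xDeriv hq (n := 2) (by norm_num) x t).ofReal_comp
    have hUd : ∀ x t : ℝ, HasDerivAt (fun t => laxU (q x t) z)
        ((6 * (xDeriv q 0 x t : ℂ) * xDeriv q 1 x t - xDeriv q 3 x t) • laxDown) t := by
      intro x t
      have h := (((hq.kdv x t).ofReal_comp.sub_const z).smul_const laxDown).const_add laxUp
      refine h.congr_deriv ?_
      rw [xDeriv_zero, xDeriv, xDeriv, iteratedDeriv_one]
      push_cast
      rfl
    have hcurv : ∀ x t y, ((6 * (xDeriv q 0 x t : ℂ) * xDeriv q 1 x t - xDeriv q 3 x t) •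
        laxDown) y + laxU (q x t) z (laxA q z x t y) = laxVDeriv z (xDeriv q 0 x t)
        (xDeriv q 1 x t) (xDeriv q 2 x t) (xDeriv q 3 x t) y +
          laxA q z x t (laxU (q x t) z y) := by
      intro x t y
      have h := lax_compatibility z (xDeriv q 0 x t) (xDeriv q 1 x t) (xDeriv q 2 x t)
        (xDeriv q 3 x t) y
      rw [laxA]
      simp only [xDeriv_zero] at h ⊢
      exact h
    have h0 : ∀ x, HasDerivAt (fun x => Θ x 0) (laxU (q x 0) z (Θ x 0)) x := by
      intro x
      simp only [hΘ0]
      rw [laxU_apply]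
      exact (hψ x).prodMk (hψ' x)
    exact hasDerivAt_of_zeroCurvature (A := laxA q z) (A' := fun x t => laxVDeriv z
      (xDeriv q 0 x t) (xDeriv q 1 x t) (xDeriv q 2 x t) (xDeriv q 3 x t))
      (U := fun x t => laxU (q x t) z)
      (U' := fun x t => (6 * (xDeriv q 0 x t : ℂ) * xDeriv q 1 x t - xDeriv q 3 x t) • laxDown)
      hAc hA' hAd hUd hcurv hΘ h0
  · intro t
    obtain ⟨K, hK⟩ := norm_laxA_le hq z |t|
    have hA₀ : ∀ s, |s| ≤ |t| → Tendsto (fun x => laxA q z x s) F (𝓝 (laxV z a 0 0)) :=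
      fun s _ => tendsto_laxA z (hF0 s) (hF1 s) (hF2 s)
    have hY : ∀ x s, HasDerivAt (fun t => e x • Θ x t) (laxA q z x s (e x • Θ x s)) s := by
      intro x s
      rw [laxA, laxV_smul]
      exact (hΘ x s).const_smul (e x)
    have hY₀ : ∀ s : ℝ, HasDerivAt (fun t : ℝ => exp ((2 * a + 4 * z) * ν * t) • ((1 : ℂ), ν))
        (laxV z a 0 0 (exp ((2 * a + 4 * z) * ν * s) • ((1 : ℂ), ν))) s := by
      intro s
      rw [laxV_smul, laxV_eigenvector z a ν hν, smul_smul]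
      have h1 : HasDerivAt (fun t : ℝ => exp ((2 * a + 4 * z) * ν * t))
          (exp ((2 * a + 4 * z) * ν * s) * ((2 * a + 4 * z) * ν)) s := by
        simpa using ((hasDerivAt_id s).ofReal_comp.const_mul ((2 * a + 4 * z) * ν)).cexp
      exact h1.smul_const _
    have h0 : Tendsto (fun x => e x • Θ x 0) F
        (𝓝 (exp ((2 * a + 4 * z) * ν * (0 : ℝ)) • ((1 : ℂ), ν))) := by
      simp only [hΘ0, ofReal_zero, mul_zero, Complex.exp_zero, one_smul]
      exact (he.prodMk_nhds he').congr fun x => by simp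
    exact tendsto_linearODE (F := F) (A := laxA q z) (A₀ := laxV z a 0 0)
      (Y := fun x t => e x • Θ x t)
      (Y₀ := fun t : ℝ => exp ((2 * a + 4 * z) * ν * t) • ((1 : ℂ), ν)) (T := |t|) (K := K)
      hAx hK hA₀ hY hY₀ h0 (le_refl |t|)

/-- The evolution of the right Jost solution. -/
lemma hasDerivAt_jost_evolution (hq : IsKdVSolution c q) {k : ℂ} (hk : 0 ≤ k.im) (x t : ℝ) :
    HasDerivAt (fun t : ℝ => exp (4 * I * k ^ 3 * t) •
        (jost (fun x => q x t) k x, jostDeriv (fun x => q x t) k x))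
      (laxA q (k ^ 2) x t (exp (4 * I * k ^ 3 * t) •
        (jost (fun x => q x t) k x, jostDeriv (fun x => q x t) k x))) t := by
  have hp := fun t => (isSteplikePotential hq t).right
  obtain ⟨Θ, hΘ0, hΘt, hΘx, hΘl⟩ := exists_lax_solution hq (z := k ^ 2)
    (ψ := jost (fun x => q x 0) k) (ψ' := jostDeriv (fun x => q x 0) k)
    (hasDerivAt_jost (hp 0) hk) (hasDerivAt_jostDeriv (hp 0) hk) (F := atTop) (a := 0) (ν := I * k)
    (by rw [mul_pow, I_sq]; push_cast; ring) (e := fun x => exp (-(I * k * x)))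
    (tendsto_potential_atTop hq) (tendsto_xDeriv_atTop hq le_rfl (by norm_num))
    (tendsto_xDeriv_atTop hq (by norm_num) (by norm_num))
    (isJostRight_jost (hp 0) hk).2 (tendsto_exp_neg_mul_jostDeriv (hp 0) hk)
  have hE : ∀ t : ℝ, exp ((2 * ((0 : ℝ) : ℂ) + 4 * k ^ 2) * (I * k) * t) = exp (4 * I * k ^ 3 * t) := by
    intro t
    congr 1
    push_cast
    ring
  have key : ∀ x t, Θ x t = exp (4 * I * k ^ 3 * t) •
      (jost (fun x => q x t) k x, jostDeriv (fun x => q x t) k x) := by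
    intro x t
    set s := exp (4 * I * k ^ 3 * t) with hs
    have hs0 : s ≠ 0 := Complex.exp_ne_zero _
    have h1 : ∀ x, HasDerivAt (fun x => s⁻¹ * (Θ x t).1) (s⁻¹ * (Θ x t).2) x := fun x => by
      have := (ContinuousLinearMap.fst ℝ ℂ ℂ).hasFDerivAt.comp_hasDerivAt x (hΘx x t)
      rw [laxU_apply] at this
      exact this.const_mul _
    have h2 : ∀ x, HasDerivAt (fun x => s⁻¹ * (Θ x t).2)
        ((q x t - k ^ 2) * (s⁻¹ * (Θ x t).1)) x := fun x => by
      have := (ContinuousLinearMap.snd ℝ ℂ ℂ).hasFDerivAt.comp_hasDerivAt x (hΘx x t)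
      rw [laxU_apply] at this
      refine (this.const_mul s⁻¹).congr_deriv ?_
      rw [ContinuousLinearMap.coe_snd']
      ring
    have hJ : IsJostRight (fun x => q x t) k (fun x => s⁻¹ * (Θ x t).1) := by
      refine ⟨⟨fun x => (h1 x).differentiableAt, fun x => ?_⟩, ?_⟩
      · rw [funext fun x => (h1 x).deriv]
        exact h2 x
      · have h3 := hΘl t
        rw [hE] at h3
        have h4 := ((continuous_fst.tendsto _).comp h3).const_mul s⁻¹
        simp only [Prod.smul_mk, smul_eq_mul, mul_one] at h4
        rw [← hs, inv_mul_cancel₀ hs0] at h4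
        refine h4.congr fun x => ?_
        simp only [Function.comp_apply, Prod.smul_fst, smul_eq_mul]
        ring
    have h3 := isJostRight_unique (hp t) hk hJ
    have e1 := congrFun h3 x
    have e2 : s⁻¹ * (Θ x t).2 = jostDeriv (fun x => q x t) k x := by
      have := h1 x
      rw [h3] at this
      exact this.unique (hasDerivAt_jost (hp t) hk x)
    rw [← e1, ← e2]
    ext <;> simp [hs0]
  have := hΘt x t
  rw [funext (key x)] at this
  exact this

/-- The evolution of the left Jost solution. -/
lemma hasDerivAt_leftJost_evolution (hq : IsKdVSolution c q) {k l : ℂ} (hl : 0 ≤ l.im)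
    (hkl : l ^ 2 = k ^ 2 + c ^ 2) (x t : ℝ) :
    HasDerivAt (fun t : ℝ => exp ((2 * c ^ 2 - 4 * k ^ 2) * (I * l) * t) •
        (jost (leftPot c fun x => q x t) l (-x), -jostDeriv (leftPot c fun x => q x t) l (-x)))
      (laxA q (k ^ 2) x t (exp ((2 * c ^ 2 - 4 * k ^ 2) * (I * l) * t) •
        (jost (leftPot c fun x => q x t) l (-x),
          -jostDeriv (leftPot c fun x => q x t) l (-x)))) t := by
  have hp := fun t => (isSteplikePotential hq t).left
  have hz : l ^ 2 - (c : ℂ) ^ 2 = k ^ 2 := by rw [hkl]; ring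
  obtain ⟨Θ, hΘ0, hΘt, hΘx, hΘl⟩ := exists_lax_solution hq (z := k ^ 2)
    (ψ := fun x => jost (leftPot c fun x => q x 0) l (-x))
    (ψ' := fun x => -jostDeriv (leftPot c fun x => q x 0) l (-x))
    (hasDerivAt_leftJost (hp 0) hl) (fun x => by
      have := (solves_leftJost (hp 0) hl).2 x
      rw [funext fun x => (hasDerivAt_leftJost (hp 0) hl x).deriv, hz] at this
      exact this) (F := atBot) (a := -c ^ 2) (ν := -(I * l))
    (by rw [neg_sq, mul_pow, I_sq, hkl]; push_cast; ring) (e := fun x => exp (I * l * x))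
    (tendsto_potential_atBot hq) (tendsto_xDeriv_atBot hq le_rfl (by norm_num))
    (tendsto_xDeriv_atBot hq (by norm_num) (by norm_num))
    (isJostLeft_jost (hp 0) hl).2 (by
      have := ((tendsto_exp_neg_mul_jostDeriv (hp 0) hl).comp tendsto_neg_atBot_atTop).neg
      refine this.congr fun x => ?_
      simp)
  have hE : ∀ t : ℝ, exp ((2 * ((-c ^ 2 : ℝ) : ℂ) + 4 * k ^ 2) * (-(I * l)) * t) =
      exp ((2 * c ^ 2 - 4 * k ^ 2) * (I * l) * t) := by
    intro t
    congr 1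
    push_cast
    ring
  have key : ∀ x t, Θ x t = exp ((2 * c ^ 2 - 4 * k ^ 2) * (I * l) * t) •
      (jost (leftPot c fun x => q x t) l (-x),
        -jostDeriv (leftPot c fun x => q x t) l (-x)) := by
    intro x t
    set s := exp ((2 * c ^ 2 - 4 * k ^ 2) * (I * l) * t) with hs
    have hs0 : s ≠ 0 := Complex.exp_ne_zero _
    have h1 : ∀ x, HasDerivAt (fun x => s⁻¹ * (Θ x t).1) (s⁻¹ * (Θ x t).2) x := fun x => by
      have := (ContinuousLinearMap.fst ℝ ℂ ℂ).hasFDerivAt.comp_hasDerivAt x (hΘx x t)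
      rw [laxU_apply] at this
      exact this.const_mul _
    have h2 : ∀ x, HasDerivAt (fun x => s⁻¹ * (Θ x t).2)
        ((q x t - k ^ 2) * (s⁻¹ * (Θ x t).1)) x := fun x => by
      have := (ContinuousLinearMap.snd ℝ ℂ ℂ).hasFDerivAt.comp_hasDerivAt x (hΘx x t)
      rw [laxU_apply] at this
      refine (this.const_mul s⁻¹).congr_deriv ?_
      rw [ContinuousLinearMap.coe_snd']
      ring
    have hJ : IsJostLeft c (fun x => q x t) l (fun x => s⁻¹ * (Θ x t).1) := by
      refine ⟨⟨fun x => (h1 x).differentiableAt, fun x => ?_⟩, ?_⟩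
      · rw [funext fun x => (h1 x).deriv, hz]
        exact h2 x
      · have h3 := hΘl t
        rw [hE] at h3
        have h4 := ((continuous_fst.tendsto _).comp h3).const_mul s⁻¹
        simp only [Prod.smul_mk, smul_eq_mul, mul_one] at h4
        rw [← hs, inv_mul_cancel₀ hs0] at h4
        refine h4.congr fun x => ?_
        simp only [Function.comp_apply, Prod.smul_fst, smul_eq_mul]
        ring
    have h3 := isJostRight_unique (hp t) hl hJ.isJostRight
    have h3' : (fun x => s⁻¹ * (Θ x t).1) = fun x => jost (leftPot c fun x => q x t) l (-x) := by
      ext x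
      simpa using congrFun h3 (-x)
    have e1 := congrFun h3' x
    have e2 : s⁻¹ * (Θ x t).2 = -jostDeriv (leftPot c fun x => q x t) l (-x) := by
      have := h1 x
      rw [h3'] at this
      exact this.unique (hasDerivAt_leftJost (hp t) hl x)
    rw [← e1, ← e2]
    ext <;> simp [hs0]
  have := hΘt x t
  rw [funext (key x)] at this
  exact this

end evolution

/-! ### Time evolution of the scattering data -/

section scattering

variable {c : ℝ} {q : ℝ → ℝ → ℝ}

lemma laxA_smul (z : ℂ) (x t : ℝ) (b : ℂ) (y : ℂ × ℂ) :
    laxA q z x t (b • y) = b • laxA q z x t y := laxV_smul _ _ _ _ _ _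

lemma lax_wronskian_eq {z : ℂ} {x : ℝ} {Y Z : ℝ → ℂ × ℂ}
    (hY : ∀ t, HasDerivAt Y (laxA q z x t (Y t)) t)
    (hZ : ∀ t, HasDerivAt Z (laxA q z x t (Z t)) t) (t : ℝ) :
    (Y t).1 * (Z t).2 - (Y t).2 * (Z t).1 = (Y 0).1 * (Z 0).2 - (Y 0).2 * (Z 0).1 := by
  have h1 : ∀ {X : ℝ → ℂ × ℂ}, (∀ t, HasDerivAt X (laxA q z x t (X t)) t) → ∀ t,
      HasDerivAt (fun t => (X t).1) (laxA q z x t (X t)).1 t := fun h t =>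
    (ContinuousLinearMap.fst ℝ ℂ ℂ).hasFDerivAt.comp_hasDerivAt t (h t)
  have h2 : ∀ {X : ℝ → ℂ × ℂ}, (∀ t, HasDerivAt X (laxA q z x t (X t)) t) → ∀ t,
      HasDerivAt (fun t => (X t).2) (laxA q z x t (X t)).2 t := fun h t =>
    (ContinuousLinearMap.snd ℝ ℂ ℂ).hasFDerivAt.comp_hasDerivAt t (h t)
  have h : ∀ t, HasDerivAt (fun t => (Y t).1 * (Z t).2 - (Y t).2 * (Z t).1) 0 t := by
    intro t
    refine (((h1 hY t).mul (h2 hZ t)).sub ((h2 hY t).mul (h1 hZ t))).congr_deriv ?_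
    simp only [laxA, laxV_apply]
    ring
  exact is_const_of_deriv_eq_zero (fun t => (h t).differentiableAt) (fun t => (h t).deriv) t 0

/-- Linear relations between solutions of the `t`-equation persist. -/
lemma lax_linear_relation (hq : IsKdVSolution c q) {z : ℂ} {x : ℝ} {X Y Z : ℝ → ℂ × ℂ}
    (hX : ∀ t, HasDerivAt X (laxA q z x t (X t)) t)
    (hY : ∀ t, HasDerivAt Y (laxA q z x t (Y t)) t)
    (hZ : ∀ t, HasDerivAt Z (laxA q z x t (Z t)) t) {a r : ℂ}
    (h0 : a • X 0 = Y 0 + r • Z 0) (t : ℝ) : a • X t = Y t + r • Z t := by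
  rw [← sub_eq_zero]
  refine eq_zero_of_norm_deriv_le (f := fun t => a • X t - (Y t + r • Z t))
    (f' := fun t => laxA q z x t (a • X t - (Y t + r • Z t))) (fun t => ?_) (fun T => ?_)
    (sub_eq_zero.2 h0) t
  · rw [map_sub, map_add, laxA_smul, laxA_smul]
    exact ((hX t).const_smul a).sub ((hY t).add ((hZ t).const_smul r))
  · obtain ⟨K, hK⟩ := norm_laxA_le hq z T
    exact ⟨K, fun t ht => (ContinuousLinearMap.le_opNorm _ _).trans (by gcongr; exact hK x t ht)⟩

/-- The factor in the evolution of the right Jost solution. -/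
def evolRight (k : ℂ) (t : ℝ) : ℂ := exp (4 * I * k ^ 3 * t)

/-- The factor in the evolution of the left Jost solution. -/
def evolLeft (c : ℝ) (k l : ℂ) (t : ℝ) : ℂ := exp ((2 * c ^ 2 - 4 * k ^ 2) * (I * l) * t)

lemma evolRight_ne_zero (k : ℂ) (t : ℝ) : evolRight k t ≠ 0 := Complex.exp_ne_zero _

lemma evolLeft_ne_zero (c : ℝ) (k l : ℂ) (t : ℝ) : evolLeft c k l t ≠ 0 := Complex.exp_ne_zero _

lemma evolLeft_mul_neg (c : ℝ) (k l : ℂ) (t : ℝ) : evolLeft c k l t * evolLeft c k (-l) t = 1 := by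
  rw [evolLeft, evolLeft, ← Complex.exp_add, ← Complex.exp_zero]
  congr 1
  ring

lemma evolRight_mul_neg (k : ℂ) (t : ℝ) : evolRight k t * evolRight (-k) t = 1 := by
  rw [evolRight, evolRight, ← Complex.exp_add, ← Complex.exp_zero]
  congr 1
  ring

lemma exp_tPhi (x t : ℝ) (k : ℂ) :
    exp (tPhi x t k) = evolRight k t ^ 2 * exp (I * k * x) ^ 2 := by
  rw [tPhi, evolRight, ← Complex.exp_nat_mul, ← Complex.exp_nat_mul, ← Complex.exp_add]
  congr 1
  push_cast
  ring

/-- The evolution of the Wronskian of the Jost solutions. -/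
lemma jostW_evolution (hq : IsKdVSolution c q) {k l : ℂ} (hk : 0 ≤ k.im) (hl : 0 ≤ l.im)
    (hkl : l ^ 2 = k ^ 2 + c ^ 2) (t : ℝ) :
    evolLeft c k l t * evolRight k t * jostW c (fun x => q x t) k l =
      jostW c (fun x => q x 0) k l := by
  have h := lax_wronskian_eq (hasDerivAt_leftJost_evolution hq hl hkl 0)
    (hasDerivAt_jost_evolution hq hk 0) t
  simp only [Prod.smul_fst, Prod.smul_snd, smul_eq_mul, ofReal_zero, mul_zero, Complex.exp_zero,
    one_mul, neg_zero] at h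
  simp only [jostW, evolLeft, evolRight]
  linear_combination h

lemma wronskian_evolution (hq : IsKdVSolution c q) {k : ℂ} (hk : 0 ≤ k.im) (t : ℝ) :
    evolLeft c k (kOne c k) t * evolRight k t * wronskian c (fun x => q x t) k =
      wronskian c (fun x => q x 0) k := by
  rw [wronskian_eq (isSteplikePotential hq t) hk, wronskian_eq (isSteplikePotential hq 0) hk]
  exact jostW_evolution hq hk (kOne_im_nonneg k) (kOne_sq k) t

lemma wronskian_eq_zero_iff (hq : IsKdVSolution c q) {k : ℂ} (hk : 0 ≤ k.im) (t : ℝ) :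
    wronskian c (fun x => q x t) k = 0 ↔ wronskian c (fun x => q x 0) k = 0 := by
  rw [← wronskian_evolution hq hk t]
  simp [evolLeft_ne_zero, evolRight_ne_zero]

/-- The evolution of the factor between linearly dependent Jost solutions. -/
lemma phiOne_evolution (hq : IsKdVSolution c q) {k : ℂ} (hk : 0 ≤ k.im) {b : ℂ}
    (hb : ∀ x, phiOne c (fun x => q x 0) k x = b * phi (fun x => q x 0) k x) (x t : ℝ) :
    evolLeft c k (kOne c k) t * phiOne c (fun x => q x t) k x =
      b * (evolRight k t * phi (fun x => q x t) k x) := by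
  have hl := kOne_im_nonneg (c := c) k
  have hp := isSteplikePotential hq
  have hb' : ∀ x, jost (leftPot c fun x => q x 0) (kOne c k) (-x) =
      b * jost (fun x => q x 0) k x := by
    intro x
    rw [← phi_eq_jost (hp 0).right hk, ← hb x, phiOne_eq (hp 0)]
  have h := lax_linear_relation hq (hasDerivAt_leftJost_evolution hq hl (kOne_sq k) x)
    (hasDerivAt_jost_evolution hq hk x) (hasDerivAt_jost_evolution hq hk x) (a := 1) (r := b - 1)
    (by
      simp only [ofReal_zero, mul_zero, Complex.exp_zero, one_smul]
      rw [hb', leftJost_deriv_eq (hp 0) hk hl hb']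
      ext <;> simp <;> ring) t
  have h1 := congrArg Prod.fst h
  simp only [one_smul, Prod.smul_fst, Prod.fst_add, smul_eq_mul] at h1
  rw [phi_eq_jost (hp t).right hk, phiOne_eq (hp t), evolLeft, evolRight]
  linear_combination h1

lemma kOne_ofReal_exists (hc : 0 < c) (r : ℝ) :
    ∃ l : ℝ, l ≠ 0 ∧ kOne c r = l ∧ 0 ≤ r * l := by
  have h : 0 < Real.sqrt (r ^ 2 + c ^ 2) := Real.sqrt_pos.2 (by positivity)
  rcases le_or_gt 0 r with hr | hr
  · exact ⟨_, h.ne', kOne_ofReal_of_nonneg hr, by positivity⟩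
  · exact ⟨-Real.sqrt (r ^ 2 + c ^ 2), by simpa using h.ne',
      by rw [kOne_ofReal_of_neg hr]; push_cast; rfl,
      mul_nonneg_of_nonpos_of_nonpos hr.le (by linarith)⟩

lemma wronskian_ofReal_ne_zero {p : ℝ → ℝ} (hc : 0 < c) (hp : IsSteplikePotential c p) (r : ℝ) :
    wronskian c p r ≠ 0 := by
  obtain ⟨l, hl0, hl, hrl⟩ := kOne_ofReal_exists hc r
  rw [wronskian_eq hp (by simp), hl]
  exact jostW_ne_zero_of_real hp hl0 (by rw [← hl, kOne_sq]) (Or.inl ⟨r, rfl, hrl⟩)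

lemma exists_reflection {p : ℝ → ℝ} (hc : 0 < c) (hp : IsSteplikePotential c p) (r : ℝ) :
    ∃ R : ℂ, ∀ x, transT c p r * phiOne c p r x = conj (phi p r x) + R * phi p r x := by
  have hr : 0 ≤ (r : ℂ).im := by simp
  have hl := kOne_im_nonneg (c := c) r
  have hW := wronskian_ofReal_ne_zero hc hp r
  have hf : Solves p ((r : ℂ) ^ 2) (phiOne c p r) := by
    rw [phiOne_eq hp]
    exact (solves_leftJost hp.left hl).congr rfl (by rw [kOne_sq]; ring)
  have hphi : Solves p ((r : ℂ) ^ 2) (phi p r) := by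
    rw [phi_eq_jost hp.right hr]
    exact solves_jost hp.right hr
  have hcphi : Solves p ((r : ℂ) ^ 2) (fun x => conj (phi p r x)) :=
    hphi.conj.congr rfl (by rw [map_pow, conj_ofReal])
  have hw : wron (fun x => transT c p r * phiOne c p r x - conj (phi p r x)) (phi p r) 0 = 0 := by
    have hd : deriv (fun x => transT c p r * phiOne c p r x - conj (phi p r x)) 0 =
        transT c p r * deriv (phiOne c p r) 0 - conj (deriv (phi p r) 0) := by
      rw [← deriv_conj (hphi.1 0)]
      exact ((((hf.hasDerivAt 0).const_mul _).sub (hcphi.hasDerivAt 0)).deriv)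
    have h1 := jost_wron_conj hp.right r 0
    rw [← deriv_jost hp.right hr, ← phi_eq_jost hp.right hr] at h1
    have h2 : transT c p r * wronskian c p r = 2 * I * r := by
      rw [transT, div_mul_cancel₀ _ hW]
    rw [wron, hd]
    rw [wronskian] at h2
    linear_combination h2 + h1
  obtain ⟨b, hb⟩ := hphi.exists_eq_const_mul hp.right.continuous ((hf.const_mul _).sub hcphi)
    (by rw [phi_eq_jost hp.right hr]; exact jost_ne_zero hp.right hr) hw
  exact ⟨b, fun x => by rw [← hb x]; ring⟩

lemma reflR_spec {p : ℝ → ℝ} (hc : 0 < c) (hp : IsSteplikePotential c p) (r x : ℝ) :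
    transT c p r * phiOne c p r x = conj (phi p r x) + reflR c p r * phi p r x :=
  Classical.epsilon_spec (exists_reflection hc hp r) x

/-- The evolution of the scattering relation. -/
lemma scattering_evolution (hc : 0 < c) (hq : IsKdVSolution c q) (r x t : ℝ) :
    transT c (fun x => q x t) r * phiOne c (fun x => q x t) r x =
      conj (phi (fun x => q x t) r x) +
        reflR c (fun x => q x 0) r * evolRight r t ^ 2 * phi (fun x => q x t) r x := by
  have hp := isSteplikePotential hq
  have hr : 0 ≤ (r : ℂ).im := by simp
  have hnr : 0 ≤ (-(r : ℂ)).im := by simp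
  have hl := kOne_im_nonneg (c := c) r
  have hs : -conj (r : ℂ) = -r := by rw [conj_ofReal]
  have hrel : ∀ x, transT c (fun x => q x 0) r * jost (leftPot c fun x => q x 0) (kOne c r) (-x) =
      jost (fun x => q x 0) (-r) x + reflR c (fun x => q x 0) r * jost (fun x => q x 0) r x := by
    intro x
    have := reflR_spec hc (hp 0) r x
    rwa [phi_eq_jost (hp 0).right hr, phiOne_eq (hp 0), conj_jost, hs] at this
  have hrel' : ∀ x, transT c (fun x => q x 0) r *
      (-jostDeriv (leftPot c fun x => q x 0) (kOne c r) (-x)) =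
      jostDeriv (fun x => q x 0) (-r) x +
        reflR c (fun x => q x 0) r * jostDeriv (fun x => q x 0) r x := by
    intro x
    have h1 := (hasDerivAt_leftJost (hp 0).left hl x).const_mul (transT c (fun x => q x 0) r)
    rw [funext hrel] at h1
    exact h1.unique ((hasDerivAt_jost (hp 0).right hnr x).add
      ((hasDerivAt_jost (hp 0).right hr x).const_mul _))
  have hneg := hasDerivAt_jost_evolution hq hnr x
  rw [neg_sq] at hneg
  have h := lax_linear_relation hq (hasDerivAt_leftJost_evolution hq hl (kOne_sq (r : ℂ)) x)
    hneg (hasDerivAt_jost_evolution hq hr x) (a := transT c (fun x => q x 0) r)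
    (r := reflR c (fun x => q x 0) r)
    (by
      simp only [ofReal_zero, mul_zero, Complex.exp_zero, one_smul]
      ext
      · exact hrel x
      · exact hrel' x) t
  have h1 := congrArg Prod.fst h
  simp only [Prod.smul_fst, Prod.fst_add, smul_eq_mul] at h1
  change transT c (fun x => q x 0) r * (evolLeft c r (kOne c r) t * _) =
    evolRight (-r) t * _ + _ * (evolRight r t * _) at h1
  have hT : transT c (fun x => q x t) r =
      transT c (fun x => q x 0) r * (evolLeft c r (kOne c r) t * evolRight r t) := by
    rw [transT, transT, ← wronskian_evolution hq hr t]
    have := wronskian_ofReal_ne_zero hc (hp t) r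
    have := evolLeft_ne_zero c r (kOne c r) t
    have := evolRight_ne_zero r t
    field_simp
  have hE := evolRight_mul_neg r t
  rw [phi_eq_jost (hp t).right hr, phiOne_eq (hp t), conj_jost, hs, hT]
  linear_combination evolRight r t * h1 + jost (fun x => q x t) (-r) x * hE

end scattering

/-! ### Boundary values of the vector function -/

section boundary

variable {c : ℝ} {p : ℝ → ℝ}

/-- The values of `m` in the upper half plane, with `k₁` replaced by `l`. -/
def upperValue (c : ℝ) (p : ℝ → ℝ) (x : ℝ) (k l : ℂ) : Fin 2 → ℂ :=
  ![2 * I * k / jostW c p k l * jost (leftPot c p) l (-x) * exp (I * k * x),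
    jost p k x * exp (-(I * k * x))]

lemma mVec_of_im_pos (hp : IsSteplikePotential c p) (x : ℝ) {k : ℂ} (hk : 0 < k.im) :
    mVec c p x k = upperValue c p x k (kOne c k) := by
  rw [mVec, if_pos hk, transT, wronskian_eq hp hk.le, phiOne_eq hp, phi_eq_jost hp.right hk.le]
  rfl

lemma mVec_neg (c : ℝ) (p : ℝ → ℝ) (x : ℝ) {k : ℂ} (hk : k.im ≠ 0) :
    mVec c p x (-k) = ![mVec c p x k 1, mVec c p x k 0] := by
  rcases lt_or_gt_of_ne hk with h | h
  · rw [mVec, mVec, if_pos (by simpa using h), if_neg (by simpa using h.le)]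
    simp
  · rw [mVec, mVec, if_neg (by simpa using h.le), if_pos h]
    simp

lemma neg_mem_contour {k : ℂ} : -k ∈ contour c ↔ k ∈ contour c := by
  simp [contour]

lemma hasNTLimit_neg (x : ℝ) {k n : ℂ} {l : Fin 2 → ℂ}
    (h : HasNTLimit (contour c)ᶜ (mVec c p x) k n l) :
    HasNTLimit (contour c)ᶜ (mVec c p x) (-k) (-n) ![l 1, l 0] := by
  intro a ha
  have h1 : Tendsto (fun z : ℂ => -z) (𝓝[(contour c)ᶜ ∩ cone (-k) (-n) a] (-k))
      (𝓝[(contour c)ᶜ ∩ cone k n a] k) := by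
    refine tendsto_nhdsWithin_iff.2 ⟨?_, ?_⟩
    · refine Tendsto.mono_left ?_ nhdsWithin_le_nhds
      simpa using (continuous_neg (G := ℂ)).tendsto (-k)
    · filter_upwards [self_mem_nhdsWithin] with z hz
      refine ⟨fun hm => hz.1 (neg_mem_contour.1 hm), ?_⟩
      have e : (z - -k) * conj (-n) = (-z - k) * conj n := by rw [map_neg]; ring
      have := hz.2
      rw [cone, Set.mem_ofPred_eq, e] at this
      exact this
  have h2 := (h a ha).comp h1
  have h3 : Tendsto (fun z => ![mVec c p x (-z) 1, mVec c p x (-z) 0])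
      (𝓝[(contour c)ᶜ ∩ cone (-k) (-n) a] (-k)) (𝓝 ![l 1, l 0]) := by
    rw [tendsto_pi_nhds] at h2 ⊢
    intro i
    fin_cases i
    · exact h2 1
    · exact h2 0
  refine h3.congr' ?_
  filter_upwards [self_mem_nhdsWithin] with z hz
  have him : (-z).im ≠ 0 := by simpa using im_ne_zero_of_notMem_contour hz.1
  rw [← mVec_neg c p x him, neg_neg]

lemma tendsto_mVec_upper (hp : IsSteplikePotential c p) (x : ℝ) {F : Filter ℂ} {k₀ l₀ : ℂ}
    (hF : F ≤ 𝓝 k₀) (hFi : ∀ᶠ k in F, 0 < k.im) (hk₀ : 0 ≤ k₀.im)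
    (hl : Tendsto (kOne c) F (𝓝 l₀)) (hl₀ : 0 ≤ l₀.im) (hW : jostW c p k₀ l₀ ≠ 0) :
    Tendsto (mVec c p x) F (𝓝 (upperValue c p x k₀ l₀)) := by
  have hk : Tendsto (fun k : ℂ => k) F (𝓝 k₀) := hF
  have hki : ∀ᶠ k in F, 0 ≤ k.im := hFi.mono fun k h => h.le
  have hli : ∀ᶠ k in F, 0 ≤ (kOne c k).im := Eventually.of_forall fun k => kOne_im_nonneg k
  have h : Tendsto (fun k => upperValue c p x k (kOne c k)) F (𝓝 (upperValue c p x k₀ l₀)) := by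
    have hexp : Tendsto (fun k : ℂ => I * k * x) F (𝓝 (I * k₀ * x)) :=
      (hk.const_mul I).mul_const _
    rw [tendsto_pi_nhds]
    intro i
    fin_cases i
    · exact (((hk.const_mul (2 * I)).div (tendsto_jostW hp hk hki hk₀ hl hli hl₀) hW).mul
        (tendsto_jost_param hp.left hl hli hl₀ (-x))).mul hexp.cexp
    · exact (tendsto_jost_param hp.right hk hki hk₀ x).mul hexp.neg.cexp
  exact h.congr' (hFi.mono fun k hk => (mVec_of_im_pos hp x hk).symm)

lemma tendsto_neg_conj_quadrant (k₀ : ℂ) :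
    Tendsto (fun k : ℂ => -conj k) (𝓝[{k | k.re < 0 ∧ 0 < k.im}] k₀)
      (𝓝[{k | 0 < k.re ∧ 0 < k.im}] (-conj k₀)) := by
  refine tendsto_nhdsWithin_iff.2 ⟨?_, ?_⟩
  · exact ((continuous_conj.neg).tendsto k₀).mono_left nhdsWithin_le_nhds
  · filter_upwards [self_mem_nhdsWithin] with k hk
    simpa using hk

lemma notMem_contour_of_re_neg {k : ℂ} (hre : k.re < 0) (him : 0 < k.im) : k ∉ contour c := by
  rintro (h | h)
  · exact him.ne' h
  · exact hre.ne h.1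

lemma tendsto_kOne_quadrant_left (hc : 0 < c) {k₀ : ℂ} {l : ℝ} (hl : 0 ≤ l)
    (hkl : (l : ℂ) ^ 2 = k₀ ^ 2 + c ^ 2) :
    Tendsto (kOne c) (𝓝[{k | k.re < 0 ∧ 0 < k.im}] k₀) (𝓝 (-l)) := by
  have hkl' : (l : ℂ) ^ 2 = (-conj k₀) ^ 2 + c ^ 2 := by
    have := congrArg conj hkl
    simp only [map_pow, map_add, conj_ofReal] at this
    rw [this, neg_sq]
  have h := (tendsto_kOne_quadrant hc hl hkl').comp (tendsto_neg_conj_quadrant k₀)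
  have h2 := ((continuous_conj.tendsto _).comp h).neg
  rw [conj_ofReal] at h2
  refine h2.congr' ?_
  filter_upwards [self_mem_nhdsWithin] with k hk
  simp only [Function.comp_apply]
  rw [kOne_neg_conj hc (notMem_contour_of_re_neg hk.1 hk.2), map_neg, conj_conj, neg_neg]

/-- Boundary values on the real axis from above. -/
lemma hasNTLimit_real (hc : 0 < c) (hp : IsSteplikePotential c p) (x r : ℝ) :
    HasNTLimit (contour c)ᶜ (mVec c p x) r I (upperValue c p x r (kOne c r)) := by
  intro a _
  have hle : 𝓝[(contour c)ᶜ ∩ cone r I a] (r : ℂ) ≤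
      𝓝[{k | 0 < k.re ∧ 0 < k.im}] (r : ℂ) ⊔ 𝓝[{k | k.re < 0 ∧ 0 < k.im}] (r : ℂ) := by
    rw [← nhdsWithin_union]
    refine nhdsWithin_le_iff.2 ?_
    have hsmall : ∀ᶠ k : ℂ in 𝓝 (r : ℂ), |k.im| < c := by
      have : Continuous fun k : ℂ => |k.im| := continuous_im.abs
      exact this.continuousAt.eventually_lt_const (by simpa using hc)
    filter_upwards [self_mem_nhdsWithin, nhdsWithin_le_nhds hsmall] with k hk hki
    have him : 0 < k.im := by
      have := hk.2.1
      simpa using this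
    have hre : k.re ≠ 0 := fun h => hk.1 (Or.inr ⟨h, hki.le⟩)
    rcases lt_or_gt_of_ne hre with h | h
    · exact Or.inr ⟨h, him⟩
    · exact Or.inl ⟨h, him⟩
  refine Tendsto.mono_left (Tendsto.sup ?_ ?_) hle
  · rcases lt_or_ge r 0 with hr | hr
    · have : 𝓝[{k : ℂ | 0 < k.re ∧ 0 < k.im}] (r : ℂ) = ⊥ := by
        rw [← notMem_closure_iff_nhdsWithin_eq_bot]
        intro hm
        have hcl : IsClosed {k : ℂ | 0 ≤ k.re} := isClosed_le continuous_const continuous_re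
        have := closure_minimal (fun k hk => hk.1.le) hcl hm
        simp only [Set.mem_ofPred_eq, ofReal_re] at this
        linarith
      rw [this]
      exact tendsto_bot
    · have hs : 0 ≤ Real.sqrt (r ^ 2 + c ^ 2) := Real.sqrt_nonneg _
      have hkl : ((Real.sqrt (r ^ 2 + c ^ 2) : ℝ) : ℂ) ^ 2 = (r : ℂ) ^ 2 + c ^ 2 := by
        rw [← kOne_ofReal_of_nonneg hr, kOne_sq]
      have hW := wronskian_ofReal_ne_zero hc hp r
      rw [wronskian_eq hp (by simp), kOne_ofReal_of_nonneg hr] at hW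
      rw [kOne_ofReal_of_nonneg hr]
      exact tendsto_mVec_upper hp x nhdsWithin_le_nhds
        (by filter_upwards [self_mem_nhdsWithin] with k hk using hk.2) (by simp)
        (tendsto_kOne_quadrant hc hs hkl) (by simp) hW
  · rcases lt_trichotomy r 0 with hr | hr | hr
    · have hs : 0 ≤ Real.sqrt (r ^ 2 + c ^ 2) := Real.sqrt_nonneg _
      have hkl : ((Real.sqrt (r ^ 2 + c ^ 2) : ℝ) : ℂ) ^ 2 = (r : ℂ) ^ 2 + c ^ 2 := by
        rw [← neg_sq, ← kOne_ofReal_of_neg hr, kOne_sq]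
      have hW := wronskian_ofReal_ne_zero hc hp r
      rw [wronskian_eq hp (by simp), kOne_ofReal_of_neg hr] at hW
      rw [kOne_ofReal_of_neg hr]
      exact tendsto_mVec_upper hp x nhdsWithin_le_nhds
        (by filter_upwards [self_mem_nhdsWithin] with k hk using hk.2) (by simp)
        (tendsto_kOne_quadrant_left hc hs hkl) (by simp) hW
    · subst hr
      have hkl : (c : ℂ) ^ 2 = ((0 : ℝ) : ℂ) ^ 2 + c ^ 2 := by simp
      have hW : jostW c p ((0 : ℝ) : ℂ) (-c) ≠ 0 := by
        have := jostW_ne_zero_of_real hp (k := ((0 : ℝ) : ℂ)) (l := -c) (by simpa using hc.ne')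
          (by simp) (Or.inl ⟨0, rfl, by simp⟩)
        simpa using this
      have h := tendsto_mVec_upper hp x nhdsWithin_le_nhds
        (by filter_upwards [self_mem_nhdsWithin] with k hk using hk.2) (by simp)
        (tendsto_kOne_quadrant_left hc hc.le hkl) (by simp) hW
      convert h using 2
      simp [upperValue]
    · have : 𝓝[{k : ℂ | k.re < 0 ∧ 0 < k.im}] (r : ℂ) = ⊥ := by
        rw [← notMem_closure_iff_nhdsWithin_eq_bot]
        intro hm
        have hcl : IsClosed {k : ℂ | k.re ≤ 0} := isClosed_le continuous_re continuous_const
        have := closure_minimal (fun k hk => hk.1.le) hcl hm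
        simp only [Set.mem_ofPred_eq, ofReal_re] at this
        linarith
      rw [this]
      exact tendsto_bot

lemma eventually_im_pos {k₀ : ℂ} (hk₀ : 0 < k₀.im) : ∀ᶠ k : ℂ in 𝓝 k₀, 0 < k.im :=
  continuous_im.continuousAt.eventually_const_lt hk₀

/-- Boundary values on the cut from the right. -/
lemma hasNTLimit_cut_right (hc : 0 < c) (hp : IsSteplikePotential c p) (x : ℝ) {k₀ : ℂ} {l : ℝ}
    (hre : k₀.re = 0) (him : 0 < k₀.im) (hl : 0 ≤ l) (hkl : (l : ℂ) ^ 2 = k₀ ^ 2 + c ^ 2)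
    (hW : jostW c p k₀ l ≠ 0) :
    HasNTLimit (contour c)ᶜ (mVec c p x) k₀ 1 (upperValue c p x k₀ l) := by
  intro a _
  have hle : 𝓝[(contour c)ᶜ ∩ cone k₀ 1 a] k₀ ≤ 𝓝[{k | 0 < k.re ∧ 0 < k.im}] k₀ := by
    refine nhdsWithin_le_iff.2 ?_
    filter_upwards [self_mem_nhdsWithin, nhdsWithin_le_nhds (eventually_im_pos him)] with k hk hki
    have := hk.2.1
    rw [map_one, mul_one, sub_re, hre, sub_zero] at this
    exact ⟨this, hki⟩
  exact tendsto_mVec_upper hp x nhdsWithin_le_nhds (nhdsWithin_le_nhds (eventually_im_pos him))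
    him.le ((tendsto_kOne_quadrant hc hl hkl).mono_left hle) (by simp) hW

/-- Boundary values on the cut from the left. -/
lemma hasNTLimit_cut_left (hc : 0 < c) (hp : IsSteplikePotential c p) (x : ℝ) {k₀ : ℂ} {l : ℝ}
    (hre : k₀.re = 0) (him : 0 < k₀.im) (hl : 0 ≤ l) (hkl : (l : ℂ) ^ 2 = k₀ ^ 2 + c ^ 2)
    (hW : jostW c p k₀ (-l) ≠ 0) :
    HasNTLimit (contour c)ᶜ (mVec c p x) k₀ (-1) (upperValue c p x k₀ (-l)) := by
  intro a _
  have hle : 𝓝[(contour c)ᶜ ∩ cone k₀ (-1) a] k₀ ≤ 𝓝[{k | k.re < 0 ∧ 0 < k.im}] k₀ := by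
    refine nhdsWithin_le_iff.2 ?_
    filter_upwards [self_mem_nhdsWithin, nhdsWithin_le_nhds (eventually_im_pos him)] with k hk hki
    have := hk.2.1
    rw [map_neg, map_one, mul_neg_one, neg_re, sub_re, hre, sub_zero] at this
    exact ⟨by linarith, hki⟩
  exact tendsto_mVec_upper hp x nhdsWithin_le_nhds (nhdsWithin_le_nhds (eventually_im_pos him))
    him.le ((tendsto_kOne_quadrant_left hc hl hkl).mono_left hle) (by simp) hW

lemma chi_eq (hc : 0 < c) (hp : IsSteplikePotential c p) {k₀ : ℂ} {l : ℝ}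
    (hre : k₀.re = 0) (him : 0 < k₀.im) (hl : 0 ≤ l) (hkl : (l : ℂ) ^ 2 = k₀ ^ 2 + c ^ 2)
    (hW : jostW c p k₀ l ≠ 0) :
    chi c p k₀ = 4 * k₀ * l / (jostW c p k₀ l * jostW c p k₀ (-l)) := by
  have hconj : conj k₀ = -k₀ := by
    apply Complex.ext <;> simp [hre]
  have h1 : Tendsto (fun ε : ℝ => k₀ + ε) (𝓝[>] 0) (𝓝[{k | 0 < k.re ∧ 0 < k.im}] k₀) := by
    refine tendsto_nhdsWithin_iff.2 ⟨?_, ?_⟩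
    · refine Tendsto.mono_left ?_ nhdsWithin_le_nhds
      have : Continuous fun ε : ℝ => k₀ + ε := by fun_prop
      simpa using this.tendsto 0
    · filter_upwards [self_mem_nhdsWithin] with ε hε
      simpa [hre, him] using hε
  have hQ : ∀ᶠ k in 𝓝[{k : ℂ | 0 < k.re ∧ 0 < k.im}] k₀, 0 ≤ k.im := by
    filter_upwards [self_mem_nhdsWithin] with k hk using hk.2.le
  have hk : Tendsto (fun k : ℂ => k) (𝓝[{k | 0 < k.re ∧ 0 < k.im}] k₀) (𝓝 k₀) :=
    nhdsWithin_le_nhds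
  have hkOne := tendsto_kOne_quadrant hc hl hkl
  have hWl : Tendsto (wronskian c p) (𝓝[{k | 0 < k.re ∧ 0 < k.im}] k₀)
      (𝓝 (jostW c p k₀ l)) := by
    refine (tendsto_jostW hp hk hQ him.le hkOne
      (Eventually.of_forall fun k => kOne_im_nonneg k) (by simp)).congr' ?_
    exact hQ.mono fun k hk => (wronskian_eq hp hk).symm
  have hT : Tendsto (transT c p) (𝓝[{k | 0 < k.re ∧ 0 < k.im}] k₀)
      (𝓝 (2 * I * k₀ / jostW c p k₀ l)) := (hk.const_mul (2 * I)).div hWl hW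
  have hT1 : Tendsto (transTOne c p) (𝓝[{k | 0 < k.re ∧ 0 < k.im}] k₀)
      (𝓝 (2 * I * l / jostW c p k₀ l)) := (hkOne.const_mul (2 * I)).div hWl hW
  have hlim := (((continuous_conj.tendsto _).comp hT).mul hT1).comp h1
  have hconjW : conj (jostW c p k₀ l) = jostW c p k₀ (-l) := by
    rw [conj_jostW hp him.le (by simp), hconj, neg_neg, conj_ofReal]
  rw [chi, if_pos him.le]
  have := hlim.limUnder_eq
  simp only [Function.comp_def] at this
  rw [this]
  rw [map_div₀, hconjW, map_mul, map_mul, hconj, conj_I, map_ofNat]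
  have hW' : jostW c p k₀ (-l) ≠ 0 := by
    rw [← hconjW]
    simpa using hW
  field_simp
  linear_combination (-4 * k₀ * (l : ℂ)) * I_sq

lemma chi_neg (c : ℝ) (p : ℝ → ℝ) {k : ℂ} (hk : 0 < k.im) : chi c p (-k) = -chi c p k := by
  rw [chi, chi, if_pos hk.le, if_neg (by simpa using hk), neg_neg, neg_neg]

lemma jostW_eq (hp : IsSteplikePotential c p) {k l : ℂ} (hk : 0 ≤ k.im) (hl : 0 ≤ l.im)
    (hkl : l ^ 2 = k ^ 2 + c ^ 2) (x : ℝ) :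
    jostW c p k l = jost (leftPot c p) l (-x) * jostDeriv p k x +
      jostDeriv (leftPot c p) l (-x) * jost p k x := by
  have h := ((solves_leftJost hp.left hl).congr rfl (by rw [hkl]; ring)).wron_eq
    (solves_jost hp.right hk) 0 x
  rw [wron_leftJost_jost hp hk hl, wron, deriv_jost hp.right hk,
    (hasDerivAt_leftJost hp.left hl x).deriv] at h
  rw [h]
  ring

/-- The jump of the first component across the cut. -/
lemma upperValue_cut (hp : IsSteplikePotential c p) (x : ℝ) {k : ℂ} {l : ℝ}
    (him : 0 ≤ k.im) (hkl : (l : ℂ) ^ 2 = k ^ 2 + c ^ 2)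
    (hW : jostW c p k l ≠ 0) (hW' : jostW c p k (-l) ≠ 0) :
    upperValue c p x k l 0 = upperValue c p x k (-l) 0 +
      4 * k * l / (jostW c p k l * jostW c p k (-l)) * exp (I * k * x) ^ 2 *
        upperValue c p x k (-l) 1 := by
  have e1 := jostW_eq hp him (l := (l : ℂ)) (by simp) hkl x
  have e2 := jostW_eq hp him (l := -(l : ℂ)) (by simp) (by rw [neg_sq, hkl]) x
  have e3 := jost_wron_conj hp.left l (-x)
  have hs : -conj (l : ℂ) = -l := by rw [conj_ofReal]
  rw [conj_jost, conj_jostDeriv hp.left (by simp), hs] at e3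
  have hE : exp (I * k * x) * exp (-(I * k * x)) = 1 := by
    rw [← Complex.exp_add, add_neg_cancel, Complex.exp_zero]
  simp only [upperValue, Matrix.cons_val_zero, Matrix.cons_val_one]
  set W := jostW c p k l
  set W' := jostW c p k (-l)
  have e4 : jost (leftPot c p) l (-x) * W' - jost (leftPot c p) (-l) (-x) * W =
      -(2 * I * l) * jost p k x := by
    rw [e1, e2]
    linear_combination jost p k x * e3
  have hr : 4 * k * l / (W * W') * exp (I * k * x) ^ 2 * (jost p k x * exp (-(I * k * x))) =
      4 * k * l / (W * W') * exp (I * k * x) * jost p k x := by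
    linear_combination (4 * k * l / (W * W') * exp (I * k * x) * jost p k x) * hE
  rw [hr]
  field_simp
  linear_combination (2 * I * k) * e4 - (4 * l * jost p k x * k) * I_sq

end boundary

/-! ### The jump conditions -/

section jumps

variable {c : ℝ} {p : ℝ → ℝ} {q : ℝ → ℝ → ℝ}

lemma vecMul_fin_two (v : Fin 2 → ℂ) (a b d e : ℂ) :
    v ᵥ* !![a, b; d, e] = ![v 0 * a + v 1 * d, v 0 * b + v 1 * e] := by
  ext i
  fin_cases i <;> simp [Matrix.vecMul, dotProduct, Fin.sum_univ_two]

lemma upperValue_kOne (hp : IsSteplikePotential c p) (x : ℝ) {k : ℂ} (hk : 0 ≤ k.im) :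
    upperValue c p x k (kOne c k) = ![transT c p k * phiOne c p k x * exp (I * k * x),
      phi p k x * exp (-(I * k * x))] := by
  rw [transT, wronskian_eq hp hk, phiOne_eq hp, phi_eq_jost hp.right hk]
  rfl

lemma phi_neg_ofReal (hp : IsSteplikePotential c p) (r x : ℝ) :
    phi p ((-r : ℝ) : ℂ) x = conj (phi p r x) := by
  rw [phi_eq_jost hp.right (by simp), phi_eq_jost hp.right (by simp), conj_jost, conj_ofReal,
    ofReal_neg]

lemma kOne_neg_ofReal {r : ℝ} (hr : r ≠ 0) : kOne c ((-r : ℝ) : ℂ) = -kOne c r := by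
  rcases lt_or_gt_of_ne hr with h | h
  · rw [kOne_ofReal_of_neg h, kOne_ofReal_of_nonneg (by linarith), neg_sq, neg_neg]
  · rw [kOne_ofReal_of_nonneg h.le, kOne_ofReal_of_neg (by linarith), neg_sq]

lemma transT_mul_phiOne_neg_ofReal (hc : 0 < c) (hp : IsSteplikePotential c p) (r x : ℝ) :
    transT c p ((-r : ℝ) : ℂ) * phiOne c p ((-r : ℝ) : ℂ) x =
      conj (transT c p r * phiOne c p r x) := by
  rcases eq_or_ne r 0 with rfl | hr
  · simp [transT]
  · obtain ⟨l, -, hl, -⟩ := kOne_ofReal_exists hc r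
    rw [transT, transT, wronskian_eq hp (by simp), wronskian_eq hp (by simp), phiOne_eq hp,
      phiOne_eq hp, kOne_neg_ofReal hr, hl, map_mul, map_div₀, conj_jost,
      conj_jostW hp (by simp) (by simp)]
    simp only [map_mul, map_ofNat, conj_I, conj_ofReal, ofReal_neg]
    ring_nf

lemma jump_real (hc : 0 < c) (hq : IsKdVSolution c q) (x t r : ℝ) :
    ∃ mp mm : Fin 2 → ℂ,
      HasNTLimit (contour c)ᶜ (mVec c (fun y => q y t) x) r I mp ∧
      HasNTLimit (contour c)ᶜ (mVec c (fun y => q y t) x) r (-I) mm ∧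
      mp = mm ᵥ* !![1 - (‖reflR c (fun y => q y 0) r‖ : ℂ) ^ 2,
        -(conj (reflR c (fun y => q y 0) r) * exp (-tPhi x t r));
        reflR c (fun y => q y 0) r * exp (tPhi x t r), 1] := by
  have hp := isSteplikePotential hq t
  have hm := hasNTLimit_neg x (hasNTLimit_real hc hp x (-r))
  rw [ofReal_neg, neg_neg] at hm
  refine ⟨_, _, hasNTLimit_real hc hp x r, hm, ?_⟩
  rw [← ofReal_neg, upperValue_kOne hp x (by simp), upperValue_kOne hp x (by simp),
    transT_mul_phiOne_neg_ofReal hc hp, phi_neg_ofReal hp, scattering_evolution hc hq r x t]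
  set R := reflR c (fun y => q y 0) r
  set f := phi (fun y => q y t) r x
  have hE : exp (I * r * x) * exp (-(I * r * x)) = 1 := by
    rw [← Complex.exp_add, add_neg_cancel, Complex.exp_zero]
  have hV : conj (evolRight r t) * evolRight r t = 1 := by
    rw [evolRight, ← exp_conj, ← Complex.exp_add, ← Complex.exp_zero]
    congr 1
    simp only [map_mul, map_pow, conj_ofReal, conj_I, map_ofNat]
    ring
  have hPhi : exp (-tPhi x t r) = conj (evolRight r t) ^ 2 * exp (-(I * r * x)) ^ 2 := by
    have h1 := exp_tPhi x t r
    have h2 : exp (tPhi x t r) ≠ 0 := Complex.exp_ne_zero _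
    rw [Complex.exp_neg, inv_eq_iff_eq_inv, eq_comm]
    refine inv_eq_of_mul_eq_one_right ?_
    rw [h1]
    calc _ = (conj (evolRight r t) * evolRight r t) ^ 2 *
          (exp (I * r * x) * exp (-(I * r * x))) ^ 2 := by ring
      _ = 1 := by rw [hE, hV]; ring
  have hR : (‖R‖ : ℂ) ^ 2 = conj R * R := by rw [mul_comm, mul_conj, normSq_eq_norm_sq]; push_cast; rfl
  have e1 : I * ((-r : ℝ) : ℂ) * x = -(I * r * x) := by push_cast; ring
  rw [hPhi, exp_tPhi, hR, e1, neg_neg]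
  set V := evolRight r t
  set P := exp (I * r * x)
  set M := exp (-(I * r * x))
  rw [vecMul_fin_two]
  ext i
  fin_cases i
  · simp
    linear_combination (-(P ^ 2 * M) * R * conj R * conj f * (conj V * V + 1)) * hV +
      (-P * R * V ^ 2 * f - P * R * conj R * conj f) * hE
  · simp
    linear_combination (conj R * conj f * conj V ^ 2 * M) * hE

/-- The jump across the upper half of the cut. -/
lemma jump_cut (hc : 0 < c) (hq : IsKdVSolution c q)
    (hnr : wronskian c (fun x => q x 0) (I * c) ≠ 0) (x t : ℝ) {k : ℂ} (hre : k.re = 0)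
    (him : 0 < k.im) (hkc : k.im ≤ c) :
    ∃ mp mm : Fin 2 → ℂ,
      HasNTLimit (contour c)ᶜ (mVec c (fun y => q y t) x) k 1 mp ∧
      HasNTLimit (contour c)ᶜ (mVec c (fun y => q y t) x) k (-1) mm ∧
      mp 0 = mm 0 + chi c (fun y => q y 0) k * exp (tPhi x t k) * mm 1 ∧ mp 1 = mm 1 := by
  have hp := isSteplikePotential hq
  have hk : k = I * k.im := by apply Complex.ext <;> simp [hre]
  set l := Real.sqrt (c ^ 2 - k.im ^ 2) with hl
  have hl0 : 0 ≤ l := Real.sqrt_nonneg _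
  have hkl : (l : ℂ) ^ 2 = k ^ 2 + c ^ 2 := by
    have h1 : l ^ 2 = c ^ 2 - k.im ^ 2 := Real.sq_sqrt (by nlinarith)
    rw [hk, mul_pow, I_sq, ← ofReal_pow, h1]
    push_cast
    simp
    ring
  have hkl' : (-(l : ℂ)) ^ 2 = k ^ 2 + c ^ 2 := by rw [neg_sq, hkl]
  have hWs : ∀ s : ℝ, (s : ℂ) ^ 2 = k ^ 2 + c ^ 2 → ∀ t, jostW c (fun y => q y t) k s ≠ 0 := by
    intro s hs t
    rcases eq_or_ne s 0 with rfl | hs0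
    · have hkc' : k.im = c := by
        have h1 : (k.im : ℂ) ^ 2 = (c : ℂ) ^ 2 := by
          rw [hk, mul_pow, I_sq] at hs
          simp at hs
          linear_combination hs
        have h2 : k.im ^ 2 = c ^ 2 := by exact_mod_cast h1
        exact (pow_left_inj₀ him.le hc.le two_ne_zero).1 h2
      have hnr' := (wronskian_eq_zero_iff hq (k := I * c) (by simpa using hc.le) t).not.2 hnr
      rw [wronskian_eq (hp t) (by simpa using hc.le), kOne_imaginary hc le_rfl] at hnr'
      rw [hk, hkc']
      simpa using hnr'
    · exact jostW_ne_zero_of_real (hp t) hs0 hs (Or.inr ⟨k.im, hk, him.le⟩)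
  have hW := hWs l hkl
  have hW' : ∀ t, jostW c (fun y => q y t) k (-l) ≠ 0 := fun t => by
    have := hWs (-l) (by push_cast; exact hkl') t
    rwa [ofReal_neg] at this
  refine ⟨_, _, hasNTLimit_cut_right hc (hp t) x hre him hl0 hkl (hW t),
    hasNTLimit_cut_left hc (hp t) x hre him hl0 hkl (hW' t), ?_, rfl⟩
  rw [upperValue_cut (hp t) x him.le hkl (hW t) (hW' t),
    chi_eq hc (hp 0) hre him hl0 hkl (hW 0), exp_tPhi,
    ← jostW_evolution hq him.le (by simp) hkl t, ← jostW_evolution hq him.le (by simp) hkl' t]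
  have h1 := evolLeft_mul_neg c k l t
  have h2 := evolRight_ne_zero k t
  have h3 := hW t
  have h4 := hW' t
  have h5 : evolLeft c k l t * evolRight k t * jostW c (fun x => q x t) k l *
      (evolLeft c k (-l) t * evolRight k t * jostW c (fun x => q x t) k (-l)) =
      evolRight k t ^ 2 * (jostW c (fun x => q x t) k l * jostW c (fun x => q x t) k (-l)) := by
    linear_combination (evolRight k t ^ 2 *
      (jostW c (fun x => q x t) k l * jostW c (fun x => q x t) k (-l))) * h1
  rw [h5]
  congr 2
  field_simp

lemma jump_condition (hc : 0 < c) (hq : IsKdVSolution c q)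
    (hnr : wronskian c (fun x => q x 0) (I * c) ≠ 0) (x t : ℝ) {k : ℂ} (hk : k ∈ contour c) :
    ∃ mp mm : Fin 2 → ℂ,
      HasNTLimit (contour c)ᶜ (mVec c (fun y => q y t) x) k (plusNormal k) mp ∧
      HasNTLimit (contour c)ᶜ (mVec c (fun y => q y t) x) k (-plusNormal k) mm ∧
      mp = mm ᵥ* jump (reflR c (fun y => q y 0)) (chi c (fun y => q y 0)) x t k := by
  rcases lt_trichotomy k.im 0 with him | him | him
  · have hre : k.re = 0 ∧ |k.im| ≤ c := hk.resolve_left him.ne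
    obtain ⟨mp, mm, h1, h2, h3, h4⟩ := jump_cut hc hq hnr x t (k := -k) (by simpa using hre.1)
      (by simpa using him) (by rw [neg_im]; exact (neg_le_abs _).trans hre.2)
    rw [plusNormal, if_neg him.ne, jump, if_neg him.ne, if_neg him.not_gt]
    have h5 := hasNTLimit_neg x h2
    have h6 := hasNTLimit_neg x h1
    rw [neg_neg] at h5 h6
    rw [neg_neg] at h5
    refine ⟨_, _, h5, h6, ?_⟩
    have h7 : chi c (fun y => q y 0) k = -chi c (fun y => q y 0) (-k) := by
      rw [← chi_neg _ _ (by simpa using him), neg_neg]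
    have h8 : tPhi x t (-k) = -tPhi x t k := by rw [tPhi, tPhi]; ring
    rw [h8] at h3
    rw [h7]
    rw [vecMul_fin_two]
    ext i
    fin_cases i
    · simp [h4]
    · simp [h4, h3]
      ring
  · obtain ⟨r, rfl⟩ : ∃ r : ℝ, k = r := ⟨k.re, by apply Complex.ext <;> simp [him]⟩
    rw [plusNormal, if_pos him, jump, if_pos him, ofReal_re]
    exact jump_real hc hq x t r
  · have hre : k.re = 0 ∧ |k.im| ≤ c := hk.resolve_left him.ne'
    obtain ⟨mp, mm, h1, h2, h3, h4⟩ := jump_cut hc hq hnr x t hre.1 him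
      ((le_abs_self _).trans hre.2)
    rw [plusNormal, if_neg him.ne', jump, if_neg him.ne', if_pos him]
    refine ⟨mp, mm, h1, h2, ?_⟩
    rw [vecMul_fin_two]
    ext i
    fin_cases i
    · simp [h3]
      ring
    · simp [h4]

end jumps

/-! ### Analyticity, poles and normalization -/

section poles

variable {c : ℝ} {p : ℝ → ℝ} {q : ℝ → ℝ → ℝ}

/-- A function with a limit of `(k - a) f(k)` at an isolated singularity `a` has at most a simple
pole there. -/
lemma meromorphicAt_of_tendsto_sub_mul {f : ℂ → ℂ} {a l : ℂ}
    (hd : ∀ᶠ k in 𝓝[≠] a, DifferentiableAt ℂ f k)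
    (hl : Tendsto (fun k => (k - a) * f k) (𝓝[≠] a) (𝓝 l)) :
    MeromorphicAt f a ∧ (-1 : ℤ) ≤ meromorphicOrderAt f a := by
  set g : ℂ → ℂ := Function.update (fun k => (k - a) * f k) a l with hg
  have hgeq : ∀ k, k ≠ a → g k = (k - a) * f k := fun k hk => Function.update_of_ne hk _ _
  have hga : AnalyticAt ℂ g a := by
    refine analyticAt_of_differentiable_on_punctured_nhds_of_continuousAt ?_ ?_
    · filter_upwards [hd, self_mem_nhdsWithin] with k hk hka
      have h1 : DifferentiableAt ℂ (fun k => (k - a) * f k) k := by fun_prop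
      refine h1.congr_of_eventuallyEq ?_
      filter_upwards [isOpen_ne.mem_nhds hka] with z hz using hgeq z hz
    · rw [continuousAt_iff_punctured_nhds, hg, Function.update_self]
      refine hl.congr' ?_
      filter_upwards [self_mem_nhdsWithin] with k hk using (hgeq k hk).symm
  have hfg : f =ᶠ[𝓝[≠] a] (fun z => (z - a)⁻¹) * g := by
    filter_upwards [self_mem_nhdsWithin] with k hk
    have : k - a ≠ 0 := sub_ne_zero.2 hk
    rw [Pi.mul_apply, hgeq k hk, inv_mul_cancel_left₀ this]
  have hm : MeromorphicAt (fun z : ℂ => z - a) a := by fun_prop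
  have hinv : MeromorphicAt (fun z : ℂ => (z - a)⁻¹) a := hm.inv
  refine ⟨(hinv.mul hga.meromorphicAt).congr hfg.symm, ?_⟩
  rw [meromorphicOrderAt_congr hfg, meromorphicOrderAt_mul hinv hga.meromorphicAt]
  have h1 : meromorphicOrderAt (fun z : ℂ => (z - a)⁻¹) a = (-1 : ℤ) := by
    have := meromorphicOrderAt_zpow_id_sub_const (𝕜 := ℂ) (x := a) (n := -1)
    rw [zpow_neg_one] at this
    exact this
  rw [h1]
  exact le_add_of_nonneg_right hga.meromorphicOrderAt_nonneg

lemma differentiableAt_mVec_upper (hc : 0 < c) (hp : IsSteplikePotential c p) (x : ℝ) {k : ℂ}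
    (hk : 0 < k.im) (hkc : k ∉ contour c) (hW : wronskian c p k ≠ 0) (i : Fin 2) :
    DifferentiableAt ℂ (fun k => mVec c p x k i) k := by
  have h1 := differentiableAt_phiOne hc hp hkc x
  have h2 := differentiableAt_phi hp hk x
  have h3 := differentiableAt_wronskian hc hp hk hkc
  have h4 : DifferentiableAt ℂ (fun k => transT c p k * phiOne c p k x * exp (I * k * x)) k := by
    unfold transT
    fun_prop (disch := assumption)
  have h5 : DifferentiableAt ℂ (fun k => phi p k x * exp (-(I * k * x))) k := by fun_prop
  have hev := eventually_im_pos hk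
  fin_cases i
  · refine h4.congr_of_eventuallyEq (hev.mono fun z hz => ?_)
    simp [mVec, hz]
  · refine h5.congr_of_eventuallyEq (hev.mono fun z hz => ?_)
    simp [mVec, hz]

lemma differentiableAt_mVec_lower (x : ℝ) {k : ℂ} (hk : k.im < 0)
    (h : ∀ i, DifferentiableAt ℂ (fun k => mVec c p x k i) (-k)) (i : Fin 2) :
    DifferentiableAt ℂ (fun k => mVec c p x k i) k := by
  have hev : ∀ᶠ z : ℂ in 𝓝 k, z.im < 0 := continuous_im.continuousAt.eventually_lt_const hk
  have h' : ∀ i, DifferentiableAt ℂ (fun z => mVec c p x (-z) i) k := fun i =>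
    (h i).fun_comp' k (differentiableAt_id.neg)
  fin_cases i
  · refine (h' 1).congr_of_eventuallyEq (hev.mono fun z hz => ?_)
    simp [mVec_neg c p x hz.ne]
  · refine (h' 0).congr_of_eventuallyEq (hev.mono fun z hz => ?_)
    simp [mVec_neg c p x hz.ne]

lemma gammaConst_sq (p : ℝ → ℝ) (κ : ℝ) :
    (gammaConst p κ) ^ 2 = (∫ x : ℝ, ‖phi p (I * κ) x‖ ^ 2)⁻¹ := by
  rw [gammaConst, inv_pow, Real.sq_sqrt (integral_nonneg fun x => by positivity)]

lemma residue_upper (hc : 0 < c) (hq : IsKdVSolution c q) (x t : ℝ) {κ : ℝ} (hκ : c < κ)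
    (hW : wronskian c (fun y => q y 0) (I * κ) = 0) :
    HasResidueCondition (mVec c (fun y => q y t) x) (I * κ)
      !![0, 0; I * (gammaConst (fun y => q y 0) κ : ℂ) ^ 2 * exp (tPhi x t (I * κ)), 0] := by
  have hp := isSteplikePotential hq
  set k₀ : ℂ := I * κ with hk₀
  have hκ0 : 0 < κ := hc.trans hκ
  have him : 0 < k₀.im := by simpa [hk₀] using hκ0
  have hkc : k₀ ∉ contour c := I_mul_notMem_contour hc hκ
  have hk0 : k₀ ≠ 0 := by rintro h; simp [h] at him
  obtain ⟨b, hb0, hb, -, hN, hd⟩ := hasDerivAt_wronskian hc (hp 0) hκ hW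
  rw [← hk₀] at hb hN hd
  have hg : ((gammaConst (fun y => q y 0) κ : ℂ)) ^ 2 =
      ((∫ x : ℝ, ‖phi (fun y => q y 0) k₀ x‖ ^ 2 : ℝ) : ℂ)⁻¹ := by
    rw [← ofReal_pow, gammaConst_sq, ofReal_inv]
  set N : ℂ := ((∫ x : ℝ, ‖phi (fun y => q y 0) k₀ x‖ ^ 2 : ℝ) : ℂ)
  have hN0 : N ≠ 0 := ofReal_ne_zero.2 hN.ne'
  set D : ℂ := 2 * k₀ * b * N with hD
  have hD0 : D ≠ 0 := by simp [hD, hk0, hb0, hN0]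
  have hkOne : ContinuousAt (kOne c) k₀ := (differentiableAt_kOne hc hkc).continuousAt
  set E : ℂ → ℂ := fun k => evolLeft c k (kOne c k) t * evolRight k t with hE
  have hEc : ContinuousAt E k₀ := by
    simp only [hE, evolLeft, evolRight]
    fun_prop
  have hslope : Tendsto (fun k => (k - k₀) / wronskian c (fun y => q y t) k) (𝓝[≠] k₀)
      (𝓝 (E k₀ / D)) := by
    have h1 := (hasDerivAt_iff_tendsto_slope.1 hd).inv₀ hD0
    have h2 := (hEc.tendsto.mono_left (nhdsWithin_le_nhds (s := {k₀}ᶜ))).mul h1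
    rw [← div_eq_mul_inv] at h2
    refine h2.congr' ?_
    filter_upwards [nhdsWithin_le_nhds (eventually_im_pos him)] with k hk
    have h3 := wronskian_evolution hq (le_of_lt hk) t
    have hEk : E k ≠ 0 := mul_ne_zero (evolLeft_ne_zero _ _ _ _) (evolRight_ne_zero _ _)
    change E k * _ = _ at h3
    rw [slope_def_field, hW, sub_zero, inv_div, ← h3, mul_div_assoc', mul_div_mul_left _ _ hEk]
  have hk : Tendsto (fun k : ℂ => k) (𝓝[≠] k₀) (𝓝 k₀) := nhdsWithin_le_nhds
  have hexp : Tendsto (fun k : ℂ => I * k * x) (𝓝[≠] k₀) (𝓝 (I * k₀ * x)) :=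
    (hk.const_mul I).mul_const _
  have hphi : Tendsto (fun k => phi (fun y => q y t) k x) (𝓝[≠] k₀)
      (𝓝 (phi (fun y => q y t) k₀ x)) :=
    (differentiableAt_phi (hp t) him x).continuousAt.tendsto.mono_left nhdsWithin_le_nhds
  have hphiOne : Tendsto (fun k => phiOne c (fun y => q y t) k x) (𝓝[≠] k₀)
      (𝓝 (phiOne c (fun y => q y t) k₀ x)) :=
    (differentiableAt_phiOne hc (hp t) hkc x).continuousAt.tendsto.mono_left nhdsWithin_le_nhds
  have hsecond : Tendsto (fun k => phi (fun y => q y t) k x * exp (-(I * k * x))) (𝓝[≠] k₀)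
      (𝓝 (phi (fun y => q y t) k₀ x * exp (-(I * k₀ * x)))) := hphi.mul hexp.neg.cexp
  set G : ℂ → Fin 2 → ℂ := fun k =>
      ![transT c (fun y => q y t) k * phiOne c (fun y => q y t) k x * exp (I * k * x),
        phi (fun y => q y t) k x * exp (-(I * k * x))] with hG
  have hm : ∀ᶠ k in 𝓝[≠] k₀, G k = mVec c (fun y => q y t) x k := by
    filter_upwards [nhdsWithin_le_nhds (eventually_im_pos him)] with k hk
    rw [mVec, if_pos hk]
  refine ⟨![phi (fun y => q y t) k₀ x * exp (-(I * k₀ * x)) *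
    (I * (gammaConst (fun y => q y 0) κ : ℂ) ^ 2 * exp (tPhi x t k₀)), 0], ?_, ?_⟩
  · have hfirst : Tendsto (fun k => (k - k₀) * (transT c (fun y => q y t) k *
        phiOne c (fun y => q y t) k x * exp (I * k * x))) (𝓝[≠] k₀)
        (𝓝 (phi (fun y => q y t) k₀ x * exp (-(I * k₀ * x)) *
          (I * (gammaConst (fun y => q y 0) κ : ℂ) ^ 2 * exp (tPhi x t k₀)))) := by
      have h1 := (((hk.const_mul (2 * I)).mul hslope).mul hphiOne).mul hexp.cexp
      have h2 := phiOne_evolution hq him.le hb x t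
      have hV : exp (I * k₀ * x) * exp (-(I * k₀ * x)) = 1 := by
        rw [← Complex.exp_add, add_neg_cancel, Complex.exp_zero]
      have h3 : 2 * I * k₀ * (E k₀ / D) * phiOne c (fun y => q y t) k₀ x * exp (I * k₀ * x) =
          phi (fun y => q y t) k₀ x * exp (-(I * k₀ * x)) *
          (I * (gammaConst (fun y => q y 0) κ : ℂ) ^ 2 * exp (tPhi x t k₀)) := by
        rw [hg, exp_tPhi, hD]
        simp only [hE]
        field_simp
        linear_combination (evolRight k₀ t) * h2 -
          (b * evolRight k₀ t ^ 2 * phi (fun y => q y t) k₀ x) * hV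
      rw [h3] at h1
      refine h1.congr fun k => ?_
      rw [transT]
      ring
    refine Tendsto.congr' (f₁ := fun k => (k - k₀) • G k)
      (hm.mono fun k hk => congrArg ((k - k₀) • ·) hk) ?_
    rw [tendsto_pi_nhds]
    intro i
    fin_cases i
    · exact hfirst
    · have h1 := (hk.sub_const k₀).mul hsecond
      rw [sub_self, zero_mul] at h1
      exact h1
  · refine Tendsto.congr' (f₁ := fun k => G k ᵥ* !![0, 0; I * (gammaConst (fun y => q y 0) κ : ℂ) ^ 2 *
      exp (tPhi x t k₀), 0])
      (hm.mono fun k hk => congrArg (· ᵥ* _) hk) ?_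
    simp only [vecMul_fin_two, hG]
    rw [tendsto_pi_nhds]
    intro i
    fin_cases i
    · simpa using hsecond.mul_const
        (I * (gammaConst (fun y => q y 0) κ : ℂ) ^ 2 * exp (tPhi x t k₀))
    · simp

lemma residue_lower (x : ℝ) {a w : ℂ} (ha : a.im ≠ 0)
    (h : HasResidueCondition (mVec c p x) a !![0, 0; w, 0]) :
    HasResidueCondition (mVec c p x) (-a) !![0, -w; 0, 0] := by
  obtain ⟨l, h1, h2⟩ := h
  have hneg : Tendsto (fun k : ℂ => -k) (𝓝[≠] (-a)) (𝓝[≠] a) := by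
    refine tendsto_nhdsWithin_iff.2 ⟨?_, ?_⟩
    · refine Tendsto.mono_left ?_ nhdsWithin_le_nhds
      simpa using (continuous_neg (G := ℂ)).tendsto (-a)
    · filter_upwards [self_mem_nhdsWithin] with k hk
      exact fun h => hk (by rw [Set.mem_singleton_iff, ← h, neg_neg])
  have hev : ∀ᶠ k in 𝓝[≠] (-a), (-k).im ≠ 0 := by
    refine nhdsWithin_le_nhds ?_
    have : Continuous fun k : ℂ => (-k).im := by fun_prop
    exact this.continuousAt.eventually_ne (by simpa using ha)
  set G : ℂ → Fin 2 → ℂ := fun k => ![mVec c p x (-k) 1, mVec c p x (-k) 0] with hG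
  have hm : ∀ᶠ k in 𝓝[≠] (-a), G k = mVec c p x k :=
    hev.mono fun k hk => by simp only [hG]; rw [← mVec_neg c p x hk, neg_neg]
  have h1' := tendsto_pi_nhds.1 (h1.comp hneg)
  have h2' := tendsto_pi_nhds.1 (h2.comp hneg)
  simp only [vecMul_fin_two, Function.comp_def, Pi.smul_apply, smul_eq_mul] at h1' h2'
  refine ⟨![-l 1, -l 0], ?_, ?_⟩
  · refine Tendsto.congr' (f₁ := fun k => (k - -a) • G k)
      (hm.mono fun k hk => congrArg ((k - -a) • ·) hk) ?_
    rw [tendsto_pi_nhds]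
    intro i
    fin_cases i
    · refine (h1' 1).neg.congr fun k => ?_
      simp [hG]
      ring
    · refine (h1' 0).neg.congr fun k => ?_
      simp [hG]
      ring
  · refine Tendsto.congr' (f₁ := fun k => G k ᵥ* !![0, -w; 0, 0])
      (hm.mono fun k hk => congrArg (· ᵥ* _) hk) ?_
    simp only [vecMul_fin_two, hG]
    rw [tendsto_pi_nhds]
    intro i
    fin_cases i
    · refine (h2' 1).neg.congr fun k => ?_
      simp
    · refine (h2' 0).neg.congr fun k => ?_
      simp

lemma tendsto_mVec_imaginary (hc : 0 < c) (hp : IsSteplikePotential c p) (x : ℝ) :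
    Tendsto (fun s : ℝ => mVec c p x (I * s)) atTop (𝓝 ![1, 1]) := by
  have hphi : Tendsto (fun s : ℝ => phi p (I * s) x * exp (-(I * (I * s) * x))) atTop (𝓝 1) := by
    refine (tendsto_jostAmp_imaginary hp.right x).congr' ?_
    filter_upwards [eventually_ge_atTop 0] with s hs
    rw [phi_eq_jost hp.right (by simpa using hs), mul_comm (jost _ _ _), exp_neg_mul_jost]
  have hfirst : Tendsto (fun s : ℝ => transT c p (I * s) * phiOne c p (I * s) x *
      exp (I * (I * s) * x)) atTop (𝓝 1) := by
    have h1 := (tendsto_jostAmp_imaginary hp.left (-x)).comp (tendsto_sqrt_sq_sub c)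
    have h2 : Tendsto (fun s : ℝ => exp (((Real.sqrt (s ^ 2 - c ^ 2) - s) * x : ℝ))) atTop
        (𝓝 1) := by
      have h3 := (tendsto_sqrt_sq_sub_sub c).mul_const x
      rw [zero_mul] at h3
      have h4 := ((Complex.continuous_ofReal.tendsto _).comp h3).cexp
      simpa [Function.comp_def] using h4
    have h5 := ((tendsto_transT hc hp).mul h1).mul h2
    simp only [mul_one] at h5
    refine h5.congr' ?_
    filter_upwards [eventually_ge_atTop c] with s hs
    simp only [Function.comp_apply]
    have h6 : ∀ l : ℂ, jost (leftPot c p) l (-x) =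
        exp (I * l * ((-x : ℝ) : ℂ)) * jostAmp (leftPot c p) l (-x) := fun l => rfl
    simp only [phiOne_eq hp]
    have h7 : exp (((Real.sqrt (s ^ 2 - c ^ 2) - s) * x : ℝ)) =
        exp (I * (I * Real.sqrt (s ^ 2 - c ^ 2)) * ((-x : ℝ) : ℂ)) * exp (I * (I * s) * x) := by
      rw [← Complex.exp_add]
      congr 1
      push_cast
      linear_combination (-(x : ℂ) * ((s : ℂ) - Real.sqrt (s ^ 2 - c ^ 2))) * I_sq
    rw [kOne_imaginary hc hs, h6, h7]
    ring
  have h : Tendsto (fun s : ℝ => ![transT c p (I * s) * phiOne c p (I * s) x *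
      exp (I * (I * s) * x), phi p (I * s) x * exp (-(I * (I * s) * x))]) atTop (𝓝 ![1, 1]) := by
    rw [tendsto_pi_nhds]
    intro i
    fin_cases i
    · exact hfirst
    · exact hphi
  refine h.congr' ?_
  filter_upwards [eventually_gt_atTop 0] with s hs
  rw [mVec, if_pos (by simpa using hs)]

lemma finite_poleSet {N : ℕ} (κ : Fin N → ℝ) : (poleSet κ).Finite := by
  have : poleSet κ ⊆ Set.range (fun j => I * (κ j : ℂ)) ∪ Set.range fun j => -(I * (κ j : ℂ)) := by
    rintro k ⟨j, h | h⟩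
    · exact Or.inl ⟨j, h.symm⟩
    · exact Or.inr ⟨j, h.symm⟩
  exact ((Set.finite_range _).union (Set.finite_range _)).subset this

lemma isRHPSolution_mVec (hc : 0 < c) (hq : IsKdVSolution c q)
    (hnr : wronskian c (fun y => q y 0) (I * c) ≠ 0) {N : ℕ} {κ : Fin N → ℝ}
    (hκ : ∀ s : ℝ, (c < s ∧ wronskian c (fun y => q y 0) (I * s) = 0) ↔ ∃ j, s = κ j)
    (x t : ℝ) :
    IsRHPSolution c (reflR c (fun y => q y 0)) (chi c (fun y => q y 0)) κ
      (fun j => gammaConst (fun y => q y 0) (κ j)) x t (mVec c (fun y => q y t) x) := by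
  have hp := isSteplikePotential hq
  have hκj : ∀ j, c < κ j ∧ wronskian c (fun y => q y 0) (I * κ j) = 0 := fun j =>
    (hκ (κ j)).2 ⟨j, rfl⟩
  have hdiff : ∀ k ∈ (contour c)ᶜ \ poleSet κ, ∀ i,
      DifferentiableAt ℂ (fun k => mVec c (fun y => q y t) x k i) k := by
    have hup : ∀ k ∈ (contour c)ᶜ \ poleSet κ, 0 < k.im → ∀ i,
        DifferentiableAt ℂ (fun k => mVec c (fun y => q y t) x k i) k := by
      intro k hk him
      refine differentiableAt_mVec_upper hc (hp t) x him hk.1 fun hW => hk.2 ?_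
      rw [wronskian_eq_zero_iff hq him.le] at hW
      obtain ⟨s, hs, rfl⟩ := exists_eq_of_wronskian_eq_zero hc (hp 0) him hk.1 hW
      obtain ⟨j, rfl⟩ := (hκ s).1 ⟨hs, hW⟩
      exact ⟨j, Or.inl rfl⟩
    intro k hk
    rcases lt_or_gt_of_ne (im_ne_zero_of_notMem_contour hk.1) with him | him
    · refine differentiableAt_mVec_lower x him (hup (-k) ⟨fun h => hk.1 (neg_mem_contour.1 h), ?_⟩
        (by simpa using him))
      rintro ⟨j, h | h⟩
      · exact hk.2 ⟨j, Or.inr (by rw [← h, neg_neg])⟩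
      · exact hk.2 ⟨j, Or.inl (neg_inj.1 h)⟩
    · exact hup k hk him
  have hopen : IsOpen ((contour c)ᶜ \ poleSet κ) :=
    (isClosed_contour c).isOpen_compl.sdiff (finite_poleSet κ).isClosed
  have hanalytic : ∀ i, AnalyticOnNhd ℂ (fun k => mVec c (fun y => q y t) x k i)
      ((contour c)ᶜ \ poleSet κ) := fun i =>
    DifferentiableOn.analyticOnNhd (fun k hk => (hdiff k hk i).differentiableWithinAt) hopen
  have hupper : ∀ j, HasResidueCondition (mVec c (fun y => q y t) x) (I * κ j)
      !![0, 0; I * (gammaConst (fun y => q y 0) (κ j) : ℂ) ^ 2 *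
        exp (tPhi x t (I * κ j)), 0] := fun j =>
    residue_upper hc hq x t (hκj j).1 (hκj j).2
  have hlower : ∀ j, HasResidueCondition (mVec c (fun y => q y t) x) (-(I * κ j))
      !![0, -(I * (gammaConst (fun y => q y 0) (κ j) : ℂ) ^ 2 *
        exp (tPhi x t (I * κ j))); 0, 0] := fun j =>
    residue_lower x (by simpa using (hc.trans (hκj j).1).ne') (hupper j)
  have hpoles : ∀ i, ∀ a ∈ poleSet κ,
      MeromorphicAt (fun k => mVec c (fun y => q y t) x k i) a ∧
      (-1 : ℤ) ≤ meromorphicOrderAt (fun k => mVec c (fun y => q y t) x k i) a := by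
    intro i a ha
    have hac : a ∉ contour c := by
      obtain ⟨j, rfl | rfl⟩ := ha
      · exact I_mul_notMem_contour hc (hκj j).1
      · exact fun h => I_mul_notMem_contour hc (hκj j).1 (neg_mem_contour.1 h)
    obtain ⟨l, hl⟩ : ∃ l, Tendsto (fun k => (k - a) • mVec c (fun y => q y t) x k) (𝓝[≠] a)
        (𝓝 l) := by
      obtain ⟨j, rfl | rfl⟩ := ha
      · obtain ⟨l, hl, -⟩ := hupper j
        exact ⟨l, hl⟩
      · obtain ⟨l, hl, -⟩ := hlower j
        exact ⟨l, hl⟩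
    refine meromorphicAt_of_tendsto_sub_mul ?_ (tendsto_pi_nhds.1 hl i)
    have h1 : ∀ᶠ k in 𝓝 a, k ∉ contour c := (isClosed_contour c).isOpen_compl.mem_nhds hac
    have h2 : ∀ᶠ k in 𝓝 a, k ∉ poleSet κ \ {a} :=
      ((finite_poleSet κ).subset Set.sdiff_subset).isClosed.isOpen_compl.mem_nhds (by simp)
    filter_upwards [nhdsWithin_le_nhds h1, nhdsWithin_le_nhds h2, self_mem_nhdsWithin]
      with k hk1 hk2 hk3
    exact hdiff k ⟨hk1, fun h => hk2 ⟨h, hk3⟩⟩ i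
  refine ⟨hanalytic, fun i k hk => ?_, fun i a ha => (hpoles i a ha).2,
    fun k hk => jump_condition hc hq hnr x t hk, hupper, hlower, fun k hk => ?_,
    tendsto_mVec_imaginary hc (hp t) x⟩
  · by_cases hkp : k ∈ poleSet κ
    · exact (hpoles i k hkp).1
    · exact (hanalytic i k ⟨hk, hkp⟩).meromorphicAt
  · rw [mVec_neg c _ x (im_ne_zero_of_notMem_contour hk.1), vecMul_fin_two]
    simp

end poles

end SteplikeKdV

end

theorem theorem2p3 (c C₀ : ℝ) (hc : 0 < c) (hC₀ : c < C₀) (q : ℝ → ℝ → ℝ)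
    (hini : SteplikeKdV.IsSteplikeData c C₀ (fun x => q x 0))
    (hsol : SteplikeKdV.IsKdVSolution c q)
    (hnonres : SteplikeKdV.wronskian c (fun x => q x 0) (Complex.I * c) ≠ 0) :
    ∃ (N : ℕ) (κ : Fin N → ℝ),
      StrictMono κ ∧ (∀ j, c < κ j) ∧
      (∀ lam : ℝ, SteplikeKdV.IsEigenvalue (fun x => q x 0) lam ↔ ∃ j, lam = -(κ j) ^ 2) ∧
      ∀ x t : ℝ,
        SteplikeKdV.IsRHPSolution c
          (SteplikeKdV.reflR c (fun y => q y 0))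
          (SteplikeKdV.chi c (fun y => q y 0))
          κ (fun j => SteplikeKdV.gammaConst (fun y => q y 0) (κ j)) x t
          (SteplikeKdV.mVec c (fun y => q y t) x) := by
  have hp := SteplikeKdV.isSteplikePotential hsol 0
  have hfin := SteplikeKdV.finite_zeros hc hp hnonres
  set S := hfin.toFinset with hS
  have hκ : ∀ s : ℝ, (c < s ∧ SteplikeKdV.wronskian c (fun y => q y 0) (Complex.I * s) = 0) ↔
      ∃ j, s = S.orderEmbOfFin rfl j := by
    intro s
    have h1 : s ∈ S ↔ c < s ∧ SteplikeKdV.wronskian c (fun y => q y 0) (Complex.I * s) = 0 := by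
      rw [hS, Set.Finite.mem_toFinset]
      rfl
    have h2 : s ∈ Set.range (S.orderEmbOfFin rfl) ↔ s ∈ S := by
      rw [S.range_orderEmbOfFin rfl, Finset.mem_coe]
    rw [← h1, ← h2, Set.mem_range]
    exact exists_congr fun j => eq_comm
  obtain ⟨M, -, hM⟩ := SteplikeKdV.abs_xDeriv_le hsol 0
  have hbd : ∃ M, ∀ x, |q x 0| ≤ M := ⟨M, fun x => by
    simpa [SteplikeKdV.xDeriv_zero] using hM 0 (by simp) 0 (by norm_num) x⟩
  refine ⟨S.card, S.orderEmbOfFin rfl, (S.orderEmbOfFin rfl).strictMono,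
    fun j => ((hκ _).2 ⟨j, rfl⟩).1, fun lam => ?_,
    SteplikeKdV.isRHPSolution_mVec hc hsol hnonres hκ⟩
  rw [SteplikeKdV.isEigenvalue_iff hc hp hbd lam]
  constructor
  · rintro ⟨s, hs, rfl⟩
    obtain ⟨j, rfl⟩ := (hκ s).1 hs
    exact ⟨j, rfl⟩
  · rintro ⟨j, rfl⟩
    exact ⟨_, (hκ _).2 ⟨j, rfl⟩, rfl⟩
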